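/- Let $\gamma$ be the standard Gaussian measure on $\mathbb R$ and, for $N\ge 1$, let $\sigma^N$ be the uniform probability measure on Kac's sphere $\mathcal{KS}_N=\{V\in\mathbb R^N:\ v_1^2+\dots+v_N^2=N\}$. For probability measures put $H(\mu|\gamma)=\int\log\frac{d\mu}{d\gamma}\,d\mu$ on $\mathbb R$ and $H(G|\sigma^N)=\frac1N\int\log\frac{dG}{d\sigma^N}\,dG$ on $\mathcal{KS}_N$ (with value $+\infty$ if the measure is not absolutely continuous or the integral diverges). For a measurable $f:\mathbb R\to[0,\infty)$ let $$Z_N(f)=\int_{\mathcal{KS}_N} f^{\otimes N}\,d\sigma^N,\qquad F^N=[f^{\otimes N}]_{\mathcal{KS}_N}:=\frac{1}{Z_N(f)}\,f^{\otimes N}\,\sigma^N\quad\text{when } 0<Z_N(f)<\infty .$$ Theorem. For all $p\in(1,\infty]$ and $A,M\ge 0$ there are a constant $C=C(p,A,M)$ and an integer $N_0=N_0(p,A,M)$ such that the following holds. Let $f$ be a probability density on $\mathbb R$ with $f\in L^p(\mathbb R)$, $\|f\|_{L^p}=A$, $M_6(f):=\int(1+v^2)^{3}f(v)\,dv=M<\infty$,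 $\int v f(v)\,dv=0$ and $\int v^2f(v)\,dv=1$. Then, for every $N\ge N_0$, one has $0<Z_N(f)<\infty$ (so that $F^N$ is well defined), $H(F^N|\sigma^N)<\infty$ and $$\bigl|H(F^N|\sigma^N)-H(f|\gamma)\bigr|\le\frac{C}{\sqrt N}.$$ Moreover $(F^N)$ is $f$-entropy chaotic: for $N$ large $F^N$ is a probability measure on $\mathcal{KS}_N$ invariant under permutations of the coordinates, the law of the first coordinate under $F^N$ converges weakly to $f(v)\,dv$ as $N\to\infty$, and $H(F^N|\sigma^N)\to H(f|\gamma)<\infty$. -/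

import Mathlib

open MeasureTheory ProbabilityTheory Filter Topology
open scoped ENNReal BoundedContinuousFunction

noncomputable section

namespace KacSphere

/-- The uniform probability measure on `ℝ^N` carried by the centred sphere of radius `r`
(for `N ≥ 1`): the normalised surface measure of the unit sphere, transported by `x ↦ r x`. -/
def uniformSphere (N : ℕ) (r : ℝ) : Measure (EuclideanSpace ℝ (Fin N)) :=
  ((volume : Measure (EuclideanSpace ℝ (Fin N))).toSphere Set.univ)⁻¹ •
    (volume : Measure (EuclideanSpace ℝ (Fin N))).toSphere.map
      (fun x : Metric.sphere (0 : EuclideanSpace ℝ (Fin N)) 1 =>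
        r • (x : EuclideanSpace ℝ (Fin N)))

/-- `σ^N`, the uniform probability measure on Kac's sphere `v₁² + ⋯ + v_N² = N`. -/
def kacMeasure (N : ℕ) : Measure (EuclideanSpace ℝ (Fin N)) :=
  uniformSphere N (Real.sqrt N)

/-- The tensor power `f^{⊗N}` of a nonnegative function, with values in `[0, ∞]`. -/
def tensorPower (f : ℝ → ℝ) (N : ℕ) (V : EuclideanSpace ℝ (Fin N)) : ℝ≥0∞ :=
  ∏ i, ENNReal.ofReal (f (V i))

/-- `Z_N(f; r)`, the integral of `f^{⊗N}` against the uniform measure on the sphere of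
radius `r`. -/
def partitionFunction (f : ℝ → ℝ) (N : ℕ) (r : ℝ) : ℝ≥0∞ :=
  ∫⁻ V, tensorPower f N V ∂(uniformSphere N r)

/-- The conditioned product measure `F^N = Z_N(f; √N)⁻¹ f^{⊗N} σ^N` on Kac's sphere.
It is meaningful when `0 < Z_N(f; √N) < ∞`. -/
def conditionedProduct (f : ℝ → ℝ) (N : ℕ) : Measure (EuclideanSpace ℝ (Fin N)) :=
  (partitionFunction f N (Real.sqrt N))⁻¹ • (kacMeasure N).withDensity (tensorPower f N)

/-- The measure `f(v) dv` on the real line. -/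
def densityMeasure (f : ℝ → ℝ) : Measure ℝ :=
  volume.withDensity (fun v => ENNReal.ofReal (f v))

/-- The moment `M_k(f) = ∫ ⟨v⟩^k f(v) dv`, with `⟨v⟩ = (1 + v²)^{1/2}`. -/
def moment (k : ℕ) (f : ℝ → ℝ) : ℝ :=
  ∫ v, Real.sqrt (1 + v ^ 2) ^ k * f v

/-- The normalised relative entropy `H(G | σ) = (1/N) ∫ log (dG/dσ) dG` of two probability
measures on `ℝ^N`; it is `∞` if `G` is not absolutely continuous with respect to `σ`, or if the
integral diverges. -/
def relEntropy (N : ℕ) (G σ : Measure (EuclideanSpace ℝ (Fin N))) : ℝ≥0∞ :=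
  InformationTheory.klDiv G σ / N

/-- The relative entropy `H(μ | γ)` of a probability measure on the line with respect to the
standard Gaussian measure `γ`. -/
def relEntropyGaussian (μ : Measure ℝ) : ℝ≥0∞ :=
  InformationTheory.klDiv μ (gaussianReal 0 1)

/-- The law of the first coordinate (for `N ≥ 1`). -/
def firstMarginal (N : ℕ) (G : Measure (EuclideanSpace ℝ (Fin N))) : Measure ℝ :=
  if h : 0 < N then G.map (fun V => V ⟨0, h⟩) else 0

/-- `G` is a probability measure carried by Kac's sphere `|V|² = N` and invariant under
permutations of the coordinates. -/
structure IsSymmetricOnKacSphere (N : ℕ) (G : Measure (EuclideanSpace ℝ (Fin N))) : Prop where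
  isProbability : IsProbabilityMeasure G
  carried : ∀ᵐ V ∂G, ∑ i, V i ^ 2 = (N : ℝ)
  symmetric : ∀ e : Equiv.Perm (Fin N), G.map (fun V => WithLp.toLp 2 (fun i => V (e i))) = G

/-- `(G^N)`, a sequence of symmetric probability measures on Kac's spheres (defined for `N`
large), is `μ`-entropy chaotic: `G^N_1 ⇀ μ` weakly, `H(G^N | σ^N) → H(μ | γ)` and
`H(μ | γ) < ∞`. -/
structure IsEntropyChaotic (G : ∀ N : ℕ, Measure (EuclideanSpace ℝ (Fin N)))
    (μ : Measure ℝ) : Prop where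
  mem : ∀ᶠ N in atTop, IsSymmetricOnKacSphere N (G N)
  weak : ∀ φ : ℝ →ᵇ ℝ,
    Tendsto (fun N => ∫ v, φ v ∂(firstMarginal N (G N))) atTop (𝓝 (∫ v, φ v ∂μ))
  entropy : Tendsto (fun N => relEntropy N (G N) (kacMeasure N)) atTop (𝓝 (relEntropyGaussian μ))
  finite : relEntropyGaussian μ < ∞

end KacSphere

end

/-!
For independent `vᵢ` of law `f(v) dv`, write `S_N` for the density of `v₁² + ⋯ + v_N²`. Up to a
factor independent of `f`, `Z_N(f)` is `S_N(N)`, and the law of one coordinate under the conditioned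
product is `ϑ(v) f(v) dv` with `ϑ(v) = S_{N-1}(N - v²) / S_N(N)`
(`map_apply_conditionedProduct`). Hence
`H(F^N | σ^N) = ∫ ϑ f log f - (1/N) log Z_N(f)` (`relEntropy_conditionedProduct`). The Gaussian
tensor power is constant on the sphere, so that comparing `f` with the Gaussian gives
`log Z_N(f) = log S_N(N) - log S_N^γ(N) - N (log √(2π) + 1/2)`, while
`H(f | γ) = ∫ f log f + log √(2π) + 1/2`. The difference of the two entropies is therefore
`∫ (ϑ - 1) f log f - (1/N) (log S_N(N) - log S_N^γ(N))`.

Both terms are `O(1/√N)` as soon as `c/√N ≤ S_N(N) ≤ D`,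
`|S_{N-1}(N - v²) - S_N(N)| ≤ C (1 + v²)/N` (`exists_sumDensity_estimates`) and
`∫ f |log f| (1 + v²)` is bounded (`exists_integral_log_le`): the first gives
`|log S_N(N)| = O(√N)`, which the factor `1/N` absorbs, and the first two together give
`|ϑ - 1| = O((1 + v²)/√N)`. The full local limit theorem for `S_N` is not needed.

The estimates on `S_N` come from `S_N(u) = (2π)⁻¹ ∫ Φ(t)^N e^{-itu} dt`, where `Φ` is the
characteristic function of `v²` (`sumDensity_eq_ofReal_charInv`). A power of `Φ` is integrable: for
bounded `f` the law of `v₁² + v₂²` has a bounded density, so `Φ ∈ L⁴` by Plancherel, and truncation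
extends this to `f ∈ L^q` with a larger power
(`exists_integral_norm_charFun_squareLaw_pow_le`). This integrability also bounds the variance of
`v²` from below and `|Φ|` away from `1` outside a neighbourhood of the origin, with constants
depending only on `q > 1` and the bounds on `∫ f ^ q` and on the sixth moment. The latter, a third
moment for `v²`, gives the Taylor expansion of `Φ` at the origin (`exists_charFun_estimates`).
-/

namespace KacSphere

open Set

/-! ### Disintegration of Lebesgue measure into spheres -/

/-- The disintegration of Lebesgue measure on `ℝ^N` along `x ↦ ‖x‖ ^ 2`, at the value `u`: the
image of the surface measure of the unit sphere under `x ↦ √u x`, with the weight `√u ^ N / (2 u)`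
coming from `r = √u` in `r ^ (N - 1) dr`. For `N ≠ 0` it vanishes at `u ≤ 0`, since then
`√u = 0`. -/
noncomputable def fiberMeasure (N : ℕ) (u : ℝ) : Measure (EuclideanSpace ℝ (Fin N)) :=
  ENNReal.ofReal (√u ^ N / (2 * u)) •
    (volume : Measure (EuclideanSpace ℝ (Fin N))).toSphere.map
      (fun x : Metric.sphere (0 : EuclideanSpace ℝ (Fin N)) 1 =>
        √u • (x : EuclideanSpace ℝ (Fin N)))

lemma lintegral_fiberMeasure (N : ℕ) (u : ℝ) {F : EuclideanSpace ℝ (Fin N) → ℝ≥0∞}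
    (hF : Measurable F) :
    ∫⁻ x, F x ∂(fiberMeasure N u) = ENNReal.ofReal (√u ^ N / (2 * u)) *
      ∫⁻ ω : Metric.sphere (0 : EuclideanSpace ℝ (Fin N)) 1, F (√u • (ω : EuclideanSpace ℝ (Fin N)))
        ∂(volume : Measure (EuclideanSpace ℝ (Fin N))).toSphere := by
  rw [fiberMeasure, lintegral_smul_measure, lintegral_map hF (by fun_prop), smul_eq_mul]

lemma fiberMeasure_of_nonpos {N : ℕ} (hN : N ≠ 0) {u : ℝ} (hu : u ≤ 0) : fiberMeasure N u = 0 := by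
  simp [fiberMeasure, Real.sqrt_eq_zero_of_nonpos hu, hN]

lemma measurable_lintegral_fiberMeasure {α : Type*} [MeasurableSpace α] {N : ℕ} {w : α → ℝ}
    (hw : Measurable w) {F : α → EuclideanSpace ℝ (Fin N) → ℝ≥0∞}
    (hF : Measurable (Function.uncurry F)) :
    Measurable fun a => ∫⁻ x, F a x ∂(fiberMeasure N (w a)) := by
  have h : ∀ a, ∫⁻ x, F a x ∂(fiberMeasure N (w a)) = ENNReal.ofReal (√(w a) ^ N / (2 * w a)) *
      ∫⁻ ω : Metric.sphere (0 : EuclideanSpace ℝ (Fin N)) 1,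
        F a (√(w a) • (ω : EuclideanSpace ℝ (Fin N)))
        ∂(volume : Measure (EuclideanSpace ℝ (Fin N))).toSphere := fun a =>
    lintegral_fiberMeasure N (w a) (hF.comp measurable_prodMk_left)
  simp_rw [h]
  refine Measurable.mul (by fun_prop) ?_
  refine Measurable.lintegral_prod_right'
    (f := fun p : α × Metric.sphere (0 : EuclideanSpace ℝ (Fin N)) 1 =>
      F p.1 (√(w p.1) • (p.2 : EuclideanSpace ℝ (Fin N)))) ?_
  have h2 : Measurable fun p : α × Metric.sphere (0 : EuclideanSpace ℝ (Fin N)) 1 =>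
      (p.1, √(w p.1) • (p.2 : EuclideanSpace ℝ (Fin N))) := by fun_prop
  exact hF.comp h2

/-- Polar coordinates, with the squared radius as parameter. -/
lemma lintegral_eq_lintegral_fiberMeasure {n : ℕ}
    {F : EuclideanSpace ℝ (Fin (n + 1)) → ℝ≥0∞} (hF : Measurable F) :
    ∫⁻ x, F x = ∫⁻ u : ℝ, ∫⁻ x, F x ∂(fiberMeasure (n + 1) u) := by
  let E := EuclideanSpace ℝ (Fin (n + 1))
  set G : ℝ → ℝ≥0∞ := fun r => ∫⁻ ω : Metric.sphere (0 : E) 1, F (r • (ω : E))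
    ∂(volume : Measure E).toSphere with hG
  have hGm : Measurable G := by
    refine Measurable.lintegral_prod_right' (f := fun p : ℝ × Metric.sphere (0 : E) 1 =>
      F (p.1 • (p.2 : E))) ?_
    fun_prop
  -- polar coordinates with the radius as parameter
  have h1 : ∫⁻ x, F x = ∫⁻ r in Ioi (0 : ℝ), ENNReal.ofReal (r ^ n) * G r := by
    have hmp := (volume : Measure E).measurePreserving_homeomorphUnitSphereProd
    calc ∫⁻ x, F x = ∫⁻ x in ({0}ᶜ : Set E), F x := by rw [restrict_compl_singleton]
      _ = ∫⁻ x : ({0}ᶜ : Set E), F x ∂((volume : Measure E).comap Subtype.val) :=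
          (lintegral_subtype_comap (measurableSet_singleton _).compl _).symm
      _ = ∫⁻ p, F ((homeomorphUnitSphereProd E).symm p)
            ∂((volume : Measure E).toSphere.prod (.volumeIoiPow (Module.finrank ℝ E - 1))) := by
          rw [← hmp.lintegral_comp_emb (Homeomorph.measurableEmbedding _)]
          simp
      _ = ∫⁻ r : Ioi (0 : ℝ), G r ∂(.volumeIoiPow (Module.finrank ℝ E - 1)) := by
          rw [lintegral_prod_symm' (fun p => F ((homeomorphUnitSphereProd E).symm p))
            (hF.comp (measurable_subtype_coe.comp (Homeomorph.measurable _)))]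
          simp [hG, homeomorphUnitSphereProd_symm_apply_coe]
      _ = ∫⁻ r in Ioi (0 : ℝ), ENNReal.ofReal (r ^ n) * G r := by
          rw [Measure.volumeIoiPow, lintegral_withDensity_eq_lintegral_mul _ (by fun_prop)
            (g := fun r : Ioi (0 : ℝ) => G r) (hGm.comp measurable_subtype_coe)]
          rw [← lintegral_subtype_comap measurableSet_Ioi]
          simp [E]
  have himg : (fun u : ℝ => √u) '' Ioi 0 = Ioi 0 := by
    ext r
    constructor
    · rintro ⟨u, hu, rfl⟩
      exact Real.sqrt_pos.2 hu
    · intro hr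
      exact ⟨r ^ 2, pow_pos (mem_Ioi.1 hr) 2, Real.sqrt_sq (mem_Ioi.1 hr).le⟩
  have h2 := lintegral_image_eq_lintegral_abs_deriv_mul (s := Ioi (0 : ℝ)) (f := fun u => √u)
    (f' := fun u => 1 / (2 * √u)) measurableSet_Ioi
    (fun u hu => (Real.hasDerivAt_sqrt (mem_Ioi.1 hu).ne').hasDerivWithinAt)
    (fun a ha b hb hab => (Real.sqrt_inj (mem_Ioi.1 ha).le (mem_Ioi.1 hb).le).1 hab)
    (fun r => ENNReal.ofReal (r ^ n) * G r)
  rw [himg] at h2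
  rw [h1, h2, ← lintegral_indicator measurableSet_Ioi]
  refine lintegral_congr fun u => ?_
  by_cases hu : 0 < u
  · rw [indicator_of_mem (mem_Ioi.2 hu), lintegral_fiberMeasure _ _ hF, ← mul_assoc,
      ← ENNReal.ofReal_mul (abs_nonneg _)]
    congr 2
    have hs := Real.sqrt_pos.2 hu
    rw [abs_of_pos (by positivity)]
    nth_rewrite 4 [← Real.mul_self_sqrt hu.le]
    field_simp
    ring
  · rw [indicator_of_notMem (by simpa using hu), fiberMeasure_of_nonpos (by simp) (not_lt.1 hu)]
    simp

/-- Scaling of the fibres: `fiberMeasure N` has degree of homogeneity `N / 2 - 1` in `u`. -/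
lemma lintegral_fiberMeasure_mul {N : ℕ} {c : ℝ} (hc : 0 < c) (u : ℝ)
    {F : EuclideanSpace ℝ (Fin N) → ℝ≥0∞} (hF : Measurable F) :
    ∫⁻ x, F x ∂(fiberMeasure N (c * u)) =
      ENNReal.ofReal (√c ^ N / c) * ∫⁻ x, F (√c • x) ∂(fiberMeasure N u) := by
  rw [lintegral_fiberMeasure _ _ hF, lintegral_fiberMeasure N u (F := fun x => F (√c • x))
    (by fun_prop), ← mul_assoc (ENNReal.ofReal (√c ^ N / c)),
    ← ENNReal.ofReal_mul (by positivity)]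
  simp_rw [smul_smul, Real.sqrt_mul hc.le]
  congr 2
  rw [mul_pow]
  field_simp

/-- The point of `ℝ^(n + 1)` with first coordinate `v` and remaining coordinates `x`. -/
def consE {n : ℕ} (v : ℝ) (x : EuclideanSpace ℝ (Fin n)) : EuclideanSpace ℝ (Fin (n + 1)) :=
  WithLp.toLp 2 (Fin.cons v (WithLp.ofLp x) : Fin (n + 1) → ℝ)

@[simp] lemma consE_zero {n : ℕ} (v : ℝ) (x : EuclideanSpace ℝ (Fin n)) : consE v x 0 = v := rfl

@[simp] lemma consE_succ {n : ℕ} (v : ℝ) (x : EuclideanSpace ℝ (Fin n)) (i : Fin n) :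
    consE v x i.succ = x i := rfl

@[fun_prop]
lemma measurable_consE {n : ℕ} :
    Measurable fun p : ℝ × EuclideanSpace ℝ (Fin n) => consE p.1 p.2 := by
  refine (WithLp.measurable_toLp 2 _).comp (measurable_pi_lambda _ fun i => ?_)
  refine Fin.cases ?_ (fun j => ?_) i
  · exact measurable_fst
  · simp only [Fin.cons_succ]
    fun_prop

lemma smul_consE {n : ℕ} (c v : ℝ) (x : EuclideanSpace ℝ (Fin n)) :
    c • consE v x = consE (c * v) (c • x) := by
  ext i
  refine Fin.cases ?_ (fun j => ?_) i <;> simp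

lemma norm_sq_consE {n : ℕ} (v : ℝ) (x : EuclideanSpace ℝ (Fin n)) :
    ‖consE v x‖ ^ 2 = v ^ 2 + ‖x‖ ^ 2 := by
  simp [EuclideanSpace.norm_sq_eq, Fin.sum_univ_succ]

lemma lintegral_consE {n : ℕ} {F : EuclideanSpace ℝ (Fin (n + 1)) → ℝ≥0∞} (hF : Measurable F) :
    ∫⁻ x, F x = ∫⁻ v : ℝ, ∫⁻ x, F (consE v x) := by
  have h1 := (volume_preserving_piFinSuccAbove (fun _ : Fin (n + 1) => ℝ) 0).symm
  have h2 := PiLp.volume_preserving_toLp (Fin (n + 1))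
  have h3 := PiLp.volume_preserving_toLp (Fin n)
  have hF2 := hF.comp h2.measurable
  rw [← h2.lintegral_comp hF]
  change ∫⁻ a, (F ∘ WithLp.toLp 2) a = _
  rw [← h1.lintegral_comp hF2, Measure.volume_eq_prod,
    lintegral_prod (fun a => (F ∘ WithLp.toLp 2)
      ((MeasurableEquiv.piFinSuccAbove (fun _ => ℝ) 0).symm a))
      (hF2.comp h1.measurable).aemeasurable]
  refine lintegral_congr fun v => ?_
  rw [← h3.lintegral_comp (f := fun x => F (consE v x)) (by fun_prop)]
  refine lintegral_congr fun x => ?_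
  simp [consE, MeasurableEquiv.piFinSuccAbove, Fin.insertNthEquiv]

lemma lintegral_fiberMeasure_congr {N : ℕ} (hN : N ≠ 0) {u : ℝ}
    {F G : EuclideanSpace ℝ (Fin N) → ℝ≥0∞} (hF : Measurable F) (hG : Measurable G)
    (h : ∀ x, ‖x‖ ^ 2 = u → F x = G x) :
    ∫⁻ x, F x ∂(fiberMeasure N u) = ∫⁻ x, G x ∂(fiberMeasure N u) := by
  rcases le_or_gt u 0 with hu | hu
  · simp [fiberMeasure_of_nonpos hN hu]
  rw [lintegral_fiberMeasure _ _ hF, lintegral_fiberMeasure _ _ hG]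
  congr 1
  refine lintegral_congr fun ω => h _ ?_
  rw [norm_smul, norm_eq_of_mem_sphere, mul_one, Real.norm_of_nonneg (Real.sqrt_nonneg _),
    Real.sq_sqrt hu.le]

/-- The integral of `F` over the sphere `‖x‖ ^ 2 = u`, computed by fixing the first coordinate `v`
and integrating the others over the sphere of squared radius `u - v ^ 2`. -/
noncomputable def sliceIntegral (n : ℕ) (F : EuclideanSpace ℝ (Fin (n + 1)) → ℝ≥0∞) (u : ℝ) :
    ℝ≥0∞ :=
  ∫⁻ v : ℝ, ∫⁻ x, F (consE v x) ∂(fiberMeasure n (u - v ^ 2))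

lemma lintegral_eq_mul_lintegral_comp_mul {a : ℝ} (ha : 0 < a) {g : ℝ → ℝ≥0∞} (hg : Measurable g) :
    ∫⁻ v, g v = ENNReal.ofReal a * ∫⁻ w, g (a * w) := by
  conv_lhs => rw [← Real.smul_map_volume_mul_left ha.ne']
  rw [lintegral_smul_measure, lintegral_map hg (by fun_prop), abs_of_pos ha, smul_eq_mul]

lemma measurable_sliceIntegrand {n : ℕ} {F : EuclideanSpace ℝ (Fin (n + 1)) → ℝ≥0∞}
    (hF : Measurable F) : Measurable fun p : ℝ × ℝ =>
      ∫⁻ x, F (consE p.1 x) ∂(fiberMeasure n (p.2 - p.1 ^ 2)) := by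
  refine measurable_lintegral_fiberMeasure (w := fun p : ℝ × ℝ => p.2 - p.1 ^ 2)
    (F := fun (p : ℝ × ℝ) x => F (consE p.1 x)) (by fun_prop) ?_
  have : Measurable fun q : (ℝ × ℝ) × EuclideanSpace ℝ (Fin n) => consE q.1.1 q.2 :=
    measurable_consE.comp (by fun_prop : Measurable fun q : (ℝ × ℝ) × EuclideanSpace ℝ (Fin n) =>
      (q.1.1, q.2))
  exact hF.comp this

lemma sliceIntegral_mul {n : ℕ} {F : EuclideanSpace ℝ (Fin (n + 1)) → ℝ≥0∞} (hF : Measurable F)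
    {c : ℝ} (hc : 0 < c) (u : ℝ) :
    sliceIntegral n F (c * u) =
      ENNReal.ofReal (√c ^ (n + 1) / c) * sliceIntegral n (fun x => F (√c • x)) u := by
  have hs := Real.sqrt_pos.2 hc
  have hm : Measurable fun v => ∫⁻ x, F (consE v x) ∂(fiberMeasure n (c * u - v ^ 2)) :=
    (measurable_sliceIntegrand hF).comp (g := fun p : ℝ × ℝ =>
      ∫⁻ x, F (consE p.1 x) ∂(fiberMeasure n (p.2 - p.1 ^ 2))) (f := fun v : ℝ => (v, c * u))
      (by fun_prop)
  rw [sliceIntegral, lintegral_eq_mul_lintegral_comp_mul hs hm, sliceIntegral]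
  have h : ∀ w : ℝ, ∫⁻ x, F (consE (√c * w) x) ∂(fiberMeasure n (c * u - (√c * w) ^ 2)) =
      ENNReal.ofReal (√c ^ n / c) * ∫⁻ x, F (√c • consE w x) ∂(fiberMeasure n (u - w ^ 2)) := by
    intro w
    have hw : c * u - (√c * w) ^ 2 = c * (u - w ^ 2) := by
      rw [mul_pow, Real.sq_sqrt hc.le, mul_sub]
    rw [hw, lintegral_fiberMeasure_mul hc _ (F := fun x => F (consE (√c * w) x)) (by fun_prop)]
    simp_rw [smul_consE]
  rw [lintegral_congr h, lintegral_const_mul' _ _ ENNReal.ofReal_ne_top, ← mul_assoc,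
    ← ENNReal.ofReal_mul hs.le, pow_succ, mul_comm (√c ^ n) (√c), mul_div_assoc]

lemma lintegral_eq_lintegral_sliceIntegral {n : ℕ}
    {F : EuclideanSpace ℝ (Fin (n + 2)) → ℝ≥0∞} (hF : Measurable F) :
    ∫⁻ x, F x = ∫⁻ u : ℝ, sliceIntegral (n + 1) F u := by
  rw [lintegral_consE hF]
  have h : ∀ v : ℝ, ∫⁻ x, F (consE v x) =
      ∫⁻ u : ℝ, ∫⁻ x, F (consE v x) ∂(fiberMeasure (n + 1) (u - v ^ 2)) := by
    intro v
    rw [lintegral_eq_lintegral_fiberMeasure (by fun_prop)]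
    exact (lintegral_sub_right_eq_self
      (fun u => ∫⁻ x, F (consE v x) ∂(fiberMeasure (n + 1) u)) (v ^ 2)).symm
  simp_rw [h]
  exact lintegral_lintegral_swap (measurable_sliceIntegrand hF).aemeasurable

lemma sliceIntegral_congr {n : ℕ} (hn : n ≠ 0) {u : ℝ}
    {F G : EuclideanSpace ℝ (Fin (n + 1)) → ℝ≥0∞} (hF : Measurable F) (hG : Measurable G)
    (h : ∀ x, ‖x‖ ^ 2 = u → F x = G x) :
    sliceIntegral n F u = sliceIntegral n G u := by
  refine lintegral_congr fun v => lintegral_fiberMeasure_congr hn (by fun_prop) (by fun_prop)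
    fun x hx => h _ ?_
  rw [norm_sq_consE, hx]
  ring

/-- Slicing of a sphere by its first coordinate, valid at every `u > 0`. Comparing the two
disintegrations of Lebesgue measure would give it only for almost every `u`; both sides are,
however, homogeneous in `u` with the same degree when `F` is homogeneous of degree `0`, and only the
values of `F` on one sphere matter. -/
theorem lintegral_fiberMeasure_succ {n : ℕ} {F : EuclideanSpace ℝ (Fin (n + 2)) → ℝ≥0∞}
    (hF : Measurable F) {u : ℝ} (hu : 0 < u) :
    ∫⁻ x, F x ∂(fiberMeasure (n + 2) u) =
      ∫⁻ v : ℝ, ∫⁻ x, F (consE v x) ∂(fiberMeasure (n + 1) (u - v ^ 2)) := by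
  change _ = sliceIntegral (n + 1) F u
  set G : EuclideanSpace ℝ (Fin (n + 2)) → ℝ≥0∞ := fun x => F ((√u / ‖x‖) • x) with hG
  have hGm : Measurable G := by fun_prop
  have hGF : ∀ x, ‖x‖ ^ 2 = u → F x = G x := by
    intro x hx
    have : ‖x‖ = √u := by rw [← hx, Real.sqrt_sq (norm_nonneg _)]
    simp [hG, this, (Real.sqrt_pos.2 hu).ne']
  have hGhom : ∀ c : ℝ, 0 < c → (fun x => G (√c • x)) = G := by
    intro c hc
    have hs := Real.sqrt_pos.2 hc
    ext x
    simp only [hG, norm_smul, smul_smul, Real.norm_of_nonneg hs.le]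
    congr 2
    field_simp
  rw [lintegral_fiberMeasure_congr (by simp) hF hGm hGF, sliceIntegral_congr (by simp) hF hGm hGF]
  have hA : ∀ w, 0 < w → ∫⁻ x, G x ∂(fiberMeasure (n + 2) w) =
      ENNReal.ofReal (√w ^ (n + 2) / w) * ∫⁻ x, G x ∂(fiberMeasure (n + 2) 1) := by
    intro w hw
    have := lintegral_fiberMeasure_mul (N := n + 2) hw 1 hGm
    rwa [mul_one, hGhom w hw] at this
  have hT : ∀ w, 0 < w → sliceIntegral (n + 1) G w =
      ENNReal.ofReal (√w ^ (n + 2) / w) * sliceIntegral (n + 1) G 1 := by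
    intro w hw
    have := sliceIntegral_mul (n := n + 1) hGm hw 1
    rwa [mul_one, hGhom w hw] at this
  rw [hA u hu, hT u hu]
  congr 1
  -- integrate the degree-zero homogeneous `G` over the unit ball in both ways
  set J : EuclideanSpace ℝ (Fin (n + 2)) → ℝ≥0∞ :=
    fun x => (Iic (1 : ℝ)).indicator 1 (‖x‖ ^ 2) * G x with hJ
  have hJm : Measurable J := by
    refine Measurable.mul ?_ hGm
    exact (measurable_one.indicator measurableSet_Iic).comp (by fun_prop)
  set I : ℝ≥0∞ := ∫⁻ w in Ioc (0 : ℝ) 1, ENNReal.ofReal (√w ^ (n + 2) / w) with hI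
  have hJA : ∫⁻ x, J x = I * ∫⁻ x, G x ∂(fiberMeasure (n + 2) 1) := by
    rw [lintegral_eq_lintegral_fiberMeasure hJm, hI, ← lintegral_mul_const _ (by fun_prop),
      ← lintegral_indicator measurableSet_Ioc]
    refine lintegral_congr fun w => ?_
    rcases le_or_gt w 0 with hw | hw
    · simp [fiberMeasure_of_nonpos, hw, indicator, hw.not_gt]
    have hc : ∫⁻ x, J x ∂(fiberMeasure (n + 2) w) =
        ∫⁻ x, (Iic (1 : ℝ)).indicator 1 w * G x ∂(fiberMeasure (n + 2) w) :=
      lintegral_fiberMeasure_congr (by simp) hJm (by fun_prop) fun x hx => by simp [hJ, hx]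
    rw [hc, lintegral_const_mul _ hGm, hA w hw]
    by_cases h1 : w ≤ 1 <;> simp [indicator, hw, h1]
  have hJT : ∫⁻ x, J x = I * sliceIntegral (n + 1) G 1 := by
    rw [lintegral_eq_lintegral_sliceIntegral hJm, hI, ← lintegral_mul_const _ (by fun_prop),
      ← lintegral_indicator measurableSet_Ioc]
    refine lintegral_congr fun w => ?_
    rcases le_or_gt w 0 with hw | hw
    · have : ∀ v : ℝ, fiberMeasure (n + 1) (w - v ^ 2) = 0 := fun v =>
        fiberMeasure_of_nonpos (by simp) (by nlinarith [sq_nonneg v])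
      simp [sliceIntegral, this, indicator, hw.not_gt]
    have hc : sliceIntegral (n + 1) J w =
        sliceIntegral (n + 1) (fun x => (Iic (1 : ℝ)).indicator 1 w * G x) w :=
      sliceIntegral_congr (by simp) hJm (by fun_prop) fun x hx => by simp [hJ, hx]
    rw [hc]
    by_cases h1 : w ≤ 1
    · simp only [indicator, mem_Iic, h1, if_true, mem_Ioc, hw, and_self, Pi.one_apply, one_mul]
      exact hT w hw
    · simp [indicator, h1, sliceIntegral]
  have hI0 : I ≠ 0 := by
    refine ((setLIntegral_pos_iff (by fun_prop)).2 ?_).ne'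
    have : Ioc (0 : ℝ) 1 ⊆ (Function.support fun w => ENNReal.ofReal (√w ^ (n + 2) / w)) ∩
        Ioc (0 : ℝ) 1 := by
      refine subset_inter (fun w hw => ?_) subset_rfl
      have := Real.sqrt_pos.2 hw.1
      have hw0 := hw.1
      simp only [Function.mem_support, ne_eq, ENNReal.ofReal_eq_zero, not_le]
      positivity
    refine lt_of_lt_of_le ?_ (measure_mono this)
    simp
  have hItop : I ≠ ∞ := by
    refine (lt_of_le_of_lt (setLIntegral_mono (g := fun _ => 1) measurable_const fun w hw => ?_)
      (by simp)).ne
    rw [ENNReal.ofReal_le_one, div_le_one hw.1, pow_add, Real.sq_sqrt hw.1.le]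
    exact mul_le_of_le_one_left hw.1.le
      (pow_le_one₀ (Real.sqrt_nonneg _) (Real.sqrt_le_one.2 hw.2))
  exact (ENNReal.mul_right_inj hI0 hItop).1 (hJA.symm.trans hJT)

/-! ### Densities of sums of squares -/

@[fun_prop]
lemma measurable_tensorPower {f : ℝ → ℝ} (hf : Measurable f) (N : ℕ) :
    Measurable (tensorPower f N) := by
  unfold tensorPower
  fun_prop

lemma tensorPower_consE (f : ℝ → ℝ) {n : ℕ} (v : ℝ) (x : EuclideanSpace ℝ (Fin n)) :
    tensorPower f (n + 1) (consE v x) = ENNReal.ofReal (f v) * tensorPower f n x := by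
  simp [tensorPower, Fin.prod_univ_succ]

/-- The integral of `f^{⊗N}` over the fibre `‖V‖ ^ 2 = u`; for a probability density `f` this is
the density at `u` of `v₁ ^ 2 + ⋯ + v_N ^ 2` for independent `vᵢ` of law `f(v) dv`. -/
noncomputable def sumDensity (f : ℝ → ℝ) (N : ℕ) (u : ℝ) : ℝ≥0∞ :=
  ∫⁻ V, tensorPower f N V ∂(fiberMeasure N u)

@[fun_prop]
lemma measurable_sumDensity {f : ℝ → ℝ} (hf : Measurable f) (N : ℕ) :
    Measurable (sumDensity f N) := by
  refine measurable_lintegral_fiberMeasure (w := fun u : ℝ => u)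
    (F := fun _ x => tensorPower f N x) measurable_id ?_
  exact (measurable_tensorPower hf N).comp measurable_snd

lemma sumDensity_of_nonpos (f : ℝ → ℝ) {N : ℕ} (hN : N ≠ 0) {u : ℝ} (hu : u ≤ 0) :
    sumDensity f N u = 0 := by
  simp [sumDensity, fiberMeasure_of_nonpos hN hu]

/-- The weight that `f^{⊗N}` on a sphere gives to the first coordinate. -/
lemma lintegral_coord_mul_tensorPower {f : ℝ → ℝ} (hf : Measurable f) (n : ℕ) {φ : ℝ → ℝ≥0∞}
    (hφ : Measurable φ) {u : ℝ} (hu : 0 < u) :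
    ∫⁻ V, φ (V 0) * tensorPower f (n + 2) V ∂(fiberMeasure (n + 2) u) =
      ∫⁻ v, φ v * (ENNReal.ofReal (f v) * sumDensity f (n + 1) (u - v ^ 2)) := by
  have := measurable_tensorPower hf
  rw [lintegral_fiberMeasure_succ (by fun_prop) hu]
  refine lintegral_congr fun v => ?_
  simp_rw [tensorPower_consE, consE_zero]
  rw [lintegral_const_mul _ (by fun_prop), lintegral_const_mul _ (by fun_prop), sumDensity]

lemma sumDensity_succ {f : ℝ → ℝ} (hf : Measurable f) (n : ℕ) (u : ℝ) :
    sumDensity f (n + 2) u = ∫⁻ v, ENNReal.ofReal (f v) * sumDensity f (n + 1) (u - v ^ 2) := by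
  rcases le_or_gt u 0 with hu | hu
  · have : ∀ v : ℝ, sumDensity f (n + 1) (u - v ^ 2) = 0 := fun v =>
      sumDensity_of_nonpos f (by simp) (by nlinarith [sq_nonneg v])
    simp [this, sumDensity_of_nonpos f _ hu]
  · simpa [sumDensity] using lintegral_coord_mul_tensorPower hf n (φ := 1) measurable_one hu

/-- The law of `v ^ 2` under the measure `f(v) dv`. -/
noncomputable def squareLaw (f : ℝ → ℝ) : Measure ℝ := (densityMeasure f).map (fun v => v ^ 2)

lemma lintegral_squareLaw {f : ℝ → ℝ} (hf : Measurable f) {H : ℝ → ℝ≥0∞} (hH : Measurable H) :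
    ∫⁻ x, H x ∂(squareLaw f) = ∫⁻ v, ENNReal.ofReal (f v) * H (v ^ 2) := by
  rw [squareLaw, lintegral_map hH (by fun_prop), densityMeasure,
    lintegral_withDensity_eq_lintegral_mul _ (by fun_prop) (g := fun v : ℝ => H (v ^ 2))
      (by fun_prop)]
  rfl

lemma withDensity_sumDensity_one {f : ℝ → ℝ} (hf : Measurable f) :
    volume.withDensity (sumDensity f 1) = squareLaw f := by
  refine Measure.ext_of_lintegral _ fun H hH => ?_
  rw [lintegral_withDensity_eq_lintegral_mul _ (by fun_prop) hH, lintegral_squareLaw hf hH]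
  have hm : Measurable fun x : EuclideanSpace ℝ (Fin 1) => tensorPower f 1 x * H (‖x‖ ^ 2) :=
    (measurable_tensorPower hf 1).mul (by fun_prop)
  have h1 := lintegral_eq_lintegral_fiberMeasure hm
  have h2 : ∀ u, ∫⁻ x, tensorPower f 1 x * H (‖x‖ ^ 2) ∂(fiberMeasure 1 u) =
      sumDensity f 1 u * H u := by
    intro u
    rw [lintegral_fiberMeasure_congr (G := fun x => tensorPower f 1 x * H u) (by simp) hm
      (by fun_prop) (fun x hx => by rw [hx]), lintegral_mul_const _ (by fun_prop), sumDensity]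
  simp_rw [h2] at h1
  refine (h1.symm.trans ?_)
  have hmp : MeasurePreserving (MeasurableEquiv.funUnique (Fin 1) ℝ).symm := by
    convert! (volume_preserving_funUnique (Fin 1) ℝ).symm
  rw [← (PiLp.volume_preserving_toLp (Fin 1)).lintegral_comp hm,
    ← hmp.lintegral_comp
      (f := fun a => tensorPower f 1 (WithLp.toLp 2 a) * H (‖WithLp.toLp 2 a‖ ^ 2))
      (hm.comp (WithLp.measurable_toLp 2 _))]
  refine lintegral_congr fun v => ?_
  simp [tensorPower, EuclideanSpace.norm_sq_eq]

lemma withDensity_sumDensity_succ {f : ℝ → ℝ} (hf : Measurable f)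
    [IsFiniteMeasure (squareLaw f)] (n : ℕ) :
    volume.withDensity (sumDensity f (n + 2)) =
      (volume.withDensity (sumDensity f (n + 1))) ∗ squareLaw f := by
  refine Measure.ext_of_lintegral _ fun H hH => ?_
  have hS := measurable_sumDensity hf
  rw [Measure.lintegral_conv hH,
    lintegral_withDensity_eq_lintegral_mul _ (by fun_prop) hH,
    lintegral_withDensity_eq_lintegral_mul _ (by fun_prop)
      (g := fun x => ∫⁻ y, H (x + y) ∂(squareLaw f))
      (Measurable.lintegral_prod_right' (f := fun p : ℝ × ℝ => H (p.1 + p.2)) (by fun_prop))]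
  simp only [Pi.mul_apply]
  calc ∫⁻ u, sumDensity f (n + 2) u * H u
      = ∫⁻ u, ∫⁻ v, ENNReal.ofReal (f v) * sumDensity f (n + 1) (u - v ^ 2) * H u := by
        refine lintegral_congr fun u => ?_
        rw [sumDensity_succ hf, lintegral_mul_const _ (by fun_prop)]
    _ = ∫⁻ v, ∫⁻ u, ENNReal.ofReal (f v) * sumDensity f (n + 1) (u - v ^ 2) * H u := by
        refine lintegral_lintegral_swap (Measurable.aemeasurable ?_)
        simp only [Function.uncurry_def]
        fun_prop
    _ = ∫⁻ v, ∫⁻ x, ENNReal.ofReal (f v) * sumDensity f (n + 1) x * H (x + v ^ 2) := by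
        refine lintegral_congr fun v => ?_
        rw [← lintegral_sub_right_eq_self (fun x => ENNReal.ofReal (f v) *
          sumDensity f (n + 1) x * H (x + v ^ 2)) (v ^ 2)]
        simp
    _ = ∫⁻ x, ∫⁻ v, ENNReal.ofReal (f v) * sumDensity f (n + 1) x * H (x + v ^ 2) := by
        refine lintegral_lintegral_swap (Measurable.aemeasurable ?_)
        simp only [Function.uncurry_def]
        fun_prop
    _ = ∫⁻ x, sumDensity f (n + 1) x * ∫⁻ y, H (x + y) ∂(squareLaw f) := by
        refine lintegral_congr fun x => ?_
        rw [lintegral_squareLaw hf (by fun_prop), ← lintegral_const_mul _ (by fun_prop)]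
        refine lintegral_congr fun v => ?_
        ring

/-! ### Uniform measures on spheres -/

lemma toSphere_univ_ne_zero (n : ℕ) :
    (volume : Measure (EuclideanSpace ℝ (Fin (n + 1)))).toSphere univ ≠ 0 := by
  simpa using (Metric.measure_ball_pos volume (0 : EuclideanSpace ℝ (Fin (n + 1))) one_pos).ne'

lemma toSphere_univ_ne_top (n : ℕ) :
    (volume : Measure (EuclideanSpace ℝ (Fin n))).toSphere univ ≠ ∞ := measure_ne_top _ _

instance isProbabilityMeasure_uniformSphere (n : ℕ) (r : ℝ) :
    IsProbabilityMeasure (uniformSphere (n + 1) r) := by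
  constructor
  rw [uniformSphere, Measure.smul_apply, Measure.map_apply (by fun_prop) MeasurableSet.univ,
    preimage_univ, smul_eq_mul]
  exact ENNReal.inv_mul_cancel (toSphere_univ_ne_zero n) (toSphere_univ_ne_top _)

lemma fiberMeasure_eq_smul_uniformSphere (n : ℕ) (u : ℝ) :
    fiberMeasure (n + 1) u = (ENNReal.ofReal (√u ^ (n + 1) / (2 * u)) *
      (volume : Measure (EuclideanSpace ℝ (Fin (n + 1)))).toSphere univ) •
        uniformSphere (n + 1) √u := by
  rw [uniformSphere, smul_smul, mul_assoc, ENNReal.mul_inv_cancel (toSphere_univ_ne_zero n)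
    (toSphere_univ_ne_top _), mul_one, fiberMeasure]

lemma sumDensity_eq_mul_partitionFunction (f : ℝ → ℝ) (n : ℕ) (u : ℝ) :
    sumDensity f (n + 1) u = ENNReal.ofReal (√u ^ (n + 1) / (2 * u)) *
      (volume : Measure (EuclideanSpace ℝ (Fin (n + 1)))).toSphere univ *
        partitionFunction f (n + 1) √u := by
  rw [sumDensity, fiberMeasure_eq_smul_uniformSphere, lintegral_smul_measure, smul_eq_mul,
    partitionFunction]

open scoped Pointwise in
lemma map_toSphere_linearIsometryEquiv {n : ℕ}
    (e : EuclideanSpace ℝ (Fin n) ≃ₗᵢ[ℝ] EuclideanSpace ℝ (Fin n)) (r : ℝ) :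
    ((volume : Measure (EuclideanSpace ℝ (Fin n))).toSphere.map
      (fun x : Metric.sphere (0 : EuclideanSpace ℝ (Fin n)) 1 =>
        r • (x : EuclideanSpace ℝ (Fin n)))).map e =
    (volume : Measure (EuclideanSpace ℝ (Fin n))).toSphere.map
      (fun x : Metric.sphere (0 : EuclideanSpace ℝ (Fin n)) 1 =>
        r • (x : EuclideanSpace ℝ (Fin n))) := by
  set e' : Metric.sphere (0 : EuclideanSpace ℝ (Fin n)) 1 →
    Metric.sphere (0 : EuclideanSpace ℝ (Fin n)) 1 := fun ω => ⟨e ω, by simp⟩ with he'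
  have hem : Measurable e := e.continuous.measurable
  have hm : Measurable e' := (hem.comp measurable_subtype_coe).subtype_mk
  have hinv : (volume : Measure (EuclideanSpace ℝ (Fin n))).toSphere.map e' =
      (volume : Measure (EuclideanSpace ℝ (Fin n))).toSphere := by
    ext s hs
    rw [Measure.map_apply hm hs, Measure.toSphere_apply' _ (hm hs), Measure.toSphere_apply' _ hs]
    congr 1
    conv_rhs =>
      rw [← e.measurePreserving.measure_preimage_emb e.toHomeomorph.measurableEmbedding]
    congr 1
    ext x
    simp only [Set.mem_smul, mem_image, mem_preimage]
    constructor
    · rintro ⟨t, ht, _, ⟨y, hy, rfl⟩, rfl⟩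
      exact ⟨t, ht, _, ⟨e' y, hy, rfl⟩, by simp [he']⟩
    · rintro ⟨t, ht, _, ⟨y, hy, rfl⟩, hx⟩
      refine ⟨t, ht, _, ⟨⟨e.symm y, by simp⟩, by simpa [he'] using hy, rfl⟩, ?_⟩
      rw [← map_smul, hx, e.symm_apply_apply]
  rw [Measure.map_map hem (by fun_prop)]
  conv_rhs => rw [← hinv]
  rw [Measure.map_map (by fun_prop) hm]
  congr 1
  ext x
  simp [he']

lemma uniformSphere_map_perm {n : ℕ} (σ : Equiv.Perm (Fin n)) (r : ℝ) :
    (uniformSphere n r).map (fun V => WithLp.toLp 2 (fun i => V (σ i))) = uniformSphere n r := by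
  have h := map_toSphere_linearIsometryEquiv (LinearIsometryEquiv.piLpCongrLeft 2 ℝ ℝ σ.symm) r
  have h2 : (fun V : EuclideanSpace ℝ (Fin n) => WithLp.toLp 2 (fun i => V (σ i))) =
      LinearIsometryEquiv.piLpCongrLeft 2 ℝ ℝ σ.symm := by
    ext V i
    simp [LinearIsometryEquiv.piLpCongrLeft_apply, Equiv.piCongrLeft'_apply]
  rw [h2, uniformSphere, Measure.map_smul, h]

lemma ae_uniformSphere_sum_sq {n : ℕ} {r : ℝ} :
    ∀ᵐ V ∂(uniformSphere n r), ∑ i, V i ^ 2 = r ^ 2 := by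
  rw [uniformSphere]
  refine Measure.ae_smul_measure ?_ _
  rw [ae_map_iff (by fun_prop) (measurableSet_eq_fun (by fun_prop) (by fun_prop))]
  refine ae_of_all _ fun ω => ?_
  have := norm_eq_of_mem_sphere ω
  have h2 := EuclideanSpace.real_norm_sq_eq (ω : EuclideanSpace ℝ (Fin n))
  rw [this] at h2
  simp only [PiLp.smul_apply, smul_eq_mul, mul_pow, ← Finset.mul_sum, ← h2]
  ring

section Fourier

open Complex
open scoped FourierTransform

/-! ### Fourier inversion for the densities -/

/-- Fourier inversion almost everywhere, for an integrable function with integrable transform: no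
continuity is assumed, and the two sides are compared by testing against smooth compactly supported
functions, which are Schwartz. -/
lemma ae_eq_fourierInv_fourier {f : ℝ → ℂ} (hf : Integrable f) (hF : Integrable (𝓕 f)) :
    ∀ᵐ x, f x = 𝓕⁻ (𝓕 f) x := by
  have hcont : Continuous (𝓕⁻ (𝓕 f)) := by
    rw [Real.fourierInv_eq_fourier_comp_neg]
    exact VectorFourier.fourierIntegral_continuous Real.continuous_fourierChar
      (by exact continuous_inner) hF.comp_neg
  refine ae_eq_of_integral_contDiff_smul_eq hf.locallyIntegrable hcont.locallyIntegrable
    fun g hg hgc => ?_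
  set G : ℝ → ℂ := fun x => (g x : ℂ) with hG
  have hGc : HasCompactSupport G := hgc.comp_left (g := fun r : ℝ => (r : ℂ)) ofReal_zero
  have hGd : ContDiff ℝ (⊤ : ℕ∞) G := ofRealCLM.contDiff.comp hg
  set S : SchwartzMap ℝ ℂ := hGc.toSchwartzMap hGd with hS
  have hSG : (S : ℝ → ℂ) = G := rfl
  have hSi : Integrable (𝓕⁻ G) := by
    rw [← hSG, ← SchwartzMap.fourierInv_coe]
    exact (𝓕⁻ S).integrable
  have hinv : 𝓕 (𝓕⁻ G) = G := by
    rw [← hSG, ← SchwartzMap.fourierInv_coe, ← SchwartzMap.fourier_coe,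
      FourierTransform.fourier_fourierInv_eq]
  have flip : ∀ {a b : ℝ → ℂ}, Integrable a → Integrable b →
      ∫ ξ, 𝓕 a ξ * b ξ = ∫ x, a x * 𝓕 b x := by
    intro a b ha hb
    simpa using! (VectorFourier.integral_fourierIntegral_smul_eq_flip (L := innerₗ ℝ)
      Real.continuous_fourierChar continuous_inner ha hb)
  have e1 : ∫ x, g x • f x = ∫ ξ, 𝓕 f ξ * 𝓕⁻ G ξ := by
    rw [flip hf hSi, hinv]
    simp [hG, mul_comm]
  have hGi : Integrable G := S.integrable
  have e2 : ∫ x, g x • 𝓕⁻ (𝓕 f) x = ∫ ξ, 𝓕 f ξ * 𝓕⁻ G ξ := by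
    have h3 := flip hF.comp_neg hGi
    have h4 : ∀ x, 𝓕⁻ (𝓕 f) x = 𝓕 (fun y => 𝓕 f (-y)) x := fun x => by
      rw [Real.fourierInv_eq_fourier_comp_neg]
    simp_rw [h4]
    calc ∫ x, g x • 𝓕 (fun y => 𝓕 f (-y)) x = ∫ ξ, 𝓕 (fun y => 𝓕 f (-y)) ξ * G ξ := by
          simp [hG, mul_comm]
      _ = ∫ x, 𝓕 f (-x) * 𝓕 G x := h3
      _ = ∫ x, 𝓕 f x * 𝓕 G (-x) := by
          rw [← integral_neg_eq_self]
          simp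
      _ = ∫ ξ, 𝓕 f ξ * 𝓕⁻ G ξ := by simp_rw [Real.fourierInv_eq_fourier_neg]
  rw [e1, e2]

/-- The inverse of the characteristic function: `(2π)⁻¹ ∫ Φ(t) e^{-itu} dt`. -/
noncomputable def charInv (Φ : ℝ → ℂ) (u : ℝ) : ℂ :=
  (2 * Real.pi : ℝ)⁻¹ * ∫ t : ℝ, Φ t * cexp (-(t * u * I))

lemma ae_toReal_eq_charInv {s : ℝ → ℝ≥0∞} (hs : Measurable s)
    [IsFiniteMeasure (volume.withDensity s)]
    (hΦ : Integrable (charFun (volume.withDensity s))) :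
    ∀ᵐ u, s u ≠ ∞ ∧ ((s u).toReal : ℂ) = charInv (charFun (volume.withDensity s)) u := by
  set ν := volume.withDensity s
  have hfin : ∫⁻ u, s u ≠ ∞ := by
    have := measure_ne_top ν univ
    rwa [withDensity_apply _ MeasurableSet.univ, setLIntegral_univ] at this
  have htop : ∀ᵐ u, s u < ∞ := ae_lt_top hs hfin
  have hint : Integrable fun u => ((s u).toReal : ℂ) :=
    (integrable_toReal_of_lintegral_ne_top hs.aemeasurable hfin).ofReal
  have hF : ∀ ξ : ℝ, 𝓕 (fun u => ((s u).toReal : ℂ)) ξ = charFun ν (-(2 * Real.pi) * ξ) := by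
    intro ξ
    rw [Real.fourier_real_eq_integral_exp_smul, charFun_apply_real,
      integral_withDensity_eq_integral_toReal_smul hs htop]
    refine integral_congr_ae (ae_of_all _ fun u => ?_)
    simp only [smul_eq_mul, real_smul]
    rw [mul_comm]
    congr 2
    push_cast
    ring
  have hpi : -(2 * Real.pi) ≠ 0 := by simp [Real.pi_ne_zero]
  have hFi : Integrable (𝓕 fun u => ((s u).toReal : ℂ)) := by
    rw [show (𝓕 fun u => ((s u).toReal : ℂ)) = fun ξ => charFun ν (-(2 * Real.pi) * ξ) from
      funext hF]
    exact hΦ.comp_mul_left' hpi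
  filter_upwards [htop, ae_eq_fourierInv_fourier hint hFi] with u hu h
  refine ⟨hu.ne, h.trans ?_⟩
  rw [Real.fourierInv_eq', charInv]
  simp_rw [hF]
  have hsub := Measure.integral_comp_mul_left
    (fun t : ℝ => charFun ν t * cexp (-(t * u * I))) (-(2 * Real.pi))
  rw [inv_neg, abs_neg, abs_of_pos (by positivity), real_smul] at hsub
  rw [← hsub]
  refine integral_congr_ae (ae_of_all _ fun v => ?_)
  simp only [smul_eq_mul]
  rw [mul_comm]
  congr 2
  simp only [RCLike.inner_apply, conj_trivial]
  push_cast
  ring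

lemma norm_cexp_neg_mul_I (t u : ℝ) : ‖cexp (-(t * u * I))‖ = 1 := by
  rw [← neg_mul, ← ofReal_mul, ← ofReal_neg, norm_exp_ofReal_mul_I]

lemma continuous_charInv {Φ : ℝ → ℂ} (hΦ : Integrable Φ) : Continuous (charInv Φ) := by
  refine continuous_const.mul (continuous_of_dominated (bound := fun t => ‖Φ t‖)
    (fun u => hΦ.aestronglyMeasurable.mul (by fun_prop)) (fun u => ae_of_all _ fun t => ?_)
    hΦ.norm (ae_of_all _ fun t => by fun_prop))
  rw [norm_mul, norm_cexp_neg_mul_I, mul_one]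

lemma norm_charInv_le (Φ : ℝ → ℂ) (u : ℝ) : ‖charInv Φ u‖ ≤ (2 * Real.pi)⁻¹ * ∫ t, ‖Φ t‖ := by
  rw [charInv, norm_mul, norm_real, Real.norm_of_nonneg (by positivity)]
  gcongr
  refine (norm_integral_le_integral_norm _).trans_eq ?_
  simp [norm_cexp_neg_mul_I]

lemma integral_charInv_sub {Φ : ℝ → ℂ} (hΦ : Integrable Φ) (μ : Measure ℝ) [IsFiniteMeasure μ]
    (u : ℝ) : ∫ x, charInv Φ (u - x) ∂μ = charInv (fun t => Φ t * charFun μ t) u := by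
  simp only [charInv]
  rw [integral_const_mul]
  congr 1
  rw [integral_integral_swap]
  · refine integral_congr_ae (ae_of_all _ fun t => ?_)
    simp only
    rw [charFun_apply_real, mul_assoc, ← integral_mul_const, ← integral_const_mul]
    refine integral_congr_ae (ae_of_all _ fun x => ?_)
    simp only
    rw [← Complex.exp_add]
    congr 2
    push_cast
    ring
  · have h1 : Integrable (fun p : ℝ × ℝ => Φ p.2) (μ.prod volume) := hΦ.comp_snd μ
    refine h1.mono (h1.aestronglyMeasurable.mul (by fun_prop)) (ae_of_all _ fun p => ?_)
    rw [Function.uncurry_def]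
    simp only
    rw [norm_mul, norm_cexp_neg_mul_I, mul_one]

lemma charFun_withDensity_sumDensity {f : ℝ → ℝ} (hf : Measurable f)
    [IsProbabilityMeasure (squareLaw f)] (n : ℕ) :
    IsProbabilityMeasure (volume.withDensity (sumDensity f (n + 1))) ∧
    charFun (volume.withDensity (sumDensity f (n + 1))) =
      fun t => charFun (squareLaw f) t ^ (n + 1) := by
  induction n with
  | zero => simp [withDensity_sumDensity_one hf, *]
  | succ n ih =>
    obtain ⟨h1, h2⟩ := ih
    rw [withDensity_sumDensity_succ hf]
    refine ⟨inferInstance, ?_⟩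
    ext t
    rw [charFun_conv, h2, pow_succ _ (n + 1)]

lemma squareLaw_absolutelyContinuous {f : ℝ → ℝ} (hf : Measurable f) : squareLaw f ≪ volume := by
  rw [← withDensity_sumDensity_one hf]
  exact withDensity_absolutelyContinuous _ _

/-- Fourier inversion for the density of `v₁ ^ 2 + ⋯ + v_N ^ 2` at every point `u`. Inversion for
`N - 1` summands holds almost everywhere; convolving once more with the law of `v ^ 2`, which is
absolutely continuous, turns it into an identity at every point. -/
theorem sumDensity_eq_ofReal_charInv {f : ℝ → ℝ} (hf : Measurable f)
    [IsProbabilityMeasure (squareLaw f)] {n : ℕ}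
    (hΦ : Integrable fun t => charFun (squareLaw f) t ^ (n + 1)) (u : ℝ) :
    sumDensity f (n + 2) u =
      ENNReal.ofReal (charInv (fun t => charFun (squareLaw f) t ^ (n + 2)) u).re := by
  obtain ⟨hP, hc⟩ := charFun_withDensity_sumDensity hf n
  have hae := ae_toReal_eq_charInv (measurable_sumDensity hf (n + 1)) (by rwa [hc])
  rw [hc] at hae
  set Ψ : ℝ → ℂ := fun t => charFun (squareLaw f) t ^ (n + 1) with hΨ
  have hae' : ∀ᵐ x ∂(squareLaw f), sumDensity f (n + 1) (u - x) ≠ ∞ ∧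
      ((sumDensity f (n + 1) (u - x)).toReal : ℂ) = charInv Ψ (u - x) := by
    have hq : Measure.QuasiMeasurePreserving (fun x : ℝ => u - x) volume volume :=
      quasiMeasurePreserving_sub_left volume u
    exact (squareLaw_absolutelyContinuous hf).ae_le (hq.ae hae)
  have h1 : sumDensity f (n + 2) u =
      ∫⁻ x, ENNReal.ofReal (charInv Ψ (u - x)).re ∂(squareLaw f) := by
    rw [sumDensity_succ hf, ← lintegral_squareLaw hf
      (H := fun x => sumDensity f (n + 1) (u - x)) (by have := measurable_sumDensity hf; fun_prop)]
    refine lintegral_congr_ae (hae'.mono fun x hx => ?_)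
    simp only
    rw [← hx.2, ofReal_re, ENNReal.ofReal_toReal hx.1]
  have hcont := continuous_charInv hΦ
  have hint : Integrable (fun x => charInv Ψ (u - x)) (squareLaw f) :=
    Integrable.of_bound (by fun_prop) _ (ae_of_all _ fun x => norm_charInv_le Ψ (u - x))
  rw [h1, ← ofReal_integral_eq_lintegral_ofReal (f := fun x => (charInv Ψ (u - x)).re) hint.re]
  · congr 1
    have h2 : ∫ x, RCLike.re (charInv Ψ (u - x)) ∂(squareLaw f) =
      RCLike.re (∫ x, charInv Ψ (u - x) ∂(squareLaw f)) := integral_re hint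
    refine h2.trans ?_
    rw [integral_charInv_sub hΦ]
    rfl
  · refine hae'.mono fun x hx => ?_
    simp only [Pi.zero_apply]
    rw [← hx.2, ofReal_re]
    exact ENNReal.toReal_nonneg

/-! ### Integrability of a power of the characteristic function -/

lemma integral_charFun_comm (μ ν : Measure ℝ) [IsFiniteMeasure μ] [IsFiniteMeasure ν] :
    ∫ t, charFun μ t ∂ν = ∫ x, charFun ν x ∂μ := by
  simp_rw [charFun_apply_real]
  rw [integral_integral_swap]
  · simp_rw [mul_comm]
  · refine Integrable.of_bound (C := 1) (by fun_prop) (ae_of_all _ fun p => ?_)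
    rw [Function.uncurry_def]
    simp only
    rw [← ofReal_mul, norm_exp_ofReal_mul_I]

lemma lintegral_conv_le {ν ν' : Measure ℝ} [IsFiniteMeasure ν] [IsFiniteMeasure ν'] {K : ℝ≥0∞}
    (h : ν ≤ K • volume) {H : ℝ → ℝ≥0∞} (hH : Measurable H) :
    ∫⁻ x, H x ∂(ν' ∗ ν) ≤ K * ν' univ * ∫⁻ x, H x := by
  rw [Measure.lintegral_conv hH]
  calc ∫⁻ y, ∫⁻ x, H (y + x) ∂ν ∂ν' ≤ ∫⁻ _, (K * ∫⁻ x, H x) ∂ν' := by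
        refine lintegral_mono fun y => (lintegral_mono' h le_rfl).trans_eq ?_
        rw [lintegral_smul_measure, lintegral_add_left_eq_self, smul_eq_mul]
    _ = _ := by rw [lintegral_const, mul_right_comm]

/-- A measure with density at most `K` has a square integrable characteristic function. The square
of its modulus is the characteristic function of a symmetrisation, whose density is also bounded;
integrating it against Gaussian densities of growing variance and applying Fatou gives the
bound. -/
theorem lintegral_norm_charFun_sq_le {ν : Measure ℝ} [IsFiniteMeasure ν] {K : ℝ≥0∞}
    (h : ν ≤ K • volume) :
    ∫⁻ t, ENNReal.ofReal (‖charFun ν t‖ ^ 2) ≤ ENNReal.ofReal (2 * Real.pi) * (K * ν univ) := by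
  set ν' : Measure ℝ := ν.map (fun x => -x)
  have hν' : ν' univ = ν univ := by
    rw [Measure.map_apply (by fun_prop) MeasurableSet.univ, preimage_univ]
  have hfin : IsFiniteMeasure ν' := ⟨by rw [hν']; exact measure_lt_top _ _⟩
  have hchar : ∀ t, charFun (ν' ∗ ν) t = ((‖charFun ν t‖ ^ 2 : ℝ) : ℂ) := by
    intro t
    have h1 : charFun ν' t = charFun ν (-t) := by
      have := charFun_map_mul (μ := ν) (-1) t
      simpa [ν'] using this
    rw [charFun_conv, h1, charFun_neg, ← Complex.normSq_eq_conj_mul_self, Complex.normSq_eq_norm_sq]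
  -- the Gaussian weight of variance `n + 1` in `t` becomes one of variance `1 / (n + 1)` in `x`
  have key : ∀ n : ℕ, ∫⁻ t, ENNReal.ofReal (‖charFun ν t‖ ^ 2) *
      ENNReal.ofReal (Real.exp (-(2 * ((n : ℝ) + 1))⁻¹ * t ^ 2)) ≤
        ENNReal.ofReal (2 * Real.pi) * (K * ν univ) := by
    intro n
    set w : NNReal := (n : NNReal) + 1 with hw
    have hw0 : w ≠ 0 := by positivity
    have hwr : (w : ℝ) = (n : ℝ) + 1 := by simp [hw]
    have hwpos : (0 : ℝ) < w := by rw [hwr]; positivity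
    have e1 : ∫ t, ‖charFun ν t‖ ^ 2 ∂(gaussianReal 0 w) =
        ∫ x, Real.exp (-(w * x ^ 2 / 2)) ∂(ν' ∗ ν) := by
      have := integral_charFun_comm (ν' ∗ ν) (gaussianReal 0 w)
      simp_rw [hchar, charFun_gaussianReal] at this
      rw [integral_complex_ofReal] at this
      refine Complex.ofReal_injective (this.trans ?_)
      rw [← integral_complex_ofReal]
      refine integral_congr_ae (ae_of_all _ fun x => ?_)
      push_cast
      simp
    have i1 : Integrable (fun t => ‖charFun ν t‖ ^ 2) (gaussianReal 0 w) := by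
      refine Integrable.of_bound (C := (ν.real univ) ^ 2) ?_ (ae_of_all _ fun t => ?_)
      · exact (measurable_charFun.norm.pow_const 2).aestronglyMeasurable
      · rw [Real.norm_of_nonneg (by positivity)]
        gcongr
        exact norm_charFun_le t
    have i2 : Integrable (fun x : ℝ => Real.exp (-(w * x ^ 2 / 2))) (ν' ∗ ν) := by
      refine Integrable.of_bound (C := 1) (by fun_prop) (ae_of_all _ fun t => ?_)
      rw [Real.norm_of_nonneg (by positivity)]
      exact Real.exp_le_one_iff.2 (by have := sq_nonneg t; nlinarith [mul_nonneg hwpos.le this])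
    have e2 : ∫⁻ t, ENNReal.ofReal (‖charFun ν t‖ ^ 2) ∂(gaussianReal 0 w) =
        ∫⁻ x, ENNReal.ofReal (Real.exp (-(w * x ^ 2 / 2))) ∂(ν' ∗ ν) := by
      rw [← ofReal_integral_eq_lintegral_ofReal i1 (ae_of_all _ fun t => by positivity), e1,
        ofReal_integral_eq_lintegral_ofReal i2 (ae_of_all _ fun t => by positivity)]
    have e3 : ∫⁻ x : ℝ, ENNReal.ofReal (Real.exp (-(w * x ^ 2 / 2))) =
        ENNReal.ofReal √(2 * Real.pi / w) := by
      have h1 := integral_gaussian (w / 2 : ℝ)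
      have h2 := integrable_exp_neg_mul_sq (b := (w / 2 : ℝ)) (by positivity)
      have h3 : ∀ x : ℝ, -(w * x ^ 2 / 2 : ℝ) = -(w / 2) * x ^ 2 := fun x => by ring
      simp_rw [h3]
      rw [← ofReal_integral_eq_lintegral_ofReal h2 (ae_of_all _ fun t => by positivity), h1]
      congr 2
      field_simp
    have e4 : ∫⁻ t, ENNReal.ofReal (‖charFun ν t‖ ^ 2) ∂(gaussianReal 0 w) ≤
        K * ν univ * ENNReal.ofReal √(2 * Real.pi / w) := by
      rw [e2, ← e3, ← hν']
      exact lintegral_conv_le h (by fun_prop)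
    have e5 : ∀ t : ℝ, ENNReal.ofReal (‖charFun ν t‖ ^ 2) *
        ENNReal.ofReal (Real.exp (-(2 * ((n : ℝ) + 1))⁻¹ * t ^ 2)) =
        ENNReal.ofReal √(2 * Real.pi * w) *
          (gaussianPDF 0 w t * ENNReal.ofReal (‖charFun ν t‖ ^ 2)) := by
      intro t
      have h1 : Real.exp (-(2 * ((n : ℝ) + 1))⁻¹ * t ^ 2) =
          √(2 * Real.pi * w) * gaussianPDFReal 0 w t := by
        rw [gaussianPDFReal, ← mul_assoc, mul_inv_cancel₀ (by positivity), one_mul, hwr]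
        congr 1
        ring
      rw [h1, gaussianPDF, ENNReal.ofReal_mul (by positivity)]
      ring
    simp_rw [e5]
    rw [lintegral_const_mul _ (by
      have := measurable_charFun (μ := ν)
      fun_prop)]
    have e6 : ∫⁻ t, gaussianPDF 0 w t * ENNReal.ofReal (‖charFun ν t‖ ^ 2) =
        ∫⁻ t, ENNReal.ofReal (‖charFun ν t‖ ^ 2) ∂(gaussianReal 0 w) := by
      rw [gaussianReal_of_var_ne_zero _ hw0, lintegral_withDensity_eq_lintegral_mul _ (by fun_prop)
        (by have := measurable_charFun (μ := ν); fun_prop)]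
      rfl
    rw [e6]
    calc _ ≤ ENNReal.ofReal √(2 * Real.pi * w) * (K * ν univ * ENNReal.ofReal √(2 * Real.pi / w)) :=
          by gcongr
      _ = ENNReal.ofReal √(2 * Real.pi * w) * ENNReal.ofReal √(2 * Real.pi / w) * (K * ν univ) := by
          ring
      _ = _ := by
          rw [← ENNReal.ofReal_mul (by positivity), ← Real.sqrt_mul (by positivity)]
          congr 2
          rw [show 2 * Real.pi * w * (2 * Real.pi / w) = (2 * Real.pi) ^ 2 by field_simp,
            Real.sqrt_sq (by positivity)]
  have hlim : ∀ t : ℝ, Tendsto (fun n : ℕ => ENNReal.ofReal (‖charFun ν t‖ ^ 2) *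
      ENNReal.ofReal (Real.exp (-(2 * ((n : ℝ) + 1))⁻¹ * t ^ 2))) atTop
      (𝓝 (ENNReal.ofReal (‖charFun ν t‖ ^ 2))) := by
    intro t
    have h1 : Tendsto (fun n : ℕ => -(2 * ((n : ℝ) + 1))⁻¹ * t ^ 2) atTop (𝓝 (-0 * t ^ 2)) := by
      refine Tendsto.mul_const _ (Tendsto.neg (tendsto_inv_atTop_zero.comp ?_))
      exact (tendsto_natCast_atTop_atTop.atTop_add tendsto_const_nhds).const_mul_atTop two_pos
    have h2 := ENNReal.tendsto_ofReal ((Real.continuous_exp.tendsto _).comp h1)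
    simp only [neg_zero, zero_mul, Real.exp_zero, ENNReal.ofReal_one] at h2
    have h3 := ENNReal.Tendsto.const_mul (a := ENNReal.ofReal (‖charFun ν t‖ ^ 2)) h2
      (Or.inl one_ne_zero)
    simpa using h3
  calc ∫⁻ t, ENNReal.ofReal (‖charFun ν t‖ ^ 2)
      = ∫⁻ t, liminf (fun n : ℕ => ENNReal.ofReal (‖charFun ν t‖ ^ 2) *
          ENNReal.ofReal (Real.exp (-(2 * ((n : ℝ) + 1))⁻¹ * t ^ 2))) atTop := by
        simp_rw [(hlim _).liminf_eq]
    _ ≤ liminf (fun n : ℕ => ∫⁻ t, ENNReal.ofReal (‖charFun ν t‖ ^ 2) *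
          ENNReal.ofReal (Real.exp (-(2 * ((n : ℝ) + 1))⁻¹ * t ^ 2))) atTop :=
        lintegral_liminf_le fun n => by
          have := measurable_charFun (μ := ν)
          fun_prop
    _ ≤ _ := liminf_le_of_frequently_le' (Frequently.of_forall key)

/-- The length of the unit circle, as the total mass of its surface measure. -/
noncomputable def circleLength : ℝ≥0∞ :=
  (volume : Measure (EuclideanSpace ℝ (Fin 2))).toSphere univ

lemma circleLength_ne_top : circleLength ≠ ∞ := toSphere_univ_ne_top 2

/-- The sum of two squares has a bounded density when `f` is bounded: the circle is the dimension in
which the weight of `fiberMeasure` is constant. -/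
lemma sumDensity_two_le {f : ℝ → ℝ} {K : ℝ} (hK : ∀ v, f v ≤ K) (u : ℝ) :
    sumDensity f 2 u ≤ ENNReal.ofReal K ^ 2 * circleLength := by
  rcases le_or_gt u 0 with hu | hu
  · simp [sumDensity_of_nonpos f two_ne_zero hu]
  have h1 : ∀ V, tensorPower f 2 V ≤ ENNReal.ofReal K ^ 2 := fun V => by
    rw [tensorPower, Fin.prod_univ_two, sq]
    gcongr <;> exact hK _
  rw [sumDensity]
  refine (lintegral_mono h1).trans ?_
  rw [lintegral_const]
  gcongr
  rw [fiberMeasure, Measure.smul_apply, Measure.map_apply (by fun_prop) MeasurableSet.univ,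
    preimage_univ, smul_eq_mul, circleLength]
  refine mul_le_of_le_one_left' ?_
  rw [ENNReal.ofReal_le_one, Real.sq_sqrt hu.le, div_le_one (by positivity)]
  linarith

lemma squareLaw_univ {f : ℝ → ℝ} :
    squareLaw f univ = ∫⁻ v, ENNReal.ofReal (f v) := by
  rw [squareLaw, Measure.map_apply (by fun_prop) MeasurableSet.univ, preimage_univ, densityMeasure,
    withDensity_apply _ MeasurableSet.univ, setLIntegral_univ]

/-- For bounded `f` the characteristic function of the law of `v ^ 2` is in `L⁴`: its square is the
characteristic function of a measure with bounded density. -/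
lemma lintegral_norm_charFun_squareLaw_pow_four_le {f : ℝ → ℝ} (hf : Measurable f) {K : ℝ}
    (hK : ∀ v, f v ≤ K) (hmass : squareLaw f univ ≤ 1) :
    ∫⁻ t, ENNReal.ofReal (‖charFun (squareLaw f) t‖ ^ 4) ≤
      ENNReal.ofReal (2 * Real.pi) * circleLength * ENNReal.ofReal K ^ 2 := by
  have hfin : IsFiniteMeasure (squareLaw f) := ⟨hmass.trans_lt ENNReal.one_lt_top⟩
  have h2 : squareLaw f ∗ squareLaw f = volume.withDensity (sumDensity f 2) := by
    rw [withDensity_sumDensity_succ hf 0, zero_add, withDensity_sumDensity_one hf]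
  have hle : squareLaw f ∗ squareLaw f ≤ (ENNReal.ofReal K ^ 2 * circleLength) • volume := by
    rw [h2, ← withDensity_const]
    exact withDensity_mono (ae_of_all _ (sumDensity_two_le hK))
  have hu : (squareLaw f ∗ squareLaw f) univ ≤ 1 := by
    have := Measure.lintegral_conv (μ := squareLaw f) (ν := squareLaw f) (f := fun _ => 1)
      measurable_const
    simp only [lintegral_const, one_mul] at this
    rw [this]
    exact mul_le_one' hmass hmass
  have h4 : ∀ t, ‖charFun (squareLaw f ∗ squareLaw f) t‖ ^ 2 = ‖charFun (squareLaw f) t‖ ^ 4 := by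
    intro t
    rw [charFun_conv, norm_mul]
    ring
  simp_rw [← h4]
  refine (lintegral_norm_charFun_sq_le hle).trans ?_
  calc _ ≤ ENNReal.ofReal (2 * Real.pi) * (ENNReal.ofReal K ^ 2 * circleLength * 1) := by gcongr
    _ = _ := by ring

lemma charFun_squareLaw {f : ℝ → ℝ} (hf : Measurable f) (h0 : ∀ v, 0 ≤ f v) (t : ℝ) :
    charFun (squareLaw f) t = ∫ v, (f v : ℂ) * cexp (t * v ^ 2 * I) := by
  rw [charFun_apply_real, squareLaw, integral_map (by fun_prop) (by fun_prop), densityMeasure,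
    integral_withDensity_eq_integral_toReal_smul (by fun_prop) (by simp)]
  refine integral_congr_ae (ae_of_all _ fun v => ?_)
  simp [ENNReal.toReal_ofReal (h0 v)]

lemma norm_cexp_mul_sq_mul_I (t v : ℝ) : ‖cexp (t * v ^ 2 * I)‖ = 1 := by
  rw [← ofReal_pow, ← ofReal_mul, norm_exp_ofReal_mul_I]

lemma norm_charFun_squareLaw_sub_le {f g : ℝ → ℝ} (hf : Measurable f) (hg : Measurable g)
    (hf0 : ∀ v, 0 ≤ f v) (hg0 : ∀ v, 0 ≤ g v) (hfi : Integrable f) (hgi : Integrable g) (t : ℝ) :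
    ‖charFun (squareLaw f) t - charFun (squareLaw g) t‖ ≤ ∫ v, |f v - g v| := by
  have hi : ∀ {h : ℝ → ℝ}, Integrable h → Integrable fun v => (h v : ℂ) * cexp (t * v ^ 2 * I) := by
    intro h hh
    have hc : Integrable fun v => (h v : ℂ) := hh.ofReal
    refine hc.mono (hc.aestronglyMeasurable.mul (by fun_prop)) (ae_of_all _ fun v => ?_)
    rw [norm_mul, norm_cexp_mul_sq_mul_I, mul_one]
  rw [charFun_squareLaw hf hf0, charFun_squareLaw hg hg0, ← integral_sub (hi hfi) (hi hgi)]
  refine (norm_integral_le_integral_norm _).trans_eq (integral_congr_ae (ae_of_all _ fun v => ?_))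
  simp only
  rw [← sub_mul, norm_mul, norm_cexp_mul_sq_mul_I, mul_one, ← ofReal_sub, norm_real,
    Real.norm_eq_abs]

/-- Distribution function of the characteristic function of `v ^ 2`. The part of `f` below the level
`K` has a characteristic function in `L⁴`, and the part above has mass at most
`K ^ (1 - q) ∫ f ^ q`. -/
lemma volume_norm_charFun_squareLaw_gt_le {f : ℝ → ℝ} (hf : Measurable f) (h0 : ∀ v, 0 ≤ f v)
    (h1 : ∫ v, f v = 1) {q B : ℝ} (hq : 1 < q) (hqi : Integrable fun v => f v ^ q)
    (hB : ∫ v, f v ^ q ≤ B) {l K : ℝ} (hl : 0 < l) (hKpos : 0 < K) (hK : B * K ^ (1 - q) ≤ l / 2) :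
    volume {t : ℝ | l < ‖charFun (squareLaw f) t‖} ≤
      ENNReal.ofReal (2 * Real.pi) * circleLength * ENNReal.ofReal K ^ 2 /
        ENNReal.ofReal ((l / 2) ^ 4) := by
  have hfi : Integrable f := .of_integral_ne_zero (by simp [h1])
  set g : ℝ → ℝ := {v | f v ≤ K}.indicator f with hg
  have hms : MeasurableSet {v | f v ≤ K} := measurableSet_le hf measurable_const
  have hgm : Measurable g := hf.indicator hms
  have hg0 : ∀ v, 0 ≤ g v := fun v => indicator_nonneg (fun x _ => h0 x) v
  have hgf : ∀ v, g v ≤ f v := fun v => indicator_le_self' (fun x _ => h0 x) v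
  have hgK : ∀ v, g v ≤ K := fun v => by
    by_cases h : f v ≤ K <;> simp [hg, h, hKpos.le]
  have hgi : Integrable g := hfi.indicator hms
  have hmass : squareLaw g univ ≤ 1 := by
    rw [squareLaw_univ, ← ofReal_integral_eq_lintegral_ofReal hgi (ae_of_all _ hg0),
      ENNReal.ofReal_le_one, ← h1]
    exact integral_mono hgi hfi hgf
  have htail : ∫ v, |f v - g v| ≤ l / 2 := by
    refine le_trans ?_ hK
    have : ∫ v, |f v - g v| ≤ ∫ v, f v ^ q * K ^ (1 - q) := by
      refine integral_mono (hfi.sub hgi).abs (hqi.mul_const _) fun v => ?_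
      simp only
      by_cases h : f v ≤ K
      · simp only [hg, indicator, mem_ofPred_eq, h, if_true, sub_self, abs_zero]
        have := h0 v
        positivity
      · simp only [hg, indicator, mem_ofPred_eq, h, if_false, sub_zero, abs_of_nonneg (h0 v)]
        have hKf := not_le.1 h
        have hfp : 0 < f v := hKpos.trans hKf
        calc f v = f v ^ q * f v ^ (1 - q) := by
              rw [← Real.rpow_add hfp]
              simp
          _ ≤ f v ^ q * K ^ (1 - q) := by
              gcongr ?_ * ?_
              exact Real.rpow_le_rpow_of_nonpos hKpos hKf.le (by linarith)
    rw [integral_mul_const] at this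
    exact this.trans (by gcongr)
  have hsub : {t : ℝ | l < ‖charFun (squareLaw f) t‖} ⊆
      {t : ℝ | ENNReal.ofReal ((l / 2) ^ 4) ≤ ENNReal.ofReal (‖charFun (squareLaw g) t‖ ^ 4)} := by
    intro t ht
    have h2 := norm_charFun_squareLaw_sub_le hf hgm h0 hg0 hfi hgi t
    have h3 := norm_sub_norm_le (charFun (squareLaw f) t) (charFun (squareLaw g) t)
    have ht' : l < ‖charFun (squareLaw f) t‖ := ht
    refine ENNReal.ofReal_le_ofReal ?_
    gcongr
    linarith
  refine (measure_mono hsub).trans ?_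
  refine (meas_ge_le_lintegral_div ?_ (by positivity) ENNReal.ofReal_ne_top).trans ?_
  · have : IsFiniteMeasure (squareLaw g) := ⟨hmass.trans_lt ENNReal.one_lt_top⟩
    have := measurable_charFun (μ := squareLaw g)
    fun_prop
  · gcongr
    exact lintegral_norm_charFun_squareLaw_pow_four_le hgm hgK hmass

lemma isProbabilityMeasure_squareLaw {f : ℝ → ℝ} (h0 : ∀ v, 0 ≤ f v)
    (h1 : ∫ v, f v = 1) : IsProbabilityMeasure (squareLaw f) := by
  constructor
  have hfi : Integrable f := .of_integral_ne_zero (by simp [h1])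
  rw [squareLaw_univ, ← ofReal_integral_eq_lintegral_ofReal hfi (ae_of_all _ h0), h1,
    ENNReal.ofReal_one]

/-- For `f` bounded in `L^q`, `q > 1`, some power of the characteristic function of `v ^ 2` is
integrable, with exponent and bound depending only on `q` and the bound on `f`. -/
theorem exists_integral_norm_charFun_squareLaw_pow_le {q : ℝ} (hq : 1 < q) (B : ℝ) :
    ∃ (m : ℕ) (D : ℝ), m ≠ 0 ∧ ∀ f : ℝ → ℝ, Measurable f → (∀ v, 0 ≤ f v) → ∫ v, f v = 1 →
      (Integrable fun v => f v ^ q) → ∫ v, f v ^ q ≤ B →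
      Integrable (fun t => ‖charFun (squareLaw f) t‖ ^ m) ∧
        ∫ t, ‖charFun (squareLaw f) t‖ ^ m ≤ D := by
  set B' : ℝ := max B 1 with hB'
  have hB'pos : 0 < B' := lt_of_lt_of_le one_pos (le_max_right _ _)
  set e : ℝ := 2 / (q - 1) with he
  have hq1 : 0 < q - 1 := by linarith
  have hepos : 0 < e := by positivity
  -- the distribution function at level `l` is at most of order `l ^ (-(4 + e))`, so that any power
  -- exceeding `4 + e` is integrable
  obtain ⟨k, hk⟩ := exists_nat_ge (4 + e)
  set c : ℝ≥0∞ := ENNReal.ofReal (2 * Real.pi) * circleLength *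
    ENNReal.ofReal (16 * (2 * B') ^ e) with hc
  have hctop : c ≠ ∞ := ENNReal.mul_ne_top (ENNReal.mul_ne_top ENNReal.ofReal_ne_top
    circleLength_ne_top) ENNReal.ofReal_ne_top
  refine ⟨k + 1, ((k + 1 : ℕ) * c).toReal, by simp, fun f hf h0 h1 hqi hB => ?_⟩
  have hP := isProbabilityMeasure_squareLaw h0 h1
  have hm : Measurable fun t => ‖charFun (squareLaw f) t‖ := measurable_charFun.norm
  -- the exponent `k` of `l` is the one in the layer-cake formula for the power `k + 1`
  have hweak : ∀ l : ℝ, 0 < l →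
      volume {t : ℝ | l < ‖charFun (squareLaw f) t‖} *
        ENNReal.ofReal (l ^ (((k + 1 : ℕ) : ℝ) - 1)) ≤
        (Ioc (0 : ℝ) 1).indicator (fun _ => c) l := by
    intro l hl
    by_cases hl1 : l ≤ 1
    · rw [indicator_of_mem (mem_Ioc.2 ⟨hl, hl1⟩)]
      -- truncate at the height for which the discarded part of `f` has mass at most `l / 2`
      set K : ℝ := (2 * B' / l) ^ (1 / (q - 1)) with hKdef
      have hKpos : 0 < K := by positivity
      have hKq : K ^ (1 - q) = l / (2 * B') := by
        rw [hKdef, ← Real.rpow_mul (by positivity),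
          show 1 / (q - 1) * (1 - q) = -1 by field_simp; ring, Real.rpow_neg_one, inv_div]
      have hK2 : K ^ 2 = (2 * B') ^ e / l ^ e := by
        rw [hKdef, ← Real.rpow_natCast, ← Real.rpow_mul (by positivity), ← Real.div_rpow
          (by positivity) hl.le, he]
        congr 1
        push_cast
        ring
      have hw := volume_norm_charFun_squareLaw_gt_le hf h0 h1 hq hqi (hB.trans (le_max_left B 1))
        hl hKpos (by
          rw [hKq]
          refine le_of_eq ?_
          rw [← hB']
          field_simp)
      calc _ ≤ ENNReal.ofReal (2 * Real.pi) * circleLength * ENNReal.ofReal K ^ 2 /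
            ENNReal.ofReal ((l / 2) ^ 4) * ENNReal.ofReal (l ^ (((k + 1 : ℕ) : ℝ) - 1)) := by gcongr
        _ = ENNReal.ofReal (2 * Real.pi) * circleLength *
            ENNReal.ofReal (K ^ 2 / (l / 2) ^ 4 * l ^ (((k + 1 : ℕ) : ℝ) - 1)) := by
          rw [← ENNReal.ofReal_pow hKpos.le, mul_div_assoc, ← ENNReal.ofReal_div_of_pos
            (by positivity), mul_assoc, ← ENNReal.ofReal_mul (by positivity)]
        _ ≤ c := by
          rw [hc, hK2]
          gcongr _ * ENNReal.ofReal ?_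
          have hle : l ^ (((k + 1 : ℕ) : ℝ) - 1) ≤ l ^ (4 + e) :=
            Real.rpow_le_rpow_of_exponent_ge hl hl1 (by push_cast; linarith)
          have h4 : l ^ (4 + e) = l ^ 4 * l ^ e := by
            rw [Real.rpow_add hl]
            norm_cast
          rw [h4] at hle
          have hle' : 0 < l ^ e := by positivity
          calc (2 * B') ^ e / l ^ e / (l / 2) ^ 4 * l ^ (((k + 1 : ℕ) : ℝ) - 1)
              ≤ (2 * B') ^ e / l ^ e / (l / 2) ^ 4 * (l ^ 4 * l ^ e) := by gcongr
            _ = 16 * (2 * B') ^ e := by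
              field_simp
              norm_num
    · have : {t : ℝ | l < ‖charFun (squareLaw f) t‖} = ∅ := by
        ext t
        simp only [mem_ofPred_eq, mem_empty_iff_false, iff_false, not_lt]
        exact (norm_charFun_le_one t).trans (not_le.1 hl1).le
      simp [this]
  have hlin : ∫⁻ t, ENNReal.ofReal (‖charFun (squareLaw f) t‖ ^ (k + 1)) ≤ (k + 1 : ℕ) * c := by
    have hlc := lintegral_rpow_eq_lintegral_meas_lt_mul (volume : Measure ℝ)
      (f := fun t => ‖charFun (squareLaw f) t‖) (ae_of_all _ fun t => norm_nonneg _)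
      hm.aemeasurable (p := ((k + 1 : ℕ) : ℝ)) (by positivity)
    simp_rw [Real.rpow_natCast] at hlc
    rw [hlc, ENNReal.ofReal_natCast]
    gcongr
    calc _ ≤ ∫⁻ l in Ioi (0 : ℝ), (Ioc (0 : ℝ) 1).indicator (fun _ => c) l :=
          setLIntegral_mono' measurableSet_Ioi fun l hl => hweak l hl
      _ ≤ ∫⁻ l, (Ioc (0 : ℝ) 1).indicator (fun _ => c) l := setLIntegral_le_lintegral _ _
      _ = c := by
          rw [lintegral_indicator measurableSet_Ioc]
          simp
  have htop : ((k + 1 : ℕ) * c : ℝ≥0∞) ≠ ∞ := ENNReal.mul_ne_top (ENNReal.natCast_ne_top _) hctop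
  refine ⟨⟨(hm.pow_const _).aestronglyMeasurable, ?_⟩, ?_⟩
  · rw [hasFiniteIntegral_iff_ofReal (ae_of_all _ fun t => by positivity)]
    exact hlin.trans_lt htop.lt_top
  · rw [integral_eq_lintegral_of_nonneg_ae (ae_of_all _ fun t => by positivity)
      (hm.pow_const _).aestronglyMeasurable]
    exact ENNReal.toReal_mono htop hlin

/-! ### Powers of the characteristic function of a centred measure -/

lemma abs_sin_nat_mul_le (k : ℕ) (x : ℝ) : |Real.sin (k * x)| ≤ k * |Real.sin x| := by
  induction k with
  | zero => simp
  | succ k ih =>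
    push_cast
    rw [add_mul, one_mul, Real.sin_add]
    calc _ ≤ |Real.sin (k * x) * Real.cos x| + |Real.cos (k * x) * Real.sin x| := abs_add_le _ _
      _ ≤ |Real.sin (k * x)| * 1 + 1 * |Real.sin x| := by
        rw [abs_mul, abs_mul]
        gcongr <;> exact Real.abs_cos_le_one _
      _ ≤ _ := by linarith

lemma one_sub_cos_nat_mul_le (k : ℕ) (x : ℝ) :
    1 - Real.cos (k * x) ≤ k ^ 2 * (1 - Real.cos x) := by
  have h : ∀ y : ℝ, 1 - Real.cos y = 2 * |Real.sin (y / 2)| ^ 2 := fun y => by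
    rw [sq_abs, Real.sin_sq_eq_half_sub, mul_div_cancel₀ y two_ne_zero]
    ring
  rw [h, h, mul_div_assoc]
  have := abs_sin_nat_mul_le k (x / 2)
  calc 2 * |Real.sin (k * (x / 2))| ^ 2 ≤ 2 * (k * |Real.sin (x / 2)|) ^ 2 := by gcongr
    _ = _ := by ring

lemma re_charFun_mul_cexp (ν : Measure ℝ) [IsFiniteMeasure ν] (t α : ℝ) :
    (charFun ν t * cexp (-(α * I))).re = ∫ x, Real.cos (t * x - α) ∂ν := by
  rw [charFun_apply_real, ← integral_mul_const]
  have hi : Integrable (fun x : ℝ => cexp (t * x * I) * cexp (-(α * I))) ν := by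
    refine Integrable.of_bound (C := 1) (by fun_prop) (ae_of_all _ fun x => ?_)
    rw [← Complex.exp_add, ← neg_mul, ← add_mul, ← ofReal_mul, ← ofReal_neg, ← ofReal_add,
      norm_exp_ofReal_mul_I]
  have h2 : ∫ x : ℝ, RCLike.re (cexp (t * x * I) * cexp (-(α * I))) ∂ν =
    RCLike.re (∫ x : ℝ, cexp (t * x * I) * cexp (-(α * I)) ∂ν) := integral_re hi
  refine h2.symm.trans (integral_congr_ae (ae_of_all _ fun x => ?_))
  simp only
  rw [← Complex.exp_add, ← neg_mul, ← add_mul, ← ofReal_mul, ← ofReal_neg, ← ofReal_add,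
    RCLike.re_to_complex, Complex.exp_ofReal_mul_I_re, sub_eq_add_neg]

lemma integrable_cos_sub (ν : Measure ℝ) [IsFiniteMeasure ν] (t α : ℝ) :
    Integrable (fun x => Real.cos (t * x - α)) ν :=
  Integrable.of_bound (C := 1) (by fun_prop) (ae_of_all _ fun x => by
    rw [Real.norm_eq_abs]
    exact Real.abs_cos_le_one _)

/-- If the modulus of a characteristic function is close to `1` at `t`, it remains so at the
multiples of `t`. -/
lemma one_sub_norm_charFun_nat_mul_le (ν : Measure ℝ) [IsProbabilityMeasure ν] (k : ℕ) (t : ℝ) :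
    1 - ‖charFun ν (k * t)‖ ≤ k ^ 2 * (1 - ‖charFun ν t‖) := by
  set α := (charFun ν t).arg
  have h1 : ‖charFun ν t‖ = ∫ x, Real.cos (t * x - α) ∂ν := by
    rw [← re_charFun_mul_cexp]
    conv_rhs => rw [← norm_mul_exp_arg_mul_I (charFun ν t), mul_assoc, ← Complex.exp_add]
    simp [α]
  have h2 : ∫ x, Real.cos (k * t * x - k * α) ∂ν ≤ ‖charFun ν (k * t)‖ := by
    rw [← re_charFun_mul_cexp]
    refine (re_le_norm _).trans_eq ?_
    rw [norm_mul, ← neg_mul, ← ofReal_neg, norm_exp_ofReal_mul_I, mul_one]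
  have h3 : ∫ x, (1 - Real.cos (k * t * x - k * α)) ∂ν ≤
      ∫ x, k ^ 2 * (1 - Real.cos (t * x - α)) ∂ν := by
    refine integral_mono ((integrable_const _).sub (integrable_cos_sub ν _ _))
      (((integrable_const _).sub (integrable_cos_sub ν _ _)).const_mul _) fun x => ?_
    have := one_sub_cos_nat_mul_le k (t * x - α)
    rwa [mul_sub, ← mul_assoc] at this
  rw [integral_const_mul, integral_sub (integrable_const _) (integrable_cos_sub ν _ _),
    integral_sub (integrable_const _) (integrable_cos_sub ν _ _), ← h1] at h3
  simp only [integral_const, probReal_univ, smul_eq_mul, mul_one] at h3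
  linarith

lemma one_sub_norm_charFun_le (ν : Measure ℝ) [IsProbabilityMeasure ν]
    (h : Integrable (fun x => x ^ 2) ν) (t : ℝ) :
    1 - ‖charFun ν t‖ ≤ t ^ 2 / 2 * ∫ x, x ^ 2 ∂ν := by
  have h1 := (re_le_norm (charFun ν t * cexp (-((0 : ℝ) * I))))
  rw [re_charFun_mul_cexp] at h1
  simp only [ofReal_zero, zero_mul, neg_zero, Complex.exp_zero, mul_one] at h1
  have h2 : ∫ x, (1 - t ^ 2 / 2 * x ^ 2) ∂ν ≤ ∫ x, Real.cos (t * x - 0) ∂ν := by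
    refine integral_mono ((integrable_const _).sub (h.const_mul _)) (integrable_cos_sub ν _ _)
      fun x => ?_
    have := Real.one_sub_sq_div_two_le_cos (x := t * x)
    simp only [sub_zero]
    linarith [mul_pow t x 2]
  rw [integral_sub (integrable_const _) (h.const_mul _), integral_const_mul] at h2
  simp only [integral_const, probReal_univ, smul_eq_mul, mul_one] at h2
  linarith

lemma norm_charFun_sub_le (ν : Measure ℝ) [IsProbabilityMeasure ν]
    (h : Integrable (fun x => |x|) ν) (s t : ℝ) :
    ‖charFun ν s - charFun ν t‖ ≤ |s - t| * ∫ x, |x| ∂ν := by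
  have hi : ∀ r : ℝ, Integrable (fun x : ℝ => cexp (r * x * I)) ν := fun r =>
    Integrable.of_bound (C := 1) (by fun_prop) (ae_of_all _ fun x => by
      rw [← ofReal_mul, norm_exp_ofReal_mul_I])
  rw [charFun_apply_real, charFun_apply_real, ← integral_sub (hi s) (hi t), ← integral_const_mul]
  refine norm_integral_le_of_norm_le (h.const_mul _) (ae_of_all _ fun x => ?_)
  have h1 : cexp (s * x * I) - cexp (t * x * I) =
      cexp (t * x * I) * (cexp (I * (((s - t) * x : ℝ) : ℂ)) - 1) := by
    rw [mul_sub, ← Complex.exp_add, mul_one]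
    congr 2
    push_cast
    ring
  rw [h1, norm_mul, ← ofReal_mul, norm_exp_ofReal_mul_I, one_mul, ← abs_mul]
  exact Real.norm_exp_I_mul_ofReal_sub_one_le

lemma norm_cexp_mul_I_sub_le (y : ℝ) : ‖cexp (y * I) - (1 + y * I - y ^ 2 / 2)‖ ≤ 4 * |y| ^ 3 := by
  have hn : ‖(y * I : ℂ)‖ = |y| := by simp
  rcases le_or_gt |y| 1 with hy | hy
  · have h := Complex.exp_bound (x := y * I) (by rwa [hn]) (n := 3) (by norm_num)
    have hs : ∑ m ∈ Finset.range 3, (y * I : ℂ) ^ m / (m.factorial : ℂ) =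
        1 + y * I - y ^ 2 / 2 := by
      simp only [Finset.sum_range_succ, Finset.sum_range_zero, mul_pow, I_sq]
      norm_num [Nat.factorial]
      ring
    rw [hs, hn] at h
    refine h.trans ?_
    have : 0 ≤ |y| ^ 3 := by positivity
    norm_num [Nat.factorial]
    linarith
  · have h1 : ‖cexp (y * I) - (1 + y * I - y ^ 2 / 2)‖ ≤ 1 + (1 + |y| + |y| ^ 2 / 2) := by
      refine (norm_sub_le _ _).trans ?_
      rw [norm_exp_ofReal_mul_I]
      gcongr
      refine (norm_sub_le _ _).trans (add_le_add ((norm_add_le _ _).trans_eq ?_) (le_of_eq ?_))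
      · simp
      · simp
    have h2 : |y| ≤ |y| ^ 3 := le_self_pow₀ hy.le (by norm_num)
    have h3 : |y| ^ 2 ≤ |y| ^ 3 := pow_le_pow_right₀ hy.le (by norm_num)
    have h4 : 1 ≤ |y| ^ 3 := one_le_pow₀ hy.le
    linarith

/-- A centred probability measure on the line whose first three absolute moments are at most `W`. -/
structure IsCenteredWithThirdMoment (ν : Measure ℝ) (W : ℝ) : Prop where
  isProb : IsProbabilityMeasure ν
  integrable_id : Integrable (fun x => x) ν
  mean : ∫ x, x ∂ν = 0
  integrable_sq : Integrable (fun x => x ^ 2) ν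
  integrable_cube : Integrable (fun x => |x| ^ 3) ν
  abs_le : ∫ x, |x| ∂ν ≤ W
  sq_le : ∫ x, x ^ 2 ∂ν ≤ W
  cube_le : ∫ x, |x| ^ 3 ∂ν ≤ W

lemma IsCenteredWithThirdMoment.norm_charFun_sub_le {ν : Measure ℝ} {W : ℝ}
    (h : IsCenteredWithThirdMoment ν W) (t : ℝ) :
    ‖charFun ν t - ((1 - t ^ 2 / 2 * ∫ x, x ^ 2 ∂ν : ℝ) : ℂ)‖ ≤ 4 * W * |t| ^ 3 := by
  have := h.isProb
  have hi : Integrable (fun x : ℝ => cexp (t * x * I)) ν :=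
    Integrable.of_bound (C := 1) (by fun_prop) (ae_of_all _ fun x => by
      rw [← ofReal_mul, norm_exp_ofReal_mul_I])
  have i1 : Integrable (fun x : ℝ => (t * I) * (x : ℂ)) ν := h.integrable_id.ofReal.const_mul _
  have i2 : Integrable (fun x : ℝ => ((t ^ 2 / 2 : ℝ) : ℂ) * ((x ^ 2 : ℝ) : ℂ)) ν :=
    h.integrable_sq.ofReal.const_mul _
  have i0 : Integrable (fun x : ℝ => 1 + (t * I) * (x : ℂ)) ν := (integrable_const 1).add i1
  have i3 : Integrable (fun x : ℝ => 1 + (t * I) * (x : ℂ) -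
      ((t ^ 2 / 2 : ℝ) : ℂ) * ((x ^ 2 : ℝ) : ℂ)) ν := i0.sub i2
  have h1 : ((1 - t ^ 2 / 2 * ∫ x, x ^ 2 ∂ν : ℝ) : ℂ) = ∫ x : ℝ, (1 + (t * I) * (x : ℂ) -
      ((t ^ 2 / 2 : ℝ) : ℂ) * ((x ^ 2 : ℝ) : ℂ)) ∂ν := by
    rw [integral_sub i0 i2, integral_add (integrable_const 1) i1,
      integral_const_mul, integral_const_mul, integral_complex_ofReal, integral_complex_ofReal,
      h.mean]
    simp
  rw [h1, charFun_apply_real, ← integral_sub hi i3]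
  calc _ ≤ ∫ x, 4 * |t| ^ 3 * |x| ^ 3 ∂ν := by
        refine norm_integral_le_of_norm_le (h.integrable_cube.const_mul _) (ae_of_all _ fun x => ?_)
        have := norm_cexp_mul_I_sub_le (t * x)
        rw [abs_mul, mul_pow, ← mul_assoc] at this
        refine le_trans (le_of_eq ?_) this
        congr 2
        · push_cast
          ring_nf
        · push_cast
          ring
    _ ≤ _ := by
        rw [integral_const_mul]
        have := h.cube_le
        calc 4 * |t| ^ 3 * ∫ x, |x| ^ 3 ∂ν ≤ 4 * |t| ^ 3 * W := by gcongr
          _ = _ := by ring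

/-- Markov bound on the set where a characteristic function is at least `1 / 2`. -/
lemma volume_le_of_half_le_norm_charFun {ν : Measure ℝ} {m : ℕ} {D : ℝ}
    (hi : Integrable fun t => ‖charFun ν t‖ ^ m) (hD : ∫ t, ‖charFun ν t‖ ^ m ≤ D)
    {s : Set ℝ} (hs : ∀ t ∈ s, 1 / 2 ≤ ‖charFun ν t‖) :
    volume s ≤ ENNReal.ofReal (2 ^ m * D) := by
  have h1 := mul_meas_ge_le_integral_of_nonneg (ae_of_all _ fun t => by positivity) hi
    ((1 / 2 : ℝ) ^ m)
  have hfin : volume {t | (1 / 2 : ℝ) ^ m ≤ ‖charFun ν t‖ ^ m} ≠ ∞ :=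
    (hi.measure_ge_lt_top (by positivity)).ne
  have hsub : s ⊆ {t | (1 / 2 : ℝ) ^ m ≤ ‖charFun ν t‖ ^ m} := fun t ht => by
    have := hs t ht
    simp only [mem_ofPred_eq]
    gcongr
  refine (measure_mono hsub).trans ((ENNReal.le_ofReal_iff_toReal_le hfin ?_).2 ?_)
  · have : 0 ≤ ∫ t, ‖charFun ν t‖ ^ m := integral_nonneg fun t => by positivity
    have := this.trans hD
    positivity
  · have h2 := h1.trans hD
    rw [← div_le_iff₀' (by positivity)]
    refine le_trans (le_of_eq ?_) h2
    rw [measureReal_def, one_div (2 : ℝ), inv_pow, div_eq_inv_mul]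

/-- A bound on `∫ ‖charFun ν‖ ^ m` bounds the variance from below: with a small variance, the
characteristic function would exceed `1 / 2` on a long interval. -/
lemma exists_le_variance (m : ℕ) (D : ℝ) : ∃ v : ℝ, 0 < v ∧ v ≤ 1 ∧ ∀ (ν : Measure ℝ) (W : ℝ),
    IsCenteredWithThirdMoment ν W → (Integrable fun t => ‖charFun ν t‖ ^ m) →
      ∫ t, ‖charFun ν t‖ ^ m ≤ D → v ≤ ∫ x, x ^ 2 ∂ν := by
  set T : ℝ := 2 ^ m * (|D| + 1) with hT
  have hT1 : 1 ≤ T := one_le_mul_of_one_le_of_one_le (one_le_pow₀ (by norm_num))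
    (by linarith [abs_nonneg D])
  refine ⟨1 / T ^ 2, by positivity, ?_, fun ν W h hi hD => ?_⟩
  · rw [div_le_one (by positivity)]
    exact one_le_pow₀ hT1
  have := h.isProb
  by_contra! hlt
  -- on `[-T, T]` the modulus is at least `1 / 2`, and `2 T` exceeds the Markov bound `2 ^ m D`
  have hvol := volume_le_of_half_le_norm_charFun hi hD (s := Icc (-T) T) fun t ht => by
    have h1 := one_sub_norm_charFun_le ν h.integrable_sq t
    have h2 : t ^ 2 ≤ T ^ 2 := sq_le_sq' ht.1 ht.2
    have h3 : 0 ≤ ∫ x, x ^ 2 ∂ν := integral_nonneg fun x => sq_nonneg x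
    have h4 : t ^ 2 / 2 * ∫ x, x ^ 2 ∂ν ≤ T ^ 2 / 2 * (1 / T ^ 2) := by gcongr
    have h5 : T ^ 2 / 2 * (1 / T ^ 2) = 1 / 2 := by field_simp
    linarith
  rw [Real.volume_Icc, ENNReal.ofReal_le_ofReal_iff'] at hvol
  have hp : (1 : ℝ) ≤ 2 ^ m := one_le_pow₀ (by norm_num)
  rcases hvol with hvol | hvol
  · have : 2 ^ m * D ≤ 2 ^ m * |D| := by gcongr; exact le_abs_self D
    nlinarith
  · linarith

/-- Away from the origin the modulus of the characteristic function is bounded away from `1`,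
uniformly. Otherwise it would be at least `1 / 2` near many multiples of some `t`, which contradicts
the integrability of a power. -/
lemma exists_norm_charFun_le (m : ℕ) (D W δ : ℝ) (hW : 1 ≤ W) (hδ : 0 < δ) :
    ∃ κ : ℝ, 0 < κ ∧ κ < 1 ∧ ∀ ν : Measure ℝ,
    IsCenteredWithThirdMoment ν W → (Integrable fun t => ‖charFun ν t‖ ^ m) →
      ∫ t, ‖charFun ν t‖ ^ m ≤ D → ∀ t, δ ≤ |t| → ‖charFun ν t‖ ≤ κ := by
  set r : ℝ := min (1 / (4 * W)) (δ / 2) with hr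
  have hr0 : 0 < r := lt_min (by positivity) (by positivity)
  have hrW : r * W ≤ 1 / 4 := by
    calc r * W ≤ 1 / (4 * W) * W := by gcongr; exact min_le_left _ _
      _ = 1 / 4 := by field_simp
  have hrδ : 2 * r ≤ δ := by linarith [min_le_right (1 / (4 * W)) (δ / 2)]
  obtain ⟨n, hn⟩ := exists_nat_gt (max 1 (2 ^ m * D / (2 * r)))
  have hn1 : (1 : ℝ) < n := (le_max_left _ _).trans_lt hn
  have hnD : 2 ^ m * D < n * (2 * r) := by
    rw [← div_lt_iff₀ (by positivity)]
    exact (le_max_right _ _).trans_lt hn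
  have hnn : (1 : ℝ) < (n : ℝ) ^ 2 := one_lt_pow₀ hn1 two_ne_zero
  refine ⟨1 - 1 / (4 * n ^ 2), ?_, ?_, fun ν h hi hD t ht => ?_⟩
  · rw [sub_pos, div_lt_one (by positivity)]
    linarith
  · rw [sub_lt_self_iff]
    positivity
  have := h.isProb
  by_contra! hlt
  -- the multiples `k * t` are `2 * r`-separated, and `|charFun ν|` is large near each of them
  set J : ℕ → Set ℝ := fun k => Ioo (k * t - r) (k * t + r) with hJ
  have hbig : ∀ x ∈ ⋃ k ∈ Finset.Icc 1 n, J k, 1 / 2 ≤ ‖charFun ν x‖ := by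
    intro x hx
    simp only [mem_iUnion, Finset.mem_Icc, exists_prop, hJ, mem_Ioo] at hx
    obtain ⟨k, ⟨hk1, hkn⟩, hx1, hx2⟩ := hx
    have h1 := one_sub_norm_charFun_nat_mul_le ν k t
    have h2 : (k : ℝ) ^ 2 * (1 - ‖charFun ν t‖) ≤ n ^ 2 * (1 / (4 * n ^ 2)) := by
      have : 0 ≤ 1 - ‖charFun ν t‖ := by linarith [norm_charFun_le_one (μ := ν) t]
      gcongr
      linarith
    have h3 : (n : ℝ) ^ 2 * (1 / (4 * n ^ 2)) = 1 / 4 := by field_simp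
    have h4 := KacSphere.norm_charFun_sub_le ν h.integrable_id.abs (k * t) x
    have h5 : |k * t - x| * ∫ x, |x| ∂ν ≤ r * W := by
      have : |k * t - x| ≤ r := abs_le.2 ⟨by linarith, by linarith⟩
      have h6 : 0 ≤ ∫ x, |x| ∂ν := integral_nonneg fun x => abs_nonneg x
      gcongr
      exact h.abs_le
    have h6 := norm_sub_norm_le (charFun ν (k * t)) (charFun ν x)
    linarith
  have hvol := volume_le_of_half_le_norm_charFun hi hD hbig
  rw [measure_biUnion_finset] at hvol
  · simp only [hJ, Real.volume_Ioo] at hvol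
    rw [Finset.sum_congr rfl (fun k _ => by rw [show k * t + r - (k * t - r) = 2 * r by ring]),
      Finset.sum_const, Nat.card_Icc, Nat.add_sub_cancel, nsmul_eq_mul, ← ENNReal.ofReal_natCast,
      ← ENNReal.ofReal_mul (by positivity), ENNReal.ofReal_le_ofReal_iff'] at hvol
    rcases hvol with hvol | hvol
    · linarith
    · have : 0 < (n : ℝ) * (2 * r) := by positivity
      linarith
  · intro k _ l _ hkl
    refine Set.disjoint_left.2 fun x hx hy => ?_
    simp only [hJ, mem_Ioo] at hx hy
    have h1 : |(k - l : ℝ) * t| < 2 * r := abs_lt.2 ⟨by linarith, by linarith⟩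
    have h2 : (1 : ℝ) ≤ |(k : ℝ) - l| := by
      have : (1 : ℤ) ≤ |(k : ℤ) - l| := Int.one_le_abs (sub_ne_zero.2 (by exact_mod_cast hkl))
      exact_mod_cast this
    rw [abs_mul] at h1
    nlinarith [abs_nonneg t]
  · intro k _
    exact measurableSet_Ioo

lemma norm_pow_sub_pow_le {a b : ℂ} {r : ℝ} (ha : ‖a‖ ≤ r) (hb : ‖b‖ ≤ r) (n : ℕ) :
    ‖a ^ (n + 1) - b ^ (n + 1)‖ ≤ (n + 1) * r ^ n * ‖a - b‖ := by
  have hr : 0 ≤ r := (norm_nonneg a).trans ha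
  induction n with
  | zero => simp
  | succ n ih =>
    have h : a ^ (n + 1 + 1) - b ^ (n + 1 + 1) =
        a * (a ^ (n + 1) - b ^ (n + 1)) + (a - b) * b ^ (n + 1) := by ring
    rw [h]
    calc _ ≤ ‖a * (a ^ (n + 1) - b ^ (n + 1))‖ + ‖(a - b) * b ^ (n + 1)‖ := norm_add_le _ _
      _ = ‖a‖ * ‖a ^ (n + 1) - b ^ (n + 1)‖ + ‖a - b‖ * ‖b‖ ^ (n + 1) := by
        rw [norm_mul, norm_mul, norm_pow]
      _ ≤ r * ((n + 1) * r ^ n * ‖a - b‖) + ‖a - b‖ * r ^ (n + 1) := by gcongr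
      _ = _ := by push_cast; ring

/-- The integral `∫ |t| ^ k exp (-t ^ 2) dt`. -/
noncomputable def gaussMoment (k : ℕ) : ℝ := ∫ t : ℝ, |t| ^ k * Real.exp (-t ^ 2)

lemma integrable_abs_pow_mul_exp (k : ℕ) {a : ℝ} (ha : 0 < a) :
    Integrable fun t : ℝ => |t| ^ k * Real.exp (-a * t ^ 2) := by
  have h := (integrable_rpow_mul_exp_neg_mul_sq ha (s := k)
    (lt_of_lt_of_le neg_one_lt_zero (Nat.cast_nonneg k))).norm
  refine h.congr (ae_of_all _ fun t => ?_)
  simp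

lemma integral_abs_pow_mul_exp (k : ℕ) {a : ℝ} (ha : 0 < a) :
    ∫ t : ℝ, |t| ^ k * Real.exp (-a * t ^ 2) = gaussMoment k / √a ^ (k + 1) := by
  have hs := Real.sqrt_pos.2 ha
  have h := Measure.integral_comp_mul_left (fun t : ℝ => |t| ^ k * Real.exp (-t ^ 2)) √a
  have h2 : ∀ t : ℝ, |t| ^ k * Real.exp (-a * t ^ 2) =
      (√a ^ k)⁻¹ * (|√a * t| ^ k * Real.exp (-(√a * t) ^ 2)) := by
    intro t
    rw [abs_mul, abs_of_pos hs, mul_pow, mul_pow, Real.sq_sqrt ha.le, neg_mul]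
    field_simp
  simp_rw [h2]
  rw [integral_const_mul, h, abs_of_pos (by positivity), smul_eq_mul, gaussMoment, pow_succ]
  field_simp

lemma gaussMoment_nonneg (k : ℕ) : 0 ≤ gaussMoment k :=
  integral_nonneg fun t => by positivity

lemma exists_pow_sub_le_div {κ : ℝ} (h0 : 0 < κ) (h1 : κ < 1) {m : ℕ} (hm : m ≠ 0) :
    ∃ C : ℝ, 0 < C ∧ ∀ N : ℕ, m ≤ N → κ ^ (N - m) ≤ C / N := by
  obtain ⟨C, hC⟩ := (tendsto_self_mul_const_pow_of_lt_one h0.le h1).bddAbove_range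
  refine ⟨max C 1 / κ ^ m, by positivity, fun N hN => ?_⟩
  have hNpos : 0 < N := by omega
  have h2 : (N : ℝ) * κ ^ N ≤ max C 1 := (hC ⟨N, rfl⟩).trans (le_max_left _ _)
  have h3 : κ ^ N = κ ^ (N - m) * κ ^ m := by rw [← pow_add, Nat.sub_add_cancel hN]
  rw [le_div_iff₀ (by positivity), le_div_iff₀ (by positivity)]
  rw [h3] at h2
  linarith

/-- Near the origin, the characteristic function has Gaussian decay and is close to the Gaussian of
the same variance. -/
lemma norm_charFun_le_exp_and_norm_sub_exp_le {ν : Measure ℝ} {v W : ℝ}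
    (h : IsCenteredWithThirdMoment ν W) (hv : 0 < v) (hv1 : v ≤ 1) (hW : 1 ≤ W)
    (hvar : v ≤ ∫ x, x ^ 2 ∂ν) {t : ℝ} (ht : |t| ≤ v / (16 * W)) :
    ‖charFun ν t‖ ≤ Real.exp (-(v / 4) * t ^ 2) ∧
    ‖charFun ν t - (Real.exp (-((∫ x, x ^ 2 ∂ν) / 2) * t ^ 2) : ℝ)‖ ≤ 5 * W * |t| ^ 3 := by
  set V := ∫ x, x ^ 2 ∂ν with hV
  have hVW : V ≤ W := h.sq_le
  have h1 := h.norm_charFun_sub_le t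
  rw [← hV] at h1
  have hV0 : 0 < V := hv.trans_le hvar
  have ht0 := abs_nonneg t
  have htW : 16 * W * |t| ≤ v := by
    rw [le_div_iff₀ (by positivity)] at ht
    linarith
  have ht1 : |t| ≤ 1 / 16 := by nlinarith
  have hWt : W * |t| ≤ 1 / 16 := by linarith
  have hsq : t ^ 2 = |t| ^ 2 := (sq_abs t).symm
  have hVt : V * t ^ 2 ≤ 1 := by rw [hsq]; nlinarith
  constructor
  · have h2 : ‖((1 - t ^ 2 / 2 * V : ℝ) : ℂ)‖ = 1 - t ^ 2 / 2 * V := by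
      rw [norm_real, Real.norm_of_nonneg]
      linarith
    have h3 := norm_sub_norm_le (charFun ν t) ((1 - t ^ 2 / 2 * V : ℝ) : ℂ)
    have h4 : 4 * W * |t| ^ 3 ≤ v / 4 * t ^ 2 := by
      rw [hsq]
      have : 0 ≤ |t| ^ 2 := by positivity
      nlinarith
    have h5 := Real.add_one_le_exp (-(v / 4) * t ^ 2)
    have h6 : v * t ^ 2 ≤ V * t ^ 2 := by gcongr
    linarith
  · have h2 := Real.abs_exp_sub_one_sub_id_le (x := -(V / 2) * t ^ 2) (by
      rw [neg_mul, abs_neg, abs_of_nonneg (by positivity)]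
      linarith)
    have h3 : ‖((1 - t ^ 2 / 2 * V : ℝ) : ℂ) - (Real.exp (-(V / 2) * t ^ 2) : ℝ)‖ ≤
        (-(V / 2) * t ^ 2) ^ 2 := by
      rw [← ofReal_sub, norm_real, Real.norm_eq_abs, abs_sub_comm]
      refine le_trans (le_of_eq ?_) h2
      congr 1
      ring_nf
    have h4 : (-(V / 2) * t ^ 2) ^ 2 ≤ W * |t| ^ 3 := by
      have h5 : (-(V / 2) * t ^ 2) ^ 2 = V * V * |t| / 4 * |t| ^ 3 := by rw [hsq]; ring
      rw [h5]
      gcongr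
      have : V * |t| ≤ 1 / 16 := by nlinarith
      nlinarith
    have h5 := norm_sub_le_norm_sub_add_norm_sub (charFun ν t) ((1 - t ^ 2 / 2 * V : ℝ) : ℂ)
      ((Real.exp (-(V / 2) * t ^ 2) : ℝ) : ℂ)
    linarith

set_option maxHeartbeats 800000 in
/-- A quantitative local central limit theorem at the mean: the integral of the `N`-th power of the
characteristic function is at least of order `1 / √N`, and its absolute moment of order one is at
most of order `1 / N`, uniformly over centred measures with bounded third moment and bounded
`∫ ‖charFun ν‖ ^ m`. -/
theorem exists_charFun_estimates {m : ℕ} (hm : m ≠ 0) (D : ℝ) {W : ℝ} (hW : 1 ≤ W) :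
    ∃ (c C : ℝ) (N₁ : ℕ), 0 < c ∧ 0 < C ∧ ∀ ν : Measure ℝ, IsCenteredWithThirdMoment ν W →
      (Integrable fun t => ‖charFun ν t‖ ^ m) → ∫ t, ‖charFun ν t‖ ^ m ≤ D →
      ∀ N : ℕ, N₁ ≤ N → (Integrable fun t => charFun ν t ^ N) ∧
        ∫ t, ‖charFun ν t‖ ^ N * min 1 |t| ≤ C / N ∧ c / √N ≤ (∫ t, charFun ν t ^ N).re := by
  obtain ⟨v, hv, hv1, hvar⟩ := exists_le_variance m D
  set δ : ℝ := v / (16 * W) with hδ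
  have hδ0 : 0 < δ := by positivity
  obtain ⟨κ, hκ0, hκ1, hκ⟩ := exists_norm_charFun_le m D W δ hW hδ0
  obtain ⟨C₀, hC₀, hκC⟩ := exists_pow_sub_le_div hκ0 hκ1 hm
  set C₁ : ℝ := gaussMoment 1 * (4 / v) + C₀ * |D| + 1 with hC₁
  set C₂ : ℝ := (5 * W + 1 / δ ^ 3) * (gaussMoment 3 * (8 / v) ^ 2) + C₀ * |D| + 1 with hC₂
  have hg1 := gaussMoment_nonneg 1
  have hg3 := gaussMoment_nonneg 3
  have hC₁0 : 0 < C₁ := by positivity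
  have hC₂0 : 0 < C₂ := by positivity
  set c₀ : ℝ := √(2 * Real.pi / W) with hc₀
  have hc₀0 : 0 < c₀ := by positivity
  obtain ⟨N₁, hN₁⟩ := exists_nat_ge (max (max (m : ℝ) 2) ((2 * C₂ / c₀) ^ 2))
  refine ⟨c₀ / 2, C₁, N₁, by positivity, hC₁0, fun ν h hi hD N hN => ?_⟩
  have := h.isProb
  set V := ∫ x, x ^ 2 ∂ν with hV
  have hvV : v ≤ V := hvar ν W h hi hD
  have hV0 : 0 < V := hv.trans_le hvV
  have hVW : V ≤ W := h.sq_le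
  have hNr : (N₁ : ℝ) ≤ N := by exact_mod_cast hN
  have hmax := hN₁.trans hNr
  have hmN : m ≤ N := by exact_mod_cast ((le_max_left _ _).trans (le_max_left _ _)).trans hmax
  have h2N : (2 : ℝ) ≤ N := ((le_max_right _ _).trans (le_max_left _ _)).trans hmax
  have hcN : (2 * C₂ / c₀) ^ 2 ≤ N := (le_max_right _ _).trans hmax
  have hN0 : (0 : ℝ) < N := by linarith
  have hone : ∀ t, ‖charFun ν t‖ ≤ 1 := fun t => norm_charFun_le_one t
  have hmeas : Measurable fun t => charFun ν t := measurable_charFun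
  have hpow : Integrable fun t => charFun ν t ^ N := by
    refine hi.mono (hmeas.pow_const N).aestronglyMeasurable (ae_of_all _ fun t => ?_)
    rw [norm_pow, Real.norm_of_nonneg (by positivity)]
    exact pow_le_pow_of_le_one (norm_nonneg _) (hone t) hmN
  have hDabs : ∫ t, ‖charFun ν t‖ ^ m ≤ |D| := hD.trans (le_abs_self D)
  -- the region `δ ≤ |t|` contributes exponentially little
  have hfar : ∀ t, δ ≤ |t| → ‖charFun ν t‖ ^ N ≤ κ ^ (N - m) * ‖charFun ν t‖ ^ m := by
    intro t ht
    conv_lhs => rw [← Nat.sub_add_cancel hmN, pow_add]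
    gcongr
    exact hκ ν h hi hD t ht
  have hfarint : κ ^ (N - m) * ∫ t, ‖charFun ν t‖ ^ m ≤ C₀ / N * |D| := by
    have h0 : 0 ≤ ∫ t, ‖charFun ν t‖ ^ m := integral_nonneg fun t => by positivity
    have h1 := hκC N hmN
    gcongr
  refine ⟨hpow, ?_, ?_⟩
  · have hint := integrable_abs_pow_mul_exp 1 (a := N * (v / 4)) (by positivity)
    calc ∫ t, ‖charFun ν t‖ ^ N * min 1 |t|
        ≤ ∫ t, (|t| ^ 1 * Real.exp (-(N * (v / 4)) * t ^ 2) +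
            κ ^ (N - m) * ‖charFun ν t‖ ^ m) := by
          refine integral_mono_of_nonneg (ae_of_all _ fun t => by positivity)
            (hint.add (hi.const_mul _)) (ae_of_all _ fun t => ?_)
          simp only
          have hp1 : 0 ≤ |t| ^ 1 * Real.exp (-(N * (v / 4)) * t ^ 2) := by positivity
          have hp2 : 0 ≤ κ ^ (N - m) * ‖charFun ν t‖ ^ m := by positivity
          rcases le_total |t| δ with ht | ht
          · have h1 := (norm_charFun_le_exp_and_norm_sub_exp_le h hv hv1 hW hvV ht).1
            have h2 : ‖charFun ν t‖ ^ N * min 1 |t| ≤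
                Real.exp (-(v / 4) * t ^ 2) ^ N * |t| := by
              gcongr
              exact min_le_right _ _
            rw [← Real.exp_nat_mul] at h2
            rw [pow_one]
            have h3 : (N : ℝ) * (-(v / 4) * t ^ 2) = -(N * (v / 4)) * t ^ 2 := by ring
            rw [h3] at h2
            linarith
          · have h2 : ‖charFun ν t‖ ^ N * min 1 |t| ≤ ‖charFun ν t‖ ^ N * 1 := by
              gcongr
              exact min_le_left _ _
            have := hfar t ht
            linarith
      _ ≤ gaussMoment 1 * (4 / v) / N + C₀ / N * |D| := by
          rw [integral_add hint (hi.const_mul _), integral_const_mul,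
            integral_abs_pow_mul_exp 1 (by positivity), Real.sq_sqrt (by positivity)]
          refine add_le_add (le_of_eq ?_) hfarint
          field_simp
      _ ≤ C₁ / N := by
          rw [hC₁, div_mul_eq_mul_div, ← add_div]
          gcongr ?_ / _
          linarith
  · have hint3 := integrable_abs_pow_mul_exp 3 (a := N * (v / 8)) (by positivity)
    have hG : Integrable fun t : ℝ => Real.exp (-(N * (V / 2)) * t ^ 2) :=
      integrable_exp_neg_mul_sq (by positivity)
    have hGc : Integrable fun t : ℝ => ((Real.exp (-(N * (V / 2)) * t ^ 2) : ℝ) : ℂ) := hG.ofReal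
    -- comparison with the Gaussian of the same variance; where `δ ≤ |t|`, the factor
    -- `|t| ^ 3 / δ ^ 3` is at least `1`
    have hbound : ∀ t, ‖charFun ν t ^ N - (Real.exp (-(N * (V / 2)) * t ^ 2) : ℝ)‖ ≤
        (5 * W * N + 1 / δ ^ 3) * (|t| ^ 3 * Real.exp (-(N * (v / 8)) * t ^ 2)) +
          κ ^ (N - m) * ‖charFun ν t‖ ^ m := by
      intro t
      have hp2 : 0 ≤ κ ^ (N - m) * ‖charFun ν t‖ ^ m := by positivity
      have ht2 := sq_nonneg t
      rcases le_total |t| δ with ht | ht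
      · obtain ⟨h1, h2⟩ := norm_charFun_le_exp_and_norm_sub_exp_le h hv hv1 hW hvV ht
        obtain ⟨n, rfl⟩ : ∃ n, N = n + 1 := ⟨N - 1, by
          have : 2 ≤ N := by exact_mod_cast h2N
          omega⟩
        have h3 : ‖((Real.exp (-(V / 2) * t ^ 2) : ℝ) : ℂ)‖ ≤ Real.exp (-(v / 4) * t ^ 2) := by
          rw [norm_real, Real.norm_of_nonneg (by positivity)]
          gcongr
          linarith
        have h4 := norm_pow_sub_pow_le h1 h3 n
        rw [← ofReal_pow, ← Real.exp_nat_mul, ← Real.exp_nat_mul] at h4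
        have h5 : ((n + 1 : ℕ) : ℝ) * (-(V / 2) * t ^ 2) =
            -(((n + 1 : ℕ) : ℝ) * (V / 2)) * t ^ 2 := by ring
        rw [h5] at h4
        have h6 : Real.exp (n * (-(v / 4) * t ^ 2)) ≤
            Real.exp (-(((n + 1 : ℕ) : ℝ) * (v / 8)) * t ^ 2) := by
          rw [Real.exp_le_exp]
          push_cast at h2N ⊢
          have : 0 ≤ v * t ^ 2 := by positivity
          nlinarith
        have h7 : 0 ≤ 1 / δ ^ 3 * (|t| ^ 3 *
          Real.exp (-(((n + 1 : ℕ) : ℝ) * (v / 8)) * t ^ 2)) := by positivity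
        calc _ ≤ _ := h4
          _ ≤ ((n : ℝ) + 1) * Real.exp (-(((n + 1 : ℕ) : ℝ) * (v / 8)) * t ^ 2) *
              (5 * W * |t| ^ 3) := by gcongr
          _ = 5 * W * ((n + 1 : ℕ) : ℝ) * (|t| ^ 3 *
              Real.exp (-(((n + 1 : ℕ) : ℝ) * (v / 8)) * t ^ 2)) := by push_cast; ring
          _ ≤ _ := by
            rw [add_mul]
            linarith
      · have h1 := hfar t ht
        have h2 : Real.exp (-(N * (V / 2)) * t ^ 2) ≤
            1 / δ ^ 3 * (|t| ^ 3 * Real.exp (-(N * (v / 8)) * t ^ 2)) := by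
          have h3 : 1 ≤ 1 / δ ^ 3 * |t| ^ 3 := by
            rw [one_div, inv_mul_eq_div, one_le_div (by positivity)]
            gcongr
          rw [← mul_assoc]
          refine le_trans ?_ (le_mul_of_one_le_left (by positivity) h3)
          gcongr
          linarith
        have h3 : 0 ≤ 5 * W * N * (|t| ^ 3 * Real.exp (-(N * (v / 8)) * t ^ 2)) := by positivity
        refine (norm_sub_le _ _).trans ?_
        rw [norm_pow, norm_real, Real.norm_of_nonneg (by positivity), add_mul]
        linarith
    have hdiff : ‖(∫ t, charFun ν t ^ N) - ∫ t : ℝ, ((Real.exp (-(N * (V / 2)) * t ^ 2) : ℝ) : ℂ)‖ ≤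
        C₂ / N := by
      rw [← integral_sub hpow hGc]
      calc _ ≤ ∫ t, ((5 * W * N + 1 / δ ^ 3) * (|t| ^ 3 * Real.exp (-(N * (v / 8)) * t ^ 2)) +
              κ ^ (N - m) * ‖charFun ν t‖ ^ m) :=
            norm_integral_le_of_norm_le ((hint3.const_mul _).add (hi.const_mul _))
              (ae_of_all _ hbound)
        _ ≤ (5 * W * N + 1 / δ ^ 3) * (gaussMoment 3 * (8 / v) ^ 2 / N ^ 2) + C₀ / N * |D| := by
            rw [integral_add (hint3.const_mul _) (hi.const_mul _), integral_const_mul,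
              integral_const_mul, integral_abs_pow_mul_exp 3 (by positivity)]
            refine add_le_add (le_of_eq ?_) hfarint
            have : √(N * (v / 8)) ^ (3 + 1) = (N * (v / 8)) ^ 2 := by
              rw [show 3 + 1 = 2 * 2 by norm_num, pow_mul, Real.sq_sqrt (by positivity)]
            rw [this]
            field_simp
        _ ≤ (5 * W * N + 1 / δ ^ 3 * N) * (gaussMoment 3 * (8 / v) ^ 2 / N ^ 2) + C₀ / N * |D| := by
            gcongr
            exact le_mul_of_one_le_right (by positivity) (by linarith)
        _ = ((5 * W + 1 / δ ^ 3) * (gaussMoment 3 * (8 / v) ^ 2) + C₀ * |D|) / N := by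
            field_simp
        _ ≤ C₂ / N := by
            rw [hC₂]
            gcongr ?_ / _
            linarith
    -- the Gaussian integral is of order `1 / √N`, the error of order `1 / N`
    have hgauss : c₀ / √N ≤ ∫ t : ℝ, Real.exp (-(N * (V / 2)) * t ^ 2) := by
      rw [integral_gaussian, hc₀, ← Real.sqrt_div' _ hN0.le]
      refine Real.sqrt_le_sqrt ?_
      rw [div_div, div_le_div_iff₀ (by positivity) (by positivity)]
      have := Real.pi_pos
      have : Real.pi * (N * V) ≤ Real.pi * (N * W) := by gcongr
      linarith
    have hre := abs_re_le_norm ((∫ t, charFun ν t ^ N) -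
      ∫ t : ℝ, ((Real.exp (-(N * (V / 2)) * t ^ 2) : ℝ) : ℂ))
    rw [integral_complex_ofReal, sub_re, ofReal_re] at hre
    rw [integral_complex_ofReal] at hdiff
    have h1 := (abs_le.1 (hre.trans hdiff)).1
    have h2 : C₂ / N ≤ c₀ / 2 / √N := by
      have hs := Real.sqrt_pos.2 hN0
      have h3 : 2 * C₂ / c₀ ≤ √N := Real.le_sqrt_of_sq_le hcN
      rw [div_le_iff₀ hc₀0] at h3
      calc C₂ / N = C₂ / √N / √N := by rw [div_div, Real.mul_self_sqrt hN0.le]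
        _ ≤ c₀ / 2 / √N := by
          gcongr ?_ / _
          rw [div_le_iff₀ hs]
          linarith
    have h3 : c₀ / √N = c₀ / 2 / √N + c₀ / 2 / √N := by ring
    linarith

/-! ### Estimates on the densities -/

/-- A probability density with `∫ f ^ q ≤ B`, moment of order six at most `M` and energy `1`. The
bounds are in a form that makes all later constants depend on `q`, `B` and `M` only. -/
structure IsKacDensity (q B M : ℝ) (f : ℝ → ℝ) : Prop where
  measurable : Measurable f
  nonneg : ∀ v, 0 ≤ f v
  integral_eq_one : ∫ v, f v = 1
  integrable_rpow : Integrable fun v => f v ^ q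
  integral_rpow_le : ∫ v, f v ^ q ≤ B
  integrable_moment : Integrable fun v => (1 + v ^ 2) ^ 3 * f v
  integral_moment_le : ∫ v, (1 + v ^ 2) ^ 3 * f v ≤ M
  energy : ∫ v, f v * v ^ 2 = 1

namespace IsKacDensity

variable {q B M : ℝ} {f : ℝ → ℝ}

lemma integrable (h : IsKacDensity q B M f) : Integrable f :=
  .of_integral_ne_zero (by simp [h.integral_eq_one])

lemma integrable_mul_of_le (h : IsKacDensity q B M f) {g : ℝ → ℝ} (hg : Measurable g)
    (hle : ∀ v, |g v| ≤ (1 + v ^ 2) ^ 3) : Integrable fun v => f v * g v := by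
  refine h.integrable_moment.mono (h.measurable.mul hg).aestronglyMeasurable
    (ae_of_all _ fun v => ?_)
  rw [norm_mul, norm_mul, mul_comm, Real.norm_eq_abs (g v),
    Real.norm_of_nonneg (r := (1 + v ^ 2) ^ 3) (by positivity)]
  gcongr
  exact hle v

lemma integral_mul_le_of_le (h : IsKacDensity q B M f) {g : ℝ → ℝ} (hg : Measurable g)
    (hle : ∀ v, |g v| ≤ (1 + v ^ 2) ^ 3) : ∫ v, f v * g v ≤ M := by
  refine le_trans (integral_mono (h.integrable_mul_of_le hg hle) h.integrable_moment fun v => ?_)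
    h.integral_moment_le
  simp only
  rw [mul_comm]
  have := h.nonneg v
  gcongr
  exact (le_abs_self _).trans (hle v)

lemma one_le (h : IsKacDensity q B M f) : 1 ≤ M := by
  have := h.integral_mul_le_of_le (g := fun _ => 1) measurable_const fun v => by
    rw [abs_one]
    exact one_le_pow₀ (by linarith [sq_nonneg v])
  simpa [h.integral_eq_one] using this

lemma isProbabilityMeasure (h : IsKacDensity q B M f) : IsProbabilityMeasure (squareLaw f) :=
  isProbabilityMeasure_squareLaw h.nonneg h.integral_eq_one

/-- The law of `v ^ 2 - 1` is centred, with a third moment controlled by the sixth moment of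
`f`. -/
lemma isCentered (h : IsKacDensity q B M f) :
    IsCenteredWithThirdMoment ((squareLaw f).map (· + (-1))) M := by
  have hP := h.isProbabilityMeasure
  have hmap : (squareLaw f).map (· + (-1 : ℝ)) = (densityMeasure f).map (fun v => v ^ 2 + -1) := by
    rw [squareLaw, Measure.map_map (by fun_prop) (by fun_prop)]
    rfl
  have hofR : Measurable fun v => ENNReal.ofReal (f v) := h.measurable.ennreal_ofReal
  have hsm : ∀ g : ℝ → ℝ, (fun v => (ENNReal.ofReal (f v)).toReal • g (v ^ 2 + -1)) =
      fun v => f v * g (v ^ 2 + -1) := fun g => by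
    ext v
    rw [ENNReal.toReal_ofReal (h.nonneg v), smul_eq_mul]
  have hint : ∀ g : ℝ → ℝ, Measurable g →
      ∫ x, g x ∂((squareLaw f).map (· + (-1 : ℝ))) = ∫ v, f v * g (v ^ 2 + -1) := by
    intro g hg
    rw [hmap, integral_map (by fun_prop) hg.aestronglyMeasurable, densityMeasure,
      integral_withDensity_eq_integral_toReal_smul hofR (by simp)]
    rw [hsm g]
  have hinte : ∀ g : ℝ → ℝ, Measurable g → (Integrable fun v => f v * g (v ^ 2 + -1)) →
      Integrable g ((squareLaw f).map (· + (-1 : ℝ))) := by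
    intro g hg hi
    rw [hmap, integrable_map_measure hg.aestronglyMeasurable (by fun_prop), densityMeasure,
      integrable_withDensity_iff_integrable_smul' hofR (by simp)]
    simp only [Function.comp_apply]
    rwa [hsm g]
  have b0 : ∀ v : ℝ, |v ^ 2 + -1| ≤ 1 + v ^ 2 := fun v =>
    abs_le.2 ⟨by linarith [sq_nonneg v], by linarith⟩
  have b1 : ∀ v : ℝ, 1 ≤ 1 + v ^ 2 := fun v => by linarith [sq_nonneg v]
  have c1 : ∀ v : ℝ, |v ^ 2 + -1| ≤ (1 + v ^ 2) ^ 3 := fun v =>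
    (b0 v).trans (le_self_pow₀ (b1 v) (by norm_num))
  have c2 : ∀ v : ℝ, |(v ^ 2 + -1) ^ 2| ≤ (1 + v ^ 2) ^ 3 := fun v => by
    rw [abs_pow]
    exact (pow_le_pow_left₀ (abs_nonneg _) (b0 v) 2).trans (pow_le_pow_right₀ (b1 v) (by norm_num))
  have c3 : ∀ v : ℝ, |(|v ^ 2 + -1| ^ 3)| ≤ (1 + v ^ 2) ^ 3 := fun v => by
    rw [abs_of_nonneg (by positivity)]
    exact pow_le_pow_left₀ (abs_nonneg _) (b0 v) 3
  have c1' : ∀ v : ℝ, |(|v ^ 2 + -1|)| ≤ (1 + v ^ 2) ^ 3 := fun v => by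
    rw [abs_abs]
    exact c1 v
  have hen : Integrable fun v => f v * v ^ 2 := h.integrable_mul_of_le (by fun_prop) fun v => by
    rw [abs_of_nonneg (sq_nonneg v)]
    exact (by linarith : v ^ 2 ≤ 1 + v ^ 2).trans (le_self_pow₀ (b1 v) (by norm_num))
  constructor
  · exact Measure.isProbabilityMeasure_map (by fun_prop)
  · exact hinte (fun x => x) (by fun_prop) (h.integrable_mul_of_le (by fun_prop) c1)
  · rw [hint (fun x => x) (by fun_prop)]
    simp_rw [mul_add]
    rw [integral_add hen (h.integrable.mul_const _), integral_mul_const, h.energy,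
      h.integral_eq_one]
    norm_num
  · exact hinte (fun x => x ^ 2) (by fun_prop) (h.integrable_mul_of_le (by fun_prop) c2)
  · exact hinte (fun x => |x| ^ 3) (by fun_prop) (h.integrable_mul_of_le (by fun_prop) c3)
  · rw [hint (fun x => |x|) (by fun_prop)]
    exact h.integral_mul_le_of_le (by fun_prop) c1'
  · rw [hint (fun x => x ^ 2) (by fun_prop)]
    exact h.integral_mul_le_of_le (by fun_prop) c2
  · rw [hint (fun x => |x| ^ 3) (by fun_prop)]
    exact h.integral_mul_le_of_le (by fun_prop) c3

end IsKacDensity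

lemma charFun_map_add_neg_one (μ : Measure ℝ) (t : ℝ) :
    charFun (μ.map (· + (-1))) t = charFun μ t * cexp (-(t * I)) := by
  rw [charFun_map_add_const]
  congr 2
  simp

lemma charInv_pow_natCast (μ : Measure ℝ) (N : ℕ) :
    charInv (fun t => charFun μ t ^ N) N =
      (2 * Real.pi : ℝ)⁻¹ * ∫ t, charFun (μ.map (· + (-1))) t ^ N := by
  rw [charInv]
  congr 1
  refine integral_congr_ae (ae_of_all _ fun t => ?_)
  simp only
  rw [charFun_map_add_neg_one, mul_pow, ← Complex.exp_nat_mul]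
  congr 2
  push_cast
  ring

lemma norm_charFun_map_add_neg_one (μ : Measure ℝ) (t : ℝ) :
    ‖charFun (μ.map (· + (-1))) t‖ = ‖charFun μ t‖ := by
  rw [charFun_map_add_neg_one, norm_mul, ← neg_mul, ← ofReal_neg, norm_exp_ofReal_mul_I, mul_one]

lemma norm_cexp_sub_charFun_le {ν : Measure ℝ} {W : ℝ} (h : IsCenteredWithThirdMoment ν W)
    (hW : 1 ≤ W) (t v : ℝ) :
    ‖cexp (t * (v ^ 2 - 1) * I) - charFun ν t‖ ≤ (2 + 2 * W) * (1 + v ^ 2) * min 1 |t| := by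
  have := h.isProb
  have hv := sq_nonneg v
  have ht := abs_nonneg t
  have h1 : ‖cexp (t * (v ^ 2 - 1) * I) - 1‖ ≤ 2 * (1 + v ^ 2) * min 1 |t| := by
    rw [show (t * (v ^ 2 - 1) * I : ℂ) = I * ((t * (v ^ 2 - 1) : ℝ) : ℂ) by push_cast; ring]
    rcases le_total 1 |t| with h1 | h1
    · rw [min_eq_left h1]
      refine (norm_sub_le _ _).trans ?_
      rw [mul_comm I, norm_exp_ofReal_mul_I, norm_one]
      linarith
    · rw [min_eq_right h1]
      refine Real.norm_exp_I_mul_ofReal_sub_one_le.trans ?_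
      rw [Real.norm_eq_abs, abs_mul]
      have : |v ^ 2 - 1| ≤ 1 + v ^ 2 := abs_le.2 ⟨by linarith, by linarith⟩
      nlinarith
  have h2 : ‖1 - charFun ν t‖ ≤ 2 * W * min 1 |t| := by
    rcases le_total 1 |t| with h1 | h1
    · rw [min_eq_left h1]
      exact norm_one_sub_charFun_le_two.trans (by linarith)
    · rw [min_eq_right h1]
      have h3 := norm_charFun_sub_le ν h.integrable_id.abs 0 t
      rw [charFun_zero, probReal_univ, ofReal_one, zero_sub, abs_neg] at h3
      refine h3.trans ?_
      have := h.abs_le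
      nlinarith
  have h3 := norm_sub_le_norm_sub_add_norm_sub (cexp (t * (v ^ 2 - 1) * I)) 1 (charFun ν t)
  have hm : 0 ≤ min 1 |t| := by positivity
  have h4 : 2 * W * min 1 |t| ≤ 2 * W * (1 + v ^ 2) * min 1 |t| := by
    gcongr ?_ * _
    nlinarith
  linarith

/-- The density of the sum of `N` squares at `N + 1 - v ^ 2` is close to that of `N + 1` squares at
`N + 1`: in Fourier variables the two differ by the factors `e^{it(v ^ 2 - 1)}` and `charFun ν t`,
both `1 + O(t)`. -/
lemma norm_charInv_sub_charInv_le {μ : Measure ℝ} [IsProbabilityMeasure μ] {W C : ℝ}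
    (h : IsCenteredWithThirdMoment (μ.map (· + (-1))) W) (hW : 1 ≤ W) {N : ℕ}
    (hi : Integrable fun t => charFun (μ.map (· + (-1))) t ^ N)
    (hC : ∫ t, ‖charFun (μ.map (· + (-1))) t‖ ^ N * min 1 |t| ≤ C) (v : ℝ) :
    ‖charInv (fun t => charFun μ t ^ N) ((N + 1 : ℕ) - v ^ 2) -
      charInv (fun t => charFun μ t ^ (N + 1)) (N + 1 : ℕ)‖ ≤ (2 + 2 * W) * (1 + v ^ 2) * C := by
  set ν := μ.map (· + (-1 : ℝ)) with hν
  have := h.isProb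
  have hmeas : Measurable fun t => charFun ν t := measurable_charFun
  have hexp : ∀ t : ℝ, charFun μ t ^ N * cexp (-(t * (((N + 1 : ℕ) - v ^ 2 : ℝ) : ℂ) * I)) =
      charFun ν t ^ N * cexp (t * (v ^ 2 - 1) * I) := by
    intro t
    rw [hν, charFun_map_add_neg_one, mul_pow, ← Complex.exp_nat_mul,
      mul_assoc (charFun μ t ^ N), ← Complex.exp_add]
    congr 2
    push_cast
    ring
  have hi1 : Integrable fun t : ℝ => charFun ν t ^ N * cexp (t * (v ^ 2 - 1) * I) := by
    refine hi.mono (hi.aestronglyMeasurable.mul (by fun_prop)) (ae_of_all _ fun t => ?_)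
    rw [norm_mul, ← ofReal_one, ← ofReal_pow, ← ofReal_sub, ← ofReal_mul, norm_exp_ofReal_mul_I,
      mul_one]
  have hi2 : Integrable fun t : ℝ => charFun ν t ^ (N + 1) := by
    refine hi.mono (hmeas.pow_const _).aestronglyMeasurable (ae_of_all _ fun t => ?_)
    rw [norm_pow, norm_pow]
    exact pow_le_pow_of_le_one (norm_nonneg _) (norm_charFun_le_one t) N.le_succ
  have hi3 : Integrable fun t : ℝ => ‖charFun ν t‖ ^ N * min 1 |t| := by
    refine hi.norm.mono (((hmeas.norm.pow_const N).mul (by fun_prop)).aestronglyMeasurable)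
      (ae_of_all _ fun t => ?_)
    rw [norm_mul, norm_pow, norm_norm, norm_norm, norm_pow, Real.norm_of_nonneg (by positivity)]
    exact mul_le_of_le_one_right (by positivity) (min_le_left _ _)
  rw [charInv_pow_natCast, charInv, ← mul_sub, norm_mul]
  have hpi : ‖(((2 * Real.pi : ℝ)⁻¹ : ℝ) : ℂ)‖ ≤ 1 := by
    rw [norm_real, Real.norm_of_nonneg (by positivity)]
    exact inv_le_one_of_one_le₀ (by linarith [Real.pi_gt_three])
  simp_rw [hexp]
  rw [← integral_sub hi1 hi2]
  have hmain : ‖∫ t : ℝ, (charFun ν t ^ N * cexp (t * (v ^ 2 - 1) * I) - charFun ν t ^ (N + 1))‖ ≤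
      (2 + 2 * W) * (1 + v ^ 2) * C := by
    calc _ ≤ ∫ t : ℝ, (2 + 2 * W) * (1 + v ^ 2) * (‖charFun ν t‖ ^ N * min 1 |t|) := by
          refine norm_integral_le_of_norm_le (hi3.const_mul _) (ae_of_all _ fun t => ?_)
          rw [pow_succ (charFun ν t), ← mul_sub, norm_mul, norm_pow]
          have := norm_cexp_sub_charFun_le h hW t v
          calc _ ≤ ‖charFun ν t‖ ^ N * ((2 + 2 * W) * (1 + v ^ 2) * min 1 |t|) := by gcongr
            _ = _ := by ring
      _ ≤ _ := by
          rw [integral_const_mul]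
          gcongr
  calc _ ≤ 1 * ‖∫ t : ℝ, (charFun ν t ^ N * cexp (t * (v ^ 2 - 1) * I) -
        charFun ν t ^ (N + 1))‖ := by
        gcongr
    _ ≤ _ := by rwa [one_mul]

/-- The two facts about the densities of sums of squares used for the entropy: size between
`c / √N` and `D` at the mean, and the comparison of neighbouring densities with error of order
`1 / N`. -/
theorem exists_sumDensity_estimates {q : ℝ} (hq : 1 < q) (B M : ℝ) :
    ∃ (c C D : ℝ) (N₁ : ℕ), 0 < c ∧ 0 < C ∧ 0 < D ∧ ∀ f : ℝ → ℝ, IsKacDensity q B M f →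
      ∀ n : ℕ, N₁ ≤ n →
        sumDensity f (n + 3) (n + 3 : ℕ) ≠ ∞ ∧
        c / √(n + 3 : ℕ) ≤ (sumDensity f (n + 3) (n + 3 : ℕ)).toReal ∧
        (sumDensity f (n + 3) (n + 3 : ℕ)).toReal ≤ D ∧
        ∀ v : ℝ, sumDensity f (n + 2) ((n + 3 : ℕ) - v ^ 2) ≠ ∞ ∧
          |(sumDensity f (n + 2) ((n + 3 : ℕ) - v ^ 2)).toReal -
            (sumDensity f (n + 3) (n + 3 : ℕ)).toReal| ≤ C * (1 + v ^ 2) / (n + 3 : ℕ) := by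
  obtain ⟨m, D, hm, hD⟩ := exists_integral_norm_charFun_squareLaw_pow_le hq B
  rcases lt_or_ge M 1 with hM | hM
  · -- no such density exists
    exact ⟨1, 1, 1, 0, one_pos, one_pos, one_pos, fun f h => absurd h.one_le (not_le.2 hM)⟩
  obtain ⟨c, C, N₁, hc, hC, hest⟩ := exists_charFun_estimates hm D hM
  have hpi := Real.pi_pos
  refine ⟨(2 * Real.pi)⁻¹ * c, (2 + 2 * M) * C * 2, |D| + 1, max N₁ m, by positivity,
    by positivity, by positivity, fun f hf n hn => ?_⟩
  have hP := hf.isProbabilityMeasure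
  have hcent := hf.isCentered
  set μ := squareLaw f with hμ
  set ν := μ.map (· + (-1 : ℝ)) with hν
  obtain ⟨hi, hDf⟩ := hD f hf.measurable hf.nonneg hf.integral_eq_one hf.integrable_rpow
    hf.integral_rpow_le
  have hnorm : ∀ t, ‖charFun ν t‖ = ‖charFun μ t‖ := norm_charFun_map_add_neg_one μ
  have hest' := hest ν hcent (by simpa only [hnorm] using hi) (by simpa only [hnorm] using hDf)
  have hN₁ : N₁ ≤ n := (le_max_left _ _).trans hn
  have hmn : m ≤ n := (le_max_right _ _).trans hn
  have hint : ∀ k, n ≤ k → Integrable fun t => charFun μ t ^ k := by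
    intro k hk
    have h1 := (hest' k (hN₁.trans hk)).1
    refine h1.mono (measurable_charFun.pow_const _).aestronglyMeasurable (ae_of_all _ fun t => ?_)
    rw [norm_pow, norm_pow, hnorm]
  have e3 := sumDensity_eq_ofReal_charInv hf.measurable (n := n + 1) (hint _ (by omega))
    ((n + 3 : ℕ) : ℝ)
  rw [show n + 1 + 2 = n + 3 from rfl, ← hμ] at e3
  have e2 := sumDensity_eq_ofReal_charInv hf.measurable (n := n) (hint _ (by omega))
  rw [← hμ] at e2
  have hlow : (2 * Real.pi)⁻¹ * c / √(n + 3 : ℕ) ≤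
      (charInv (fun t => charFun μ t ^ (n + 3)) ((n + 3 : ℕ) : ℝ)).re := by
    rw [charInv_pow_natCast, re_ofReal_mul, mul_div_assoc]
    gcongr
    exact (hest' (n + 3) (by omega)).2.2
  refine ⟨by rw [e3]; exact ENNReal.ofReal_ne_top, ?_, ?_, fun v => ⟨by rw [e2]; exact
    ENNReal.ofReal_ne_top, ?_⟩⟩
  · rw [e3, ENNReal.toReal_ofReal (le_trans (by positivity) hlow)]
    exact hlow
  · rw [e3]
    rw [ENNReal.toReal_ofReal (le_trans (by positivity) hlow)]
    refine (le_abs_self _).trans ((abs_re_le_norm _).trans ((norm_charInv_le _ _).trans ?_))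
    have h1 : ∫ t, ‖charFun μ t ^ (n + 3)‖ ≤ |D| := by
      refine le_trans (integral_mono (hint _ (by omega)).norm hi fun t => ?_)
        (hDf.trans (le_abs_self D))
      simp only [norm_pow]
      exact pow_le_pow_of_le_one (norm_nonneg _) (norm_charFun_le_one t) (by omega)
    have h2 : (2 * Real.pi)⁻¹ ≤ 1 := inv_le_one_of_one_le₀ (by linarith [Real.pi_gt_three])
    calc _ ≤ 1 * |D| := by gcongr
      _ ≤ _ := by linarith
  · have h1 := norm_charInv_sub_charInv_le hcent hM (hest' (n + 2) (by omega)).1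
      (hest' (n + 2) (by omega)).2.1 v
    have h2 := (abs_re_le_norm _).trans h1
    rw [sub_re] at h2
    rw [e2, e3, ENNReal.toReal_ofReal', ENNReal.toReal_ofReal']
    refine (abs_max_sub_max_le_abs _ _ _).trans (h2.trans ?_)
    have h3 : C / (n + 2 : ℕ) ≤ 2 * C / (n + 3 : ℕ) := by
      rw [div_le_div_iff₀ (by positivity) (by positivity)]
      push_cast
      have : 0 ≤ C * n := by positivity
      nlinarith
    calc (2 + 2 * M) * (1 + v ^ 2) * (C / (n + 2 : ℕ))
        ≤ (2 + 2 * M) * (1 + v ^ 2) * (2 * C / (n + 3 : ℕ)) := by gcongr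
      _ = _ := by ring

end Fourier

/-! ### Weighted integrability of the entropy density -/

/-- Pointwise control of `y |log y| (1 + v ^ 2)` for the value `y = f v`. For `y ≥ 1` the logarithm
is bounded by a power; for `e^{-v²} ≤ y ≤ 1` it is at most `v ^ 2`; for smaller `y`,
`y |log y| ≤ 2 √y` is Gaussian small. -/
lemma mul_abs_log_mul_le {q y v : ℝ} (hq : 1 < q) (hy : 0 ≤ y) :
    y * |Real.log y| * (1 + v ^ 2) ≤
      3 / (2 * (q - 1)) * (y ^ q + (1 + v ^ 2) ^ 3 * y) + (1 + v ^ 2) ^ 3 * y +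
        2 * (1 + v ^ 2) * Real.exp (-(1 / 2) * v ^ 2) := by
  set w : ℝ := 1 + v ^ 2 with hw
  have hw1 : 1 ≤ w := by rw [hw]; linarith [sq_nonneg v]
  have hq1 : 0 < q - 1 := by linarith
  have t1 : 0 ≤ 3 / (2 * (q - 1)) * (y ^ q + w ^ 3 * y) := by positivity
  have t2 : 0 ≤ w ^ 3 * y := by positivity
  have t3 : 0 ≤ 2 * w * Real.exp (-(1 / 2) * v ^ 2) := by positivity
  rcases hy.eq_or_lt with h0 | hy0
  · rw [← h0] at t1 t2 ⊢
    simp only [zero_mul]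
    linarith
  rcases le_or_gt 1 y with h1 | h1
  · -- `log y ≤ y ^ e / e` with `e = 2 (q - 1) / 3`, and either `w ≤ y ^ (e / 2)` or `y ^ e ≤ w ^ 2`
    set e : ℝ := (q - 1) / 3 with he
    have he0 : 0 < e := by positivity
    have hlog : |Real.log y| ≤ 3 / (2 * (q - 1)) * (y ^ e) ^ 2 := by
      rw [abs_of_nonneg (Real.log_nonneg h1)]
      refine (Real.log_le_rpow_div hy (ε := 2 * e) (by positivity)).trans (le_of_eq ?_)
      rw [← Real.rpow_natCast, ← Real.rpow_mul hy, he]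
      push_cast
      rw [mul_comm (2 : ℝ) ((q - 1) / 3)]
      field_simp
    have hyq : y ^ q = y * (y ^ e) ^ 3 := by
      rw [← Real.rpow_natCast, ← Real.rpow_mul hy, ← Real.rpow_one_add' hy (by positivity), he]
      congr 1
      push_cast
      ring
    have hz : 0 < y ^ e := by positivity
    have hcub : (y ^ e) ^ 2 * w ≤ (y ^ e) ^ 3 + w ^ 3 := by
      rcases le_total w (y ^ e) with h | h
      · have : (y ^ e) ^ 2 * w ≤ (y ^ e) ^ 2 * y ^ e := by gcongr
        have : 0 ≤ w ^ 3 := by positivity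
        nlinarith
      · have : (y ^ e) ^ 2 * w ≤ w ^ 2 * w := by gcongr
        have : 0 ≤ (y ^ e) ^ 3 := by positivity
        nlinarith
    calc y * |Real.log y| * w ≤ y * (3 / (2 * (q - 1)) * (y ^ e) ^ 2) * w := by gcongr
      _ = 3 / (2 * (q - 1)) * y * ((y ^ e) ^ 2 * w) := by ring
      _ ≤ 3 / (2 * (q - 1)) * y * ((y ^ e) ^ 3 + w ^ 3) := by gcongr
      _ = 3 / (2 * (q - 1)) * (y ^ q + w ^ 3 * y) := by rw [hyq]; ring
      _ ≤ _ := by linarith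
  · have hneg : |Real.log y| = -Real.log y := abs_of_nonpos (Real.log_nonpos hy h1.le)
    rcases le_or_gt (Real.exp (-v ^ 2)) y with h2 | h2
    · have h3 : |Real.log y| ≤ w := by
        have := (Real.le_log_iff_exp_le hy0).2 h2
        rw [hneg, hw]
        linarith
      have h4 : y * |Real.log y| * w ≤ y * w * w := by gcongr
      have h5 : y * w * w ≤ w ^ 3 * y := by
        rw [show y * w * w = w ^ 2 * y by ring]
        gcongr 1
        exact pow_le_pow_right₀ hw1 (by norm_num)
      linarith
    · have hs : 0 < √y := Real.sqrt_pos.2 hy0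
      have h3 : |Real.log y| ≤ 2 / √y := by
        have h4 := Real.log_le_sub_one_of_pos (inv_pos.2 hs)
        rw [Real.log_inv, Real.log_sqrt hy] at h4
        rw [hneg, div_eq_mul_inv]
        linarith
      have h5 : y * |Real.log y| ≤ 2 * √y := by
        calc y * |Real.log y| ≤ y * (2 / √y) := by gcongr
          _ = 2 * √y := by
            nth_rewrite 1 [← Real.mul_self_sqrt hy]
            field_simp
      have h6 : √y ≤ Real.exp (-(1 / 2) * v ^ 2) := by
        rw [Real.sqrt_le_left (by positivity), ← Real.exp_nat_mul]
        refine h2.le.trans (le_of_eq ?_)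
        congr 1
        push_cast
        ring
      have h7 : y * |Real.log y| * w ≤ 2 * Real.exp (-(1 / 2) * v ^ 2) * w := by
        gcongr ?_ * _
        linarith
      linarith

theorem exists_integral_log_le {q : ℝ} (hq : 1 < q) (B M : ℝ) :
    ∃ E : ℝ, 0 < E ∧ ∀ f : ℝ → ℝ, IsKacDensity q B M f →
      (Integrable fun v => f v * |Real.log (f v)| * (1 + v ^ 2)) ∧
        ∫ v, f v * |Real.log (f v)| * (1 + v ^ 2) ≤ E := by
  have hq1 : 0 < q - 1 := by linarith
  have hG : Integrable fun v : ℝ => 2 * (1 + v ^ 2) * Real.exp (-(1 / 2) * v ^ 2) := by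
    have h0 := (integrable_abs_pow_mul_exp 0 (a := 1 / 2) (by norm_num)).const_mul 2
    have h2 := (integrable_abs_pow_mul_exp 2 (a := 1 / 2) (by norm_num)).const_mul 2
    refine (h0.add h2).congr (ae_of_all _ fun v => ?_)
    simp only [Pi.add_apply, sq_abs, pow_zero]
    ring
  refine ⟨3 / (2 * (q - 1)) * (|B| + |M|) + |M| +
    |∫ v : ℝ, 2 * (1 + v ^ 2) * Real.exp (-(1 / 2) * v ^ 2)| + 1, by positivity, fun f h => ?_⟩
  have hm := h.measurable
  have i1 : Integrable fun v => 3 / (2 * (q - 1)) * (f v ^ q + (1 + v ^ 2) ^ 3 * f v) :=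
    (h.integrable_rpow.add h.integrable_moment).const_mul _
  have i2 : Integrable fun v => 3 / (2 * (q - 1)) * (f v ^ q + (1 + v ^ 2) ^ 3 * f v) +
      (1 + v ^ 2) ^ 3 * f v := i1.add h.integrable_moment
  have i3 : Integrable fun v => 3 / (2 * (q - 1)) * (f v ^ q + (1 + v ^ 2) ^ 3 * f v) +
      (1 + v ^ 2) ^ 3 * f v + 2 * (1 + v ^ 2) * Real.exp (-(1 / 2) * v ^ 2) := i2.add hG
  have hle : ∀ v, f v * |Real.log (f v)| * (1 + v ^ 2) ≤ _ := fun v =>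
    mul_abs_log_mul_le (v := v) hq (h.nonneg v)
  have hint : Integrable fun v => f v * |Real.log (f v)| * (1 + v ^ 2) := by
    refine i3.mono' (by fun_prop) (ae_of_all _ fun v => ?_)
    rw [Real.norm_of_nonneg]
    · exact hle v
    · have := h.nonneg v
      positivity
  refine ⟨hint, (integral_mono hint i3 hle).trans ?_⟩
  rw [integral_add i2 hG, integral_add i1 h.integrable_moment, integral_const_mul,
    integral_add h.integrable_rpow h.integrable_moment]
  have b1 := h.integral_rpow_le.trans (le_abs_self B)
  have b2 := h.integral_moment_le.trans (le_abs_self M)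
  have b3 := le_abs_self (∫ v : ℝ, 2 * (1 + v ^ 2) * Real.exp (-(1 / 2) * v ^ 2))
  have b4 : 3 / (2 * (q - 1)) * ((∫ v, f v ^ q) + ∫ v, (1 + v ^ 2) ^ 3 * f v) ≤
      3 / (2 * (q - 1)) * (|B| + |M|) := by gcongr
  linarith

/-! ### The conditioned product and its marginals -/

lemma tensorPower_perm (f : ℝ → ℝ) {N : ℕ} (e : Equiv.Perm (Fin N))
    (V : EuclideanSpace ℝ (Fin N)) :
    tensorPower f N (WithLp.toLp 2 fun i => V (e i)) = tensorPower f N V := by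
  simpa [tensorPower] using Equiv.prod_comp e fun i => ENNReal.ofReal (f (V i))

section ConditionedProduct

variable {f : ℝ → ℝ} {N : ℕ}

lemma lintegral_conditionedProduct (hf : Measurable f) {F : EuclideanSpace ℝ (Fin N) → ℝ≥0∞}
    (hF : Measurable F) :
    ∫⁻ V, F V ∂(conditionedProduct f N) =
      (partitionFunction f N √N)⁻¹ * ∫⁻ V, F V * tensorPower f N V ∂(kacMeasure N) := by
  rw [conditionedProduct, lintegral_smul_measure, smul_eq_mul,
    lintegral_withDensity_eq_lintegral_mul _ (measurable_tensorPower hf N) hF]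
  simp only [Pi.mul_apply, mul_comm]

lemma conditionedProduct_eq_withDensity (f : ℝ → ℝ) (h0 : partitionFunction f N √N ≠ 0) :
    conditionedProduct f N =
      (kacMeasure N).withDensity ((partitionFunction f N √N)⁻¹ • tensorPower f N) := by
  rw [conditionedProduct, withDensity_smul' _ _ (ENNReal.inv_ne_top.2 h0)]

lemma isProbabilityMeasure_conditionedProduct (h0 : partitionFunction f N √N ≠ 0)
    (h1 : partitionFunction f N √N ≠ ∞) : IsProbabilityMeasure (conditionedProduct f N) := by
  constructor
  rw [conditionedProduct, Measure.smul_apply, withDensity_apply _ MeasurableSet.univ,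
    Measure.restrict_univ, smul_eq_mul]
  exact ENNReal.inv_mul_cancel h0 h1

lemma isSymmetricOnKacSphere_conditionedProduct (hf : Measurable f)
    (h0 : partitionFunction f N √N ≠ 0) (h1 : partitionFunction f N √N ≠ ∞) :
    IsSymmetricOnKacSphere N (conditionedProduct f N) where
  isProbability := isProbabilityMeasure_conditionedProduct h0 h1
  carried := by
    rw [conditionedProduct_eq_withDensity f h0]
    refine (withDensity_absolutelyContinuous _ _).ae_le ?_
    filter_upwards [ae_uniformSphere_sum_sq (n := N) (r := √N)] with V hV
    rw [hV, Real.sq_sqrt (by positivity)]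
  symmetric e := by
    refine Measure.ext_of_lintegral _ fun (F : EuclideanSpace ℝ (Fin N) → ℝ≥0∞) hF => ?_
    have hT := measurable_tensorPower hf N
    have hm : Measurable fun V : EuclideanSpace ℝ (Fin N) =>
        (WithLp.toLp 2 fun i => V (e i) : EuclideanSpace ℝ (Fin N)) := by fun_prop
    have h2 := lintegral_map (μ := kacMeasure N) (f := fun V => F V * tensorPower f N V)
      (by fun_prop) hm
    rw [kacMeasure, uniformSphere_map_perm] at h2
    simp_rw [tensorPower_perm] at h2
    refine (lintegral_map hF hm).trans ((lintegral_conditionedProduct hf (hF.comp hm)).trans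
      (Eq.trans ?_ (lintegral_conditionedProduct hf hF).symm))
    exact congrArg _ h2.symm

end ConditionedProduct

section Marginal

variable {f : ℝ → ℝ} {n : ℕ}

/-- On Kac's sphere `fiberMeasure` is a finite nonzero multiple `a` of the uniform measure, with `a`
independent of `f`. -/
lemma exists_sumDensity_eq_mul_partitionFunction (n : ℕ) :
    ∃ a : ℝ≥0∞, a ≠ 0 ∧ a ≠ ∞ ∧ fiberMeasure (n + 1) (n + 1 : ℕ) = a • kacMeasure (n + 1) ∧
      ∀ f : ℝ → ℝ, sumDensity f (n + 1) (n + 1 : ℕ) =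
        a * partitionFunction f (n + 1) √(n + 1 : ℕ) := by
  refine ⟨_, mul_ne_zero ?_ (toSphere_univ_ne_zero n),
    ENNReal.mul_ne_top ENNReal.ofReal_ne_top (toSphere_univ_ne_top _),
    fiberMeasure_eq_smul_uniformSphere n _, fun f => sumDensity_eq_mul_partitionFunction f n _⟩
  rw [ENNReal.ofReal_ne_zero_iff]
  positivity

lemma partitionFunction_ne_zero (h0 : sumDensity f (n + 1) (n + 1 : ℕ) ≠ 0) :
    partitionFunction f (n + 1) √(n + 1 : ℕ) ≠ 0 := by
  obtain ⟨a, -, -, -, h⟩ := exists_sumDensity_eq_mul_partitionFunction n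
  exact right_ne_zero_of_mul (h f ▸ h0)

lemma partitionFunction_ne_top (h1 : sumDensity f (n + 1) (n + 1 : ℕ) ≠ ∞) :
    partitionFunction f (n + 1) √(n + 1 : ℕ) ≠ ∞ := by
  obtain ⟨a, ha0, -, -, h⟩ := exists_sumDensity_eq_mul_partitionFunction n
  intro hZ
  rw [h f, hZ, ENNReal.mul_top ha0] at h1
  exact h1 rfl

/-- The law of a coordinate under the conditioned product: `f(v) dv` with the ratio of two densities
of sums of squares as an additional factor. -/
lemma map_apply_conditionedProduct (hf : Measurable f)
    (h0 : sumDensity f (n + 3) (n + 3 : ℕ) ≠ 0) (h1 : sumDensity f (n + 3) (n + 3 : ℕ) ≠ ∞)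
    (i : Fin (n + 3)) :
    (conditionedProduct f (n + 3)).map (fun V => V i) =
      (densityMeasure f).withDensity fun v =>
        sumDensity f (n + 2) ((n + 3 : ℕ) - v ^ 2) / sumDensity f (n + 3) (n + 3 : ℕ) := by
  have hsymm : (conditionedProduct f (n + 3)).map (fun V => V i) =
      (conditionedProduct f (n + 3)).map (fun V => V 0) := by
    have hs := (isSymmetricOnKacSphere_conditionedProduct hf (partitionFunction_ne_zero h0)
      (partitionFunction_ne_top h1)).symmetric (Equiv.swap 0 i)
    conv_lhs => rw [← hs]
    rw [Measure.map_map (g := fun V : EuclideanSpace ℝ (Fin (n + 3)) => V i) (by fun_prop)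
      (by fun_prop)]
    congr 1
    ext V
    simp
  rw [hsymm]
  refine Measure.ext_of_lintegral _ fun (φ : ℝ → ℝ≥0∞) hφ => ?_
  have hS := measurable_sumDensity hf (n + 2)
  have hT := measurable_tensorPower hf (n + 3)
  obtain ⟨a, ha0, ha1, hfib, hsum⟩ := exists_sumDensity_eq_mul_partitionFunction (n + 2)
  rw [lintegral_map hφ (by fun_prop), lintegral_conditionedProduct hf (by fun_prop),
    densityMeasure, ← withDensity_mul _ (by fun_prop) (by fun_prop),
    lintegral_withDensity_eq_lintegral_mul _ (by fun_prop) hφ]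
  have hmain : ∫⁻ V : EuclideanSpace ℝ (Fin (n + 3)), φ (V 0) * tensorPower f (n + 3) V
      ∂(fiberMeasure (n + 3) (n + 3 : ℕ)) =
      ∫⁻ v, φ v * (ENNReal.ofReal (f v) * sumDensity f (n + 2) ((n + 3 : ℕ) - v ^ 2)) :=
    lintegral_coord_mul_tensorPower hf (n + 1) hφ (by positivity)
  have hfib' : fiberMeasure (n + 3) (n + 3 : ℕ) = a • kacMeasure (n + 3) := hfib
  rw [hfib', lintegral_smul_measure, smul_eq_mul] at hmain
  have hsum' : sumDensity f (n + 3) (n + 3 : ℕ) =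
      a * partitionFunction f (n + 3) √(n + 3 : ℕ) := hsum f
  -- `S⁻¹ = (a Z)⁻¹`, so that the constant `a` disappears from the normalised marginal
  have hcancel : (partitionFunction f (n + 3) √(n + 3 : ℕ))⁻¹ =
      (sumDensity f (n + 3) (n + 3 : ℕ))⁻¹ * a := by
    rw [hsum', ENNReal.mul_inv (.inl ha0) (.inl ha1), mul_comm a⁻¹, mul_assoc,
      ENNReal.inv_mul_cancel ha0 ha1, mul_one]
  rw [hcancel, mul_assoc, hmain, ← lintegral_const_mul _ (by fun_prop)]
  refine lintegral_congr fun v => ?_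
  simp only [Pi.mul_apply, div_eq_mul_inv]
  ring

end Marginal

lemma integral_densityMeasure {f : ℝ → ℝ} (hf : Measurable f) (h0 : ∀ v, 0 ≤ f v) (g : ℝ → ℝ) :
    ∫ v, g v ∂(densityMeasure f) = ∫ v, f v * g v := by
  rw [densityMeasure, integral_withDensity_eq_integral_toReal_smul (by fun_prop) (by simp)]
  simp [ENNReal.toReal_ofReal (h0 _)]

lemma integrable_densityMeasure_iff {f : ℝ → ℝ} (hf : Measurable f) (h0 : ∀ v, 0 ≤ f v)
    {g : ℝ → ℝ} : Integrable g (densityMeasure f) ↔ Integrable fun v => f v * g v := by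
  rw [densityMeasure, integrable_withDensity_iff_integrable_smul' (by fun_prop) (by simp)]
  simp [ENNReal.toReal_ofReal (h0 _)]

/-- A measure `ϑ f dv` whose factor `ϑ` differs from `1` by at most `K (1 + v ^ 2)` integrates `g`
as `f dv` does, up to a multiple of `K`. -/
lemma integrable_withDensity_and_abs_integral_sub_le {f g : ℝ → ℝ} {ϑ : ℝ → ℝ≥0∞} {K : ℝ}
    (hf : Measurable f) (h0 : ∀ v, 0 ≤ f v) (hg : Measurable g) (hϑ : Measurable ϑ)
    (hϑ' : ∀ v, ϑ v ≠ ∞) (hb : ∀ v, |(ϑ v).toReal - 1| ≤ K * (1 + v ^ 2))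
    (hi : Integrable fun v => f v * |g v| * (1 + v ^ 2)) :
    Integrable g ((densityMeasure f).withDensity ϑ) ∧
      |∫ v, g v ∂((densityMeasure f).withDensity ϑ) - ∫ v, f v * g v| ≤
        K * ∫ v, f v * |g v| * (1 + v ^ 2) := by
  have htop : ∀ᵐ v ∂(densityMeasure f), ϑ v < ∞ := ae_of_all _ fun v => (hϑ' v).lt_top
  have i0 : Integrable fun v => f v * g v := by
    refine hi.mono' (by fun_prop) (ae_of_all _ fun v => ?_)
    have := h0 v
    rw [Real.norm_eq_abs, abs_mul, abs_of_nonneg this]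
    exact le_mul_of_one_le_right (by positivity) (by linarith [sq_nonneg v])
  have hle : ∀ v, ‖f v * (((ϑ v).toReal - 1) * g v)‖ ≤ K * (f v * |g v| * (1 + v ^ 2)) := by
    intro v
    have := h0 v
    rw [Real.norm_eq_abs, abs_mul, abs_mul, abs_of_nonneg this]
    calc f v * (|(ϑ v).toReal - 1| * |g v|) ≤ f v * (K * (1 + v ^ 2) * |g v|) := by
          gcongr
          exact hb v
      _ = _ := by ring
  have i1 : Integrable fun v => f v * (((ϑ v).toReal - 1) * g v) :=
    (hi.const_mul K).mono' (by fun_prop) (ae_of_all _ hle)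
  have i2 : Integrable fun v => f v * ((ϑ v).toReal * g v) :=
    (i1.add i0).congr (ae_of_all _ fun v => by simp only [Pi.add_apply]; ring)
  constructor
  · rw [integrable_withDensity_iff_integrable_smul' hϑ htop]
    simpa [integrable_densityMeasure_iff hf h0] using i2
  · rw [integral_withDensity_eq_integral_toReal_smul hϑ htop]
    simp only [smul_eq_mul]
    rw [integral_densityMeasure hf h0, ← integral_sub i2 i0, ← integral_const_mul,
      ← Real.norm_eq_abs]
    refine norm_integral_le_of_norm_le (hi.const_mul K) (ae_of_all _ fun v => ?_)
    rw [← mul_sub, ← sub_one_mul]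
    exact hle v

/-- The divergence from `σ` of a probability measure with density `h`, as the integral of `log h`.
The representative `g` of `log h` is constrained only where `h ≠ 0`. -/
lemma klDiv_withDensity {α : Type*} {mα : MeasurableSpace α} {σ : Measure α} {h : α → ℝ≥0∞}
    [IsProbabilityMeasure σ] [IsProbabilityMeasure (σ.withDensity h)] (hh : Measurable h)
    {g : α → ℝ} (hg : ∀ x, h x ≠ 0 → Real.log (h x).toReal = g x)
    (hi : Integrable g (σ.withDensity h)) :
    InformationTheory.klDiv (σ.withDensity h) σ ≠ ∞ ∧
      (InformationTheory.klDiv (σ.withDensity h) σ).toReal = ∫ x, g x ∂(σ.withDensity h) := by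
  have hac := withDensity_absolutelyContinuous σ h
  have hllr : llr (σ.withDensity h) σ =ᵐ[σ.withDensity h] g := by
    have h1 := hac.ae_le (Measure.rnDeriv_withDensity σ hh)
    have h2 : ∀ᵐ x ∂(σ.withDensity h), h x ≠ 0 :=
      (ae_withDensity_iff hh).2 (ae_of_all _ fun x hx => hx)
    filter_upwards [h1, h2] with x hx1 hx2
    rw [llr_def]
    simp only [hx1]
    exact hg x hx2
  refine ⟨InformationTheory.klDiv_ne_top hac (hi.congr hllr.symm), ?_⟩
  rw [InformationTheory.toReal_klDiv_of_measure_eq hac (by simp), integral_congr_ae hllr]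

/-! ### Entropy formulas -/

lemma gaussianPDFReal_zero_one (v : ℝ) :
    gaussianPDFReal 0 1 v = (√(2 * Real.pi))⁻¹ * Real.exp (-(1 / 2) * v ^ 2) := by
  rw [gaussianPDFReal]
  congr 2
  · simp
  · simp
    ring

lemma log_gaussianPDFReal (v : ℝ) :
    Real.log (gaussianPDFReal 0 1 v) = -Real.log √(2 * Real.pi) - 1 / 2 * v ^ 2 := by
  rw [gaussianPDFReal_zero_one, Real.log_mul (by positivity) (by positivity), Real.log_inv,
    Real.log_exp]
  ring

lemma isKacDensity_gaussianPDFReal :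
    IsKacDensity 2 1 (∫ v, (1 + v ^ 2) ^ 3 * gaussianPDFReal 0 1 v) (gaussianPDFReal 0 1) := by
  have hm := measurable_gaussianPDFReal 0 1
  have h0 := gaussianPDFReal_nonneg 0 1
  have h1 : ∀ v, gaussianPDFReal 0 1 v ≤ 1 := fun v => by
    rw [gaussianPDFReal_zero_one]
    refine mul_le_one₀ (inv_le_one_of_one_le₀ ?_) (Real.exp_pos _).le
      (Real.exp_le_one_iff.2 (by nlinarith [sq_nonneg v]))
    rw [Real.one_le_sqrt]
    linarith [Real.pi_gt_three]
  have hi := integrable_gaussianPDFReal 0 1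
  have hle : ∀ v, gaussianPDFReal 0 1 v ^ (2 : ℝ) ≤ gaussianPDFReal 0 1 v := fun v => by
    rw [Real.rpow_two]
    exact pow_le_of_le_one (h0 v) (h1 v) two_ne_zero
  have hi2 : Integrable fun v => gaussianPDFReal 0 1 v ^ (2 : ℝ) := by
    refine hi.mono' (hm.pow_const _).aestronglyMeasurable (ae_of_all _ fun v => ?_)
    rw [Real.norm_of_nonneg (by have := h0 v; positivity)]
    exact hle v
  refine ⟨hm, h0, integral_gaussianPDFReal_eq_one 0 one_ne_zero, hi2, ?_, ?_, le_rfl, ?_⟩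
  · exact (integral_mono hi2 hi hle).trans (integral_gaussianPDFReal_eq_one 0 one_ne_zero).le
  · have hk := fun k => integrable_abs_pow_mul_exp k (a := 1 / 2) (by norm_num)
    refine ((((hk 0).add ((hk 2).const_mul 3)).add (((hk 4).const_mul 3).add (hk 6))).const_mul
      (√(2 * Real.pi))⁻¹).congr (ae_of_all _ fun v => ?_)
    simp only [Pi.add_apply, gaussianPDFReal_zero_one]
    rw [pow_abs v 4, pow_abs v 6, abs_of_nonneg (a := v ^ 4) (by positivity),
      abs_of_nonneg (a := v ^ 6) (by positivity), sq_abs, pow_zero]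
    ring
  · have hv := variance_fun_id_gaussianReal (μ := 0) (v := 1)
    rw [variance_of_integral_eq_zero (by fun_prop) (by simp)] at hv
    rw [integral_gaussianReal_eq_integral_smul one_ne_zero] at hv
    simpa using hv

section Entropy

variable {q B M : ℝ} {f : ℝ → ℝ}

lemma isProbabilityMeasure_densityMeasure (h0 : ∀ v, 0 ≤ f v) (h1 : ∫ v, f v = 1) :
    IsProbabilityMeasure (densityMeasure f) := by
  constructor
  have hi : Integrable f := .of_integral_ne_zero (by simp [h1])
  rw [densityMeasure, withDensity_apply _ MeasurableSet.univ, Measure.restrict_univ,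
    ← ofReal_integral_eq_lintegral_ofReal hi (ae_of_all _ h0), h1, ENNReal.ofReal_one]

lemma IsKacDensity.relEntropyGaussian_eq (h : IsKacDensity q B M f)
    (hi : Integrable fun v => f v * Real.log (f v)) :
    relEntropyGaussian (densityMeasure f) ≠ ∞ ∧
      (relEntropyGaussian (densityMeasure f)).toReal =
        (∫ v, f v * Real.log (f v)) + Real.log √(2 * Real.pi) + 1 / 2 := by
  have hf := h.measurable
  have hP := isProbabilityMeasure_densityMeasure h.nonneg h.integral_eq_one
  have hpdf := fun v => gaussianPDFReal_pos 0 1 v one_ne_zero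
  set k : ℝ → ℝ≥0∞ := fun v => ENNReal.ofReal (f v / gaussianPDFReal 0 1 v) with hk
  have hmk : Measurable k := by fun_prop
  have hd : densityMeasure f = (gaussianReal 0 1).withDensity k := by
    rw [gaussianReal_of_var_ne_zero 0 one_ne_zero, ← withDensity_mul _ (by fun_prop) hmk,
      densityMeasure]
    congr 1
    ext v
    rw [Pi.mul_apply, gaussianPDF, hk, ← ENNReal.ofReal_mul (hpdf v).le,
      mul_div_cancel₀ _ (hpdf v).ne']
  have hen : Integrable fun v => f v * v ^ 2 := .of_integral_ne_zero (by simp [h.energy])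
  have hi2 : Integrable fun v => f v * Real.log (f v) + f v * Real.log √(2 * Real.pi) :=
    hi.add (h.integrable.mul_const _)
  have hi3 : Integrable fun v => f v * v ^ 2 * (1 / 2) := hen.mul_const _
  have hfun : (fun v => f v * (Real.log (f v) + Real.log √(2 * Real.pi) + 1 / 2 * v ^ 2)) =
      fun v => f v * Real.log (f v) + f v * Real.log √(2 * Real.pi) + f v * v ^ 2 * (1 / 2) := by
    ext v
    ring
  have hlog : ∀ v, k v ≠ 0 → Real.log (k v).toReal =
      Real.log (f v) + Real.log √(2 * Real.pi) + 1 / 2 * v ^ 2 := by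
    intro v hv
    have hfv : f v ≠ 0 := by
      intro h0
      simp [hk, h0] at hv
    rw [hk]
    simp only
    rw [ENNReal.toReal_ofReal (div_nonneg (h.nonneg v) (hpdf v).le), Real.log_div hfv
      (hpdf v).ne', log_gaussianPDFReal]
    ring
  have hint : Integrable (fun v => Real.log (f v) + Real.log √(2 * Real.pi) + 1 / 2 * v ^ 2)
      (densityMeasure f) := by
    rw [integrable_densityMeasure_iff hf h.nonneg, hfun]
    exact hi2.add hi3
  have hP' : IsProbabilityMeasure ((gaussianReal 0 1).withDensity k) := hd ▸ hP
  have hkl := klDiv_withDensity hmk hlog (hd ▸ hint)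
  rw [← hd] at hkl
  refine ⟨hkl.1, hkl.2.trans ?_⟩
  rw [integral_densityMeasure hf h.nonneg, hfun, integral_add hi2 hi3,
    integral_add hi (h.integrable.mul_const _), integral_mul_const, integral_mul_const, h.energy,
    h.integral_eq_one]
  ring

/-- The Gaussian tensor power is constant on Kac's sphere. -/
lemma partitionFunction_gaussianPDFReal (n : ℕ) :
    partitionFunction (gaussianPDFReal 0 1) (n + 1) √(n + 1 : ℕ) =
      ENNReal.ofReal (((√(2 * Real.pi))⁻¹ * Real.exp (-(1 / 2))) ^ (n + 1)) := by
  have hconst : ∀ᵐ V ∂(uniformSphere (n + 1) √(n + 1 : ℕ)),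
      tensorPower (gaussianPDFReal 0 1) (n + 1) V =
        ENNReal.ofReal (((√(2 * Real.pi))⁻¹ * Real.exp (-(1 / 2))) ^ (n + 1)) := by
    filter_upwards [ae_uniformSphere_sum_sq] with V hV
    rw [Real.sq_sqrt (by positivity)] at hV
    rw [tensorPower, ← ENNReal.ofReal_prod_of_nonneg fun i _ => gaussianPDFReal_nonneg 0 1 _]
    congr 1
    simp_rw [gaussianPDFReal_zero_one]
    rw [Finset.prod_mul_distrib, Finset.prod_const, ← Real.exp_sum, ← Finset.mul_sum, hV,
      Finset.card_univ, Fintype.card_fin, mul_pow, ← Real.exp_nat_mul]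
    congr 2
    ring
  rw [partitionFunction, lintegral_congr_ae hconst, lintegral_const, measure_univ, mul_one]

/-- The normalised entropy of the conditioned product is the integral of `log f` against its first
marginal, minus `(1 / N) log Z`. -/
lemma relEntropy_conditionedProduct {n : ℕ} (hf : Measurable f)
    (h0 : partitionFunction f (n + 1) √(n + 1 : ℕ) ≠ 0)
    (h1 : partitionFunction f (n + 1) √(n + 1 : ℕ) ≠ ∞) {J : ℝ}
    (hi : ∀ i, Integrable (fun v => Real.log (f v))
      ((conditionedProduct f (n + 1)).map fun V => V i))
    (hJ : ∀ i, ∫ v, Real.log (f v) ∂((conditionedProduct f (n + 1)).map fun V => V i) = J) :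
    relEntropy (n + 1) (conditionedProduct f (n + 1)) (kacMeasure (n + 1)) ≠ ∞ ∧
      (relEntropy (n + 1) (conditionedProduct f (n + 1)) (kacMeasure (n + 1))).toReal =
        J - Real.log (partitionFunction f (n + 1) √(n + 1 : ℕ)).toReal / (n + 1 : ℕ) := by
  set Z := partitionFunction f (n + 1) √(n + 1 : ℕ) with hZ
  have hσ : IsProbabilityMeasure (kacMeasure (n + 1)) := isProbabilityMeasure_uniformSphere n _
  have hd := conditionedProduct_eq_withDensity f h0
  have hP : IsProbabilityMeasure (conditionedProduct f (n + 1)) :=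
    isProbabilityMeasure_conditionedProduct h0 h1
  have hT := measurable_tensorPower hf (n + 1)
  have hP' : IsProbabilityMeasure
      ((kacMeasure (n + 1)).withDensity (Z⁻¹ • tensorPower f (n + 1))) := hd ▸ hP
  have hlog : ∀ V : EuclideanSpace ℝ (Fin (n + 1)), (Z⁻¹ • tensorPower f (n + 1)) V ≠ 0 →
      Real.log ((Z⁻¹ • tensorPower f (n + 1)) V).toReal =
        ∑ i, Real.log (f (V i)) - Real.log Z.toReal := by
    intro V hV
    rw [Pi.smul_apply, smul_eq_mul] at hV ⊢
    have hpos : ∀ i, 0 < f (V i) := fun i =>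
      ENNReal.ofReal_pos.1 ((Finset.prod_ne_zero_iff.1 (right_ne_zero_of_mul hV) i
        (Finset.mem_univ i)).bot_lt)
    rw [ENNReal.toReal_mul, ENNReal.toReal_inv, tensorPower, ENNReal.toReal_prod]
    simp_rw [ENNReal.toReal_ofReal (hpos _).le]
    rw [Real.log_mul (inv_ne_zero (ENNReal.toReal_ne_zero.2 ⟨h0, h1⟩))
      (Finset.prod_ne_zero_iff.2 fun i _ => (hpos i).ne'), Real.log_inv,
      Real.log_prod fun i _ => (hpos i).ne']
    ring
  have hcoord : ∀ i, Integrable (fun V : EuclideanSpace ℝ (Fin (n + 1)) => Real.log (f (V i)))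
      (conditionedProduct f (n + 1)) := fun i =>
    (integrable_map_measure (g := fun v => Real.log (f v))
      (hf.log.aestronglyMeasurable) (by fun_prop)).1 (hi i)
  have hcoordJ : ∀ i, ∫ V, Real.log (f (V i)) ∂(conditionedProduct f (n + 1)) = J := fun i => by
    rw [← hJ i, integral_map (by fun_prop) hf.log.aestronglyMeasurable]
  have hsum : Integrable (fun V : EuclideanSpace ℝ (Fin (n + 1)) => ∑ i, Real.log (f (V i)))
      (conditionedProduct f (n + 1)) := integrable_finsetSum _ fun i _ => hcoord i
  have hkl := klDiv_withDensity (hT.const_smul _) hlog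
    (by rw [← hd]; exact hsum.sub (integrable_const _))
  rw [← hd] at hkl
  refine ⟨ENNReal.div_ne_top hkl.1 (by simp), ?_⟩
  rw [relEntropy, ENNReal.toReal_div, hkl.2, integral_sub hsum (integrable_const _),
    integral_finsetSum _ fun i _ => hcoord i, Finset.sum_congr rfl fun i _ => hcoordJ i]
  simp only [Finset.sum_const, Finset.card_univ, Fintype.card_fin, nsmul_eq_mul,
    ENNReal.toReal_natCast, integral_const, probReal_univ, one_smul]
  field_simp

end Entropy

/-- Comparison of `f` with the Gaussian, which cancels the geometric factor of the sphere: the ratio of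
the partition functions is the ratio of the densities of sums of squares. -/
lemma log_partitionFunction {f : ℝ → ℝ} {n : ℕ}
    (h0 : sumDensity f (n + 1) (n + 1 : ℕ) ≠ 0) (h1 : sumDensity f (n + 1) (n + 1 : ℕ) ≠ ∞) :
    Real.log (partitionFunction f (n + 1) √(n + 1 : ℕ)).toReal =
      Real.log (sumDensity f (n + 1) (n + 1 : ℕ)).toReal -
        Real.log (sumDensity (gaussianPDFReal 0 1) (n + 1) (n + 1 : ℕ)).toReal -
          (n + 1 : ℕ) * (Real.log √(2 * Real.pi) + 1 / 2) := by
  obtain ⟨a, ha0, ha1, -, h⟩ := exists_sumDensity_eq_mul_partitionFunction n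
  have ha : a.toReal ≠ 0 := ENNReal.toReal_ne_zero.2 ⟨ha0, ha1⟩
  have hZ : (partitionFunction f (n + 1) √(n + 1 : ℕ)).toReal ≠ 0 := ENNReal.toReal_ne_zero.2
    ⟨partitionFunction_ne_zero h0, partitionFunction_ne_top h1⟩
  rw [h, h, partitionFunction_gaussianPDFReal, ENNReal.toReal_mul, ENNReal.toReal_mul,
    ENNReal.toReal_ofReal (by positivity), Real.log_mul ha hZ, Real.log_mul ha (by positivity),
    Real.log_pow, Real.log_mul (by positivity) (by positivity), Real.log_inv, Real.log_exp]
  ring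

lemma abs_log_le_mul_sqrt {c D s r : ℝ} (hc : 0 < c) (hr : 1 ≤ r) (h1 : c / r ≤ s) (h2 : s ≤ D) :
    |Real.log s| ≤ (D + 1 / c) * r := by
  have hr0 : 0 < r := by linarith
  have hs : 0 < s := lt_of_lt_of_le (by positivity) h1
  have h3 := Real.log_le_sub_one_of_pos hs
  have h4 := Real.log_le_sub_one_of_pos (inv_pos.2 hs)
  rw [Real.log_inv] at h4
  have h5 : s⁻¹ ≤ 1 / c * r := by
    calc s⁻¹ ≤ (c / r)⁻¹ := by gcongr
      _ = 1 / c * r := by field_simp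
  have h6 : 0 ≤ 1 / c * r := by positivity
  have h7 : D ≤ D * r := le_mul_of_one_le_right (by linarith) hr
  have h8 : 0 ≤ D * r := mul_nonneg (by linarith) hr0.le
  rw [abs_le, add_mul]
  constructor <;> linarith

/-! ### Convergence of the entropy -/

/-- Both the entropy and the first marginal of the conditioned product converge at rate `1 / √N`,
uniformly over densities with the same `q`, `B` and `M`. -/
theorem exists_entropy_estimates {q : ℝ} (hq : 1 < q) (B M : ℝ) :
    ∃ (C K : ℝ) (N₀ : ℕ), ∀ f : ℝ → ℝ, IsKacDensity q B M f →
      relEntropyGaussian (densityMeasure f) ≠ ∞ ∧ ∀ N : ℕ, N₀ ≤ N →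
        partitionFunction f N √N ≠ 0 ∧ partitionFunction f N √N ≠ ∞ ∧
        relEntropy N (conditionedProduct f N) (kacMeasure N) ≠ ∞ ∧
        |(relEntropy N (conditionedProduct f N) (kacMeasure N)).toReal -
          (relEntropyGaussian (densityMeasure f)).toReal| ≤ C / √N ∧
        ∀ φ : ℝ →ᵇ ℝ, |∫ v, φ v ∂(firstMarginal N (conditionedProduct f N)) -
          ∫ v, φ v ∂(densityMeasure f)| ≤ K * ‖φ‖ / √N := by
  obtain ⟨c, C, D, N₁, hc, hC, hD, hS⟩ := exists_sumDensity_estimates hq B M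
  obtain ⟨c', C', D', N₂, hc', hC', hD', hS'⟩ := exists_sumDensity_estimates one_lt_two 1
    (∫ v, (1 + v ^ 2) ^ 3 * gaussianPDFReal 0 1 v)
  obtain ⟨E, hE, hlog⟩ := exists_integral_log_le hq B M
  refine ⟨C / c * E + (D + 1 / c + (D' + 1 / c')), C / c * 2, max N₁ N₂ + 3, fun f h => ?_⟩
  have hf := h.measurable
  obtain ⟨hE1, hE2⟩ := hlog f h
  have hlf : Integrable fun v => f v * Real.log (f v) := by
    refine hE1.mono' (by fun_prop) (ae_of_all _ fun v => ?_)
    have := h.nonneg v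
    rw [Real.norm_eq_abs, abs_mul, abs_of_nonneg this]
    exact le_mul_of_one_le_right (by positivity) (by linarith [sq_nonneg v])
  obtain ⟨hG1, hG2⟩ := h.relEntropyGaussian_eq hlf
  refine ⟨hG1, fun N hN => ?_⟩
  obtain ⟨n, rfl⟩ : ∃ n, N = n + 3 := ⟨N - 3, by omega⟩
  obtain ⟨s1, s2, s3, s4⟩ := hS f h n (by omega)
  obtain ⟨g1, g2, g3, -⟩ := hS' _ isKacDensity_gaussianPDFReal n (by omega)
  set r : ℝ := √(n + 3 : ℕ) with hr
  have hr1 : 1 ≤ r := by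
    rw [hr, Real.one_le_sqrt]
    push_cast
    linarith [n.cast_nonneg (α := ℝ)]
  have hr0 : 0 < r := by linarith
  have hrr : ((n + 3 : ℕ) : ℝ) = r * r := (Real.mul_self_sqrt (by positivity)).symm
  have spos : 0 < (sumDensity f (n + 3) (n + 3 : ℕ)).toReal :=
    lt_of_lt_of_le (by positivity) s2
  have s0 : sumDensity f (n + 3) (n + 3 : ℕ) ≠ 0 :=
    (ENNReal.toReal_pos_iff.1 spos).1.ne'
  have hZ0 := partitionFunction_ne_zero (n := n + 2) s0
  have hZ1 := partitionFunction_ne_top (n := n + 2) s1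
  set ϑ : ℝ → ℝ≥0∞ := fun v =>
    sumDensity f (n + 2) ((n + 3 : ℕ) - v ^ 2) / sumDensity f (n + 3) (n + 3 : ℕ) with hϑ
  have hϑm : Measurable ϑ := by
    have := measurable_sumDensity hf (n + 2)
    fun_prop
  have hϑt : ∀ v, ϑ v ≠ ∞ := fun v => ENNReal.div_ne_top (s4 v).1 s0
  -- the numerator is of order `1 / N` and the denominator of order `1 / √N`
  have hϑb : ∀ v, |(ϑ v).toReal - 1| ≤ C / c / r * (1 + v ^ 2) := by
    intro v
    rw [hϑ]
    simp only
    rw [ENNReal.toReal_div, div_sub_one spos.ne', abs_div, abs_of_pos spos]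
    calc _ ≤ C * (1 + v ^ 2) / (n + 3 : ℕ) / (c / r) := by
          gcongr
          exact (s4 v).2
      _ = _ := by
          rw [hrr]
          field_simp
  have hmarg := map_apply_conditionedProduct hf s0 s1
  have hdiff : ∀ g : ℝ → ℝ, Measurable g → (Integrable fun v => f v * |g v| * (1 + v ^ 2)) →
      _ := fun g hg => integrable_withDensity_and_abs_integral_sub_le (g := g) hf h.nonneg hg hϑm
        hϑt hϑb
  refine ⟨hZ0, hZ1, ?_⟩
  obtain ⟨l1, l2⟩ := hdiff (fun v => Real.log (f v)) hf.log hE1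
  obtain ⟨e1, e2⟩ := relEntropy_conditionedProduct (n := n + 2) hf hZ0 hZ1
    (fun i => (hmarg i).symm ▸ l1) (fun i => by rw [hmarg i])
  refine ⟨e1, ?_, fun φ => ?_⟩
  · have k1 := abs_log_le_mul_sqrt hc hr1 s2 s3
    have k2 := abs_log_le_mul_sqrt hc' hr1 g2 g3
    have k3 := log_partitionFunction (n := n + 2) s0 s1
    rw [show n + 2 + 1 = n + 3 from rfl] at e2 k3
    rw [e2, hG2, k3]
    set S := Real.log (sumDensity f (n + 3) (n + 3 : ℕ)).toReal
    set S' := Real.log (sumDensity (gaussianPDFReal 0 1) (n + 3) (n + 3 : ℕ)).toReal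
    set J := ∫ v, Real.log (f v) ∂((densityMeasure f).withDensity ϑ)
    -- only `|log S| = O(√N)` is needed, because of the factor `1 / N`
    have k4 : |S - S'| ≤ (D + 1 / c + (D' + 1 / c')) * r := by
      refine (abs_sub _ _).trans ?_
      linarith
    have k5 : |(S - S') / (n + 3 : ℕ)| ≤ (D + 1 / c + (D' + 1 / c')) / r := by
      rw [abs_div, Nat.abs_cast, hrr, div_le_div_iff₀ (by positivity) hr0]
      nlinarith
    have k6 : |J - ∫ v, f v * Real.log (f v)| ≤ C / c * E / r := by
      refine l2.trans ?_
      calc _ ≤ C / c / r * E := by gcongr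
        _ = _ := by ring
    have k7 : J - (S - S' - (n + 3 : ℕ) * (Real.log √(2 * Real.pi) + 1 / 2)) / (n + 3 : ℕ) -
        ((∫ v, f v * Real.log (f v)) + Real.log √(2 * Real.pi) + 1 / 2) =
        (J - ∫ v, f v * Real.log (f v)) - (S - S') / (n + 3 : ℕ) := by
      have : ((n + 3 : ℕ) : ℝ) ≠ 0 := by positivity
      field_simp
      ring
    rw [k7, add_div]
    exact (abs_sub _ _).trans (add_le_add k6 k5)
  · have hle : ∀ v, f v * |φ v| * (1 + v ^ 2) ≤ ‖φ‖ * (f v + f v * v ^ 2) := fun v => by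
      have h1 := h.nonneg v
      have h2 : |φ v| ≤ ‖φ‖ := φ.norm_coe_le_norm v
      calc f v * |φ v| * (1 + v ^ 2) ≤ f v * ‖φ‖ * (1 + v ^ 2) := by gcongr
        _ = _ := by ring
    have hen : Integrable fun v => f v * v ^ 2 := .of_integral_ne_zero (by simp [h.energy])
    have hφm : Measurable φ := φ.continuous.measurable
    have hi : Integrable fun v => ‖φ‖ * (f v + f v * v ^ 2) :=
      (h.integrable.add hen).const_mul _
    have hφi : Integrable fun v => f v * |φ v| * (1 + v ^ 2) := by
      refine hi.mono' (by fun_prop) (ae_of_all _ fun v => ?_)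
      rw [Real.norm_of_nonneg]
      · exact hle v
      · have := h.nonneg v
        positivity
    have hφb : ∫ v, f v * |φ v| * (1 + v ^ 2) ≤ ‖φ‖ * 2 := by
      refine (integral_mono hφi hi hle).trans (le_of_eq ?_)
      rw [integral_const_mul, integral_add h.integrable hen, h.integral_eq_one, h.energy]
      norm_num
    obtain ⟨-, m2⟩ := hdiff φ hφm hφi
    rw [firstMarginal, dif_pos (by omega), hmarg, integral_densityMeasure hf h.nonneg]
    refine m2.trans ?_
    calc _ ≤ C / c / r * (‖φ‖ * 2) := by gcongr
      _ = _ := by ring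

theorem isEntropyChaotic_conditionedProduct {q B M : ℝ} (hq : 1 < q) {f : ℝ → ℝ}
    (h : IsKacDensity q B M f) : IsEntropyChaotic (conditionedProduct f) (densityMeasure f) := by
  obtain ⟨C, K, N₀, hest⟩ := exists_entropy_estimates hq B M
  obtain ⟨hfin, hN⟩ := hest f h
  have hlim : ∀ a : ℝ, Tendsto (fun N : ℕ => a / √(N : ℝ)) atTop (𝓝 0) := fun a =>
    (Real.tendsto_sqrt_atTop.comp tendsto_natCast_atTop_atTop).const_div_atTop a
  refine ⟨?_, fun φ => ?_, ?_, hfin.lt_top⟩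
  · filter_upwards [eventually_ge_atTop N₀] with N hN'
    exact isSymmetricOnKacSphere_conditionedProduct h.measurable (hN N hN').1 (hN N hN').2.1
  · rw [tendsto_iff_norm_sub_tendsto_zero]
    refine squeeze_zero' (.of_forall fun _ => norm_nonneg _) ?_ (hlim (K * ‖φ‖))
    filter_upwards [eventually_ge_atTop N₀] with N hN'
    exact (hN N hN').2.2.2.2 φ
  · have h1 : Tendsto (fun N => (relEntropy N (conditionedProduct f N) (kacMeasure N)).toReal)
        atTop (𝓝 (relEntropyGaussian (densityMeasure f)).toReal) := by
      rw [tendsto_iff_norm_sub_tendsto_zero]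
      refine squeeze_zero' (.of_forall fun _ => norm_nonneg _) ?_ (hlim C)
      filter_upwards [eventually_ge_atTop N₀] with N hN'
      exact (hN N hN').2.2.2.1
    have h2 := ENNReal.tendsto_ofReal h1
    rw [ENNReal.ofReal_toReal hfin] at h2
    refine h2.congr' ?_
    filter_upwards [eventually_ge_atTop N₀] with N hN'
    exact ENNReal.ofReal_toReal (hN N hN').2.2.1

/-- A finite exponent for which `f ∈ L^p` gives control of `∫ f ^ q`: `p` itself if finite, and `2`
for `p = ∞`. -/
noncomputable def finiteExponent (p : ℝ≥0∞) : ℝ := if p = ∞ then 2 else p.toReal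

/-- The bound on `∫ f ^ q`, with `q = finiteExponent p`, for a probability density of norm `A` in
`L^p`; for `p = ∞` it comes from `f ^ 2 ≤ A f`. -/
noncomputable def rpowBound (p : ℝ≥0∞) (A : ℝ) : ℝ := if p = ∞ then A else A ^ p.toReal

lemma one_lt_finiteExponent {p : ℝ≥0∞} (hp : 1 < p) : 1 < finiteExponent p := by
  unfold finiteExponent
  split_ifs with h
  · exact one_lt_two
  · rwa [← ENNReal.toReal_one, ENNReal.toReal_lt_toReal (by simp) h]

lemma isKacDensity_of_memLp {p : ℝ≥0∞} {f : ℝ → ℝ} (hp : 1 < p) (hf : Measurable f)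
    (h0 : ∀ v, 0 ≤ f v) (h1 : ∫ v, f v = 1)
    (hi : Integrable fun v => √(1 + v ^ 2) ^ 6 * f v) (hL : MemLp f p volume)
    (he : ∫ v, f v * v ^ 2 = 1) :
    IsKacDensity (finiteExponent p) (rpowBound p (eLpNorm f p volume).toReal) (moment 6 f) f := by
  have hm : ∀ v : ℝ, √(1 + v ^ 2) ^ 6 = (1 + v ^ 2) ^ 3 := fun v => by
    rw [show 6 = 2 * 3 from rfl, pow_mul, Real.sq_sqrt (by positivity)]
  simp_rw [hm] at hi
  have key : (Integrable fun v => f v ^ finiteExponent p) ∧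
      ∫ v, f v ^ finiteExponent p ≤ rpowBound p (eLpNorm f p volume).toReal := by
    have hint : Integrable f := .of_integral_ne_zero (by simp [h1])
    unfold finiteExponent rpowBound
    split_ifs with h
    · subst h
      set A := (eLpNorm f ∞ volume).toReal
      have hle : ∀ᵐ v, f v ^ (2 : ℝ) ≤ A * f v := by
        filter_upwards [ae_le_eLpNormEssSup (f := f) (μ := volume)] with v hv
        rw [← eLpNorm_exponent_top] at hv
        have h2 := ENNReal.toReal_mono hL.eLpNorm_ne_top hv
        rw [toReal_enorm, Real.norm_of_nonneg (h0 v)] at h2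
        rw [Real.rpow_two, sq]
        exact mul_le_mul_of_nonneg_right h2 (h0 v)
      have h2 : Integrable fun v => f v ^ (2 : ℝ) := by
        refine (hint.const_mul A).mono' (hf.pow_const _).aestronglyMeasurable ?_
        filter_upwards [hle] with v hv
        rwa [Real.norm_of_nonneg (by have := h0 v; positivity)]
      refine ⟨h2, (integral_mono_ae h2 (hint.const_mul A) hle).trans (le_of_eq ?_)⟩
      rw [integral_const_mul, h1, mul_one]
    · have hp0 : p ≠ 0 := (zero_lt_one.trans hp).ne'
      have hpr : 0 < p.toReal := ENNReal.toReal_pos hp0 h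
      have h2 := hL.integrable_norm_rpow hp0 h
      simp_rw [Real.norm_of_nonneg (h0 _)] at h2
      refine ⟨h2, le_of_eq ?_⟩
      have h3 := hL.eLpNorm_eq_integral_rpow_norm hp0 h
      simp_rw [Real.norm_of_nonneg (h0 _)] at h3
      have h4 : 0 ≤ ∫ v, f v ^ p.toReal := integral_nonneg fun v => by
        have := h0 v
        positivity
      rw [h3, ENNReal.toReal_ofReal (by positivity), ← Real.rpow_mul h4,
        inv_mul_cancel₀ hpr.ne', Real.rpow_one]
  exact ⟨hf, h0, h1, key.1, key.2, hi, by rw [moment]; simp_rw [hm]; exact le_rfl, he⟩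

end KacSphere

theorem mainTheorem12 :
    ∃ (C : ℝ≥0∞ → ℝ → ℝ → ℝ) (N₀ : ℝ≥0∞ → ℝ → ℝ → ℕ),
      ∀ (p : ℝ≥0∞) (f : ℝ → ℝ),
        1 < p →
        Measurable f → (∀ v, 0 ≤ f v) → ∫ v, f v = 1 →
        Integrable (fun v => Real.sqrt (1 + v ^ 2) ^ 6 * f v) →
        MemLp f p volume →
        ∫ v, f v * v = 0 → ∫ v, f v * v ^ 2 = 1 →
        KacSphere.IsEntropyChaotic (KacSphere.conditionedProduct f) (KacSphere.densityMeasure f) ∧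
        ∀ N : ℕ, N₀ p (eLpNorm f p volume).toReal (KacSphere.moment 6 f) ≤ N →
          0 < KacSphere.partitionFunction f N (Real.sqrt N) ∧
          KacSphere.partitionFunction f N (Real.sqrt N) < ∞ ∧
          KacSphere.relEntropy N (KacSphere.conditionedProduct f N) (KacSphere.kacMeasure N) < ∞ ∧
          |(KacSphere.relEntropy N (KacSphere.conditionedProduct f N)
                (KacSphere.kacMeasure N)).toReal
              - (KacSphere.relEntropyGaussian (KacSphere.densityMeasure f)).toReal|
            ≤ C p (eLpNorm f p volume).toReal (KacSphere.moment 6 f) / Real.sqrt N := by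
  have key : ∀ (p : ℝ≥0∞) (A M : ℝ), ∃ (C : ℝ) (N₀ : ℕ), 1 < p → ∀ f : ℝ → ℝ,
      KacSphere.IsKacDensity (KacSphere.finiteExponent p) (KacSphere.rpowBound p A) M f →
      ∀ N : ℕ, N₀ ≤ N →
        0 < KacSphere.partitionFunction f N √N ∧ KacSphere.partitionFunction f N √N < ∞ ∧
        KacSphere.relEntropy N (KacSphere.conditionedProduct f N) (KacSphere.kacMeasure N) < ∞ ∧
        |(KacSphere.relEntropy N (KacSphere.conditionedProduct f N)
            (KacSphere.kacMeasure N)).toReal -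
          (KacSphere.relEntropyGaussian (KacSphere.densityMeasure f)).toReal| ≤ C / √N := by
    intro p A M
    by_cases hp : 1 < p
    · obtain ⟨C, K, N₀, hest⟩ := KacSphere.exists_entropy_estimates
        (KacSphere.one_lt_finiteExponent hp) (KacSphere.rpowBound p A) M
      refine ⟨C, N₀, fun _ f hf N hN => ?_⟩
      obtain ⟨z0, z1, e, hC, -⟩ := (hest f hf).2 N hN
      exact ⟨z0.bot_lt, z1.lt_top, e.lt_top, hC⟩
    · exact ⟨0, 0, fun h => absurd h hp⟩
  choose C N₀ hest using key
  refine ⟨C, N₀, fun p f hp hf h0 h1 hi hL _ he => ?_⟩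
  have hK := KacSphere.isKacDensity_of_memLp hp hf h0 h1 hi hL he
  exact ⟨KacSphere.isEntropyChaotic_conditionedProduct (KacSphere.one_lt_finiteExponent hp) hK,
    hest p _ _ hp f hK⟩
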